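/- Let $H$ be a separable complex Hilbert space, $B(H)$ the Banach space of bounded operators on $H$ (regarded as a real Banach space), and $P(H)\subset B(H)$ the set of orthogonal projections. For a closed subspace $S\subseteq H$ let $P_S$ be the orthogonal projection onto $S$. Two closed subspaces $S,T$ have a common complement if there is a closed subspace $Z$ with $S\dotplus Z=T\dotplus Z=H$. Let $$\Gamma=\{(P_S,P_T)\in P(H)\times P(H): S,T\text{ have no common complement}\}.$$ For $0\le i,j\le\infty$ let $P_{i,j}$ be the set of orthogonal projections of rank $i$ and corank $j$. Let $\Gamma_{\infty,\infty}=\Gamma\cap(P_{\infty,\infty}\times P_{\infty,\infty})$, and - for $n\in\mathbb Z$, let $\Gamma_1^n$ be the set of $(P_S,P_T)\in\Gamma_{\infty,\infty}$ with $\dim (S\cap T^\perp)<\infty$, $\dim (S^\perp\cap T)<\infty$, such that $P_T|_S:S\to T$ is a Fredholm operator of index $n$; - $\Gamma_\infty^l=\{(P_S,P_T)\in\Gamma_{\infty,\infty}:\dim (S\cap T^\perp)<\infty,\ \dim (S^\perp\cap T)=\infty\}$; - $\Gamma_\infty^r=\{(P_S,P_T)\in\Gamma_{\infty,\infty}:\dim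 (S\cap T^\perp)=\infty,\ \dim (S^\perp\cap T)<\infty\}$. For subsets $M\subseteq N$ of a real Banach space $E$, call $M$ a $C^\infty$ submanifold of $N$ if around every $x\in M$ there is a $C^\infty$ diffeomorphism $\varphi:U\to V$ between open subsets of $E$, $x\in U$, and closed subspaces $F\subseteq G$ of $E$ with $\varphi(U\cap M)=V\cap F$ and $\varphi(U\cap N)=V\cap G$; it is complemented at $x$ if this can be done with $F$ complemented in $G$. (For $N=E$ one has $G=E$.) Then: 1. $\Gamma$ is closed in $B(H)\times B(H)$. 2. $\Gamma$ is the disjoint union of the sets $P_{i,j}\times P_{k,l}$ with $(i,j)\ne(k,l)$, the sets $\Gamma_1^n$ with $n\neq0$, and the sets $\Gamma_\infty^l$ and $\Gamma_\infty^r$; each of these pieces is relatively open in $\Gamma$. 3. $\Gamma$ and each of these pieces are $C^\infty$ submanifolds of $B(H)\times B(H)$ and of $P(H)\times P(H)$. 4. These submanifolds are non complemented: at every point of $\Gamma_1^n$ ($n\ne0$), of $\Gamma_\infty^l$ and of $\Gamma_\infty^r$, neither $\Gamma$ nor the piece is complemented, either in $B(H)\times B(H)$ or in $P(H)\times P(H)$.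 In particular, if $\dim H=\infty$, then $\Gamma$ is not a complemented submanifold of either of them. -/

import Mathlib

open scoped ContDiff

noncomputable section

/-! ### Submanifolds of Banach spaces, not assumed to be complemented -/

namespace BanachSub

variable {E : Type*} [NormedAddCommGroup E] [NormedSpace ℝ E]

/-- `φ` is a `C^∞` diffeomorphism between open subsets of `E`, defined around `x`, which
carries `N` to the closed subspace `G` and `M` to the closed subspace `F ⊆ G`
(inside the domain of `φ`). -/
structure IsFlattening (M N : Set E) (x : E) (φ : OpenPartialHomeomorph E E)
    (F G : Submodule ℝ E) : Prop where
  mem_source : x ∈ φ.source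
  contDiffOn : ContDiffOn ℝ ∞ φ φ.source
  contDiffOn_symm : ContDiffOn ℝ ∞ φ.symm φ.target
  isClosed_left : IsClosed (F : Set E)
  isClosed_right : IsClosed (G : Set E)
  le : F ≤ G
  mem_left_iff : ∀ y ∈ φ.source, y ∈ M ↔ φ y ∈ F
  mem_right_iff : ∀ y ∈ φ.source, y ∈ N ↔ φ y ∈ G

/-- `M` is a `C^∞` submanifold of `N ⊆ E`: around each point of `M` there is a chart of `E` adapted
to both `M` and `N`. No complement of the model subspace is required. For `N = Set.univ` the
subspace `G` is all of `E`, and this says that `M` is a submanifold of the Banach space `E`. -/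
def IsSubmanifoldOf (M N : Set E) : Prop :=
  M ⊆ N ∧ ∀ x ∈ M, ∃ (φ : OpenPartialHomeomorph E E) (F G : Submodule ℝ E),
    IsFlattening M N x φ F G

/-- `M` is a complemented submanifold of `N` near `x`: there is an adapted chart around `x` whose
model subspace `F` of `M` has a closed complement in the model subspace `G` of `N`. -/
def IsComplementedAt (M N : Set E) (x : E) : Prop :=
  ∃ (φ : OpenPartialHomeomorph E E) (F G : Submodule ℝ E),
    IsFlattening M N x φ F G ∧ (F.comap G.subtype).ClosedComplemented

end BanachSub

/-! ### Pairs of closed subspaces, as pairs of orthogonal projections -/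

namespace CommonCompl

section

variable {H : Type*} [NormedAddCommGroup H] [InnerProductSpace ℂ H]

/-- Two subspaces have a common (closed) complement. -/
def HasCommonComplement (S T : Submodule ℂ H) : Prop :=
  ∃ Z : Submodule ℂ H, IsClosed (Z : Set H) ∧ IsCompl S Z ∧ IsCompl T Z

/-- The dimension of a subspace, in `{0, 1, …, ∞}`. -/
def dim (S : Submodule ℂ H) : ℕ∞ :=
  Cardinal.toENat (Module.rank ℂ S)

/-- For operators `P`, `Q`, the operator `Q|_{R(P)} : R(P) → R(Q)`. -/
def restr (P Q : H →L[ℂ] H) : P.range →L[ℂ] Q.range :=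
  (Q.comp P.range.subtypeL).codRestrict Q.range fun x => ⟨(x : H), rfl⟩

/-- The index of a Fredholm operator: dimension of the kernel minus dimension of the cokernel. -/
def index {X Y : Type*} [NormedAddCommGroup X] [NormedSpace ℂ X] [NormedAddCommGroup Y]
    [NormedSpace ℂ Y] (A : X →L[ℂ] Y) : ℤ :=
  (Module.finrank ℂ A.ker : ℤ) - (Module.finrank ℂ (Y ⧸ A.range) : ℤ)

end

variable (H : Type*) [NormedAddCommGroup H] [InnerProductSpace ℂ H] [CompleteSpace H]

/-- `P(H) × P(H)`: the pairs of orthogonal projections. -/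
def projPairs : Set ((H →L[ℂ] H) × (H →L[ℂ] H)) :=
  {p | IsStarProjection p.1 ∧ IsStarProjection p.2}

/-- `P_{i,j}`: the orthogonal projections of rank `i` and corank `j`. -/
def projOfRank (i j : ℕ∞) : Set (H →L[ℂ] H) :=
  {P | IsStarProjection P ∧ dim P.range = i ∧ dim P.rangeᗮ = j}

/-- `Γ`: the pairs `(P_S, P_T)` such that `S` and `T` have no common complement. -/
def Gam : Set ((H →L[ℂ] H) × (H →L[ℂ] H)) :=
  {p | p ∈ projPairs H ∧ ¬ HasCommonComplement p.1.range p.2.range}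

/-- The pairs in `Γ` of projections of infinite rank and corank. -/
def GamInfInf : Set ((H →L[ℂ] H) × (H →L[ℂ] H)) :=
  Gam H ∩ projOfRank H ⊤ ⊤ ×ˢ projOfRank H ⊤ ⊤

/-- `Γ_1`: the dimensions of `S ∩ T^⊥` and of `S^⊥ ∩ T` are both finite. -/
def Gam1 : Set ((H →L[ℂ] H) × (H →L[ℂ] H)) :=
  {p | p ∈ GamInfInf H ∧ dim (p.1.range ⊓ p.2.rangeᗮ) < ⊤ ∧ dim (p.1.rangeᗮ ⊓ p.2.range) < ⊤}

/-- `Γ_1^n`: the pairs in `Γ_1` for which `P_T|_S : S → T` is Fredholm of index `n`. -/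
def Gam1n (n : ℤ) : Set ((H →L[ℂ] H) × (H →L[ℂ] H)) :=
  {p | p ∈ Gam1 H ∧ (restr p.1 p.2).IsFredholm ∧ index (restr p.1 p.2) = n}

/-- `Γ_∞^l`: `dim S ∩ T^⊥ < ∞` and `dim S^⊥ ∩ T = ∞`. -/
def GamInfL : Set ((H →L[ℂ] H) × (H →L[ℂ] H)) :=
  {p | p ∈ GamInfInf H ∧ dim (p.1.range ⊓ p.2.rangeᗮ) < ⊤ ∧ dim (p.1.rangeᗮ ⊓ p.2.range) = ⊤}

/-- `Γ_∞^r`: `dim S ∩ T^⊥ = ∞` and `dim S^⊥ ∩ T < ∞`. -/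
def GamInfR : Set ((H →L[ℂ] H) × (H →L[ℂ] H)) :=
  {p | p ∈ GamInfInf H ∧ dim (p.1.range ⊓ p.2.rangeᗮ) = ⊤ ∧ dim (p.1.rangeᗮ ⊓ p.2.range) < ⊤}

/-- The labels of the pieces of `Γ`. -/
inductive PieceIndex : Type
  | full (i j k l : ℕ∞) (h : (i, j) ≠ (k, l)) : PieceIndex
  | fredholm (n : ℤ) (h : n ≠ 0) : PieceIndex
  | left : PieceIndex
  | right : PieceIndex

/-- The pieces of `Γ`. -/
def piece : PieceIndex → Set ((H →L[ℂ] H) × (H →L[ℂ] H))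
  | .full i j k l _ => projOfRank H i j ×ˢ projOfRank H k l
  | .fredholm n _ => Gam1n H n
  | .left => GamInfL H
  | .right => GamInfR H

end CommonCompl

end

/-!
Two closed subspaces `S`, `T` with orthogonal projections `P`, `Q` have a common complement exactly
when there are idempotents with ranges `S` and `T` and a common kernel, a condition that is stable
under perturbation; hence `Γ` is closed. Every pair in `Γ` has one of `(1 - Q) P` and `(1 - P) Q`
compact. If `(1 - Q) P` is compact, a spectral projection of `(P - Q) ^ 2` splits off the part of
`H` on which `P` and `Q` are far apart, on which `P` has finite rank; the ranks `m < ∞` and `n` of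
`P` and `Q` there have a difference which does not depend on choices and is locally constant, and
`S`, `T` have a common complement if and only if `m = n`. So the pieces are open in `Γ`, and near a
pair of `Γ` with `(1 - Q) P` compact the set `Γ` consists of the pairs of projections with this
property.

Describing the projections near `P` and `Q` as graphs of operators `k : S → Sᗮ` and `l : T → Tᗮ`,
this compactness becomes, after a shear, the linear condition that `(1 - Q) k` is compact. If `S`
and `Tᗮ` are infinite-dimensional, a complement of the space of these `k` would, by restriction to
diagonal operators, split `c₀` off `ℓ^∞`. This is impossible, since there are uncountably many
infinite subsets of `ℕ` with finite pairwise intersections.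
-/

noncomputable section

/-! ### Charts of submanifolds -/

namespace BanachSub

open Topology Filter

variable {E E' : Type*} [NormedAddCommGroup E] [NormedSpace ℝ E] [NormedAddCommGroup E']
  [NormedSpace ℝ E'] {M N M' N' : Set E} {x : E} {φ ψ : OpenPartialHomeomorph E E}
  {F G F' G' : Submodule ℝ E}

theorem IsFlattening.restrOpen (h : IsFlattening M N x φ F G) {U : Set E} (hU : IsOpen U)
    (hx : x ∈ U) (hM : ∀ y ∈ U, y ∈ M' ↔ y ∈ M) (hN : ∀ y ∈ U, y ∈ N' ↔ y ∈ N) :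
    IsFlattening M' N' x (φ.restrOpen U hU) F G where
  mem_source := ⟨h.mem_source, hx⟩
  contDiffOn := h.contDiffOn.mono Set.inter_subset_left
  contDiffOn_symm := h.contDiffOn_symm.mono Set.inter_subset_left
  isClosed_left := h.isClosed_left
  isClosed_right := h.isClosed_right
  le := h.le
  mem_left_iff y hy := (hM y hy.2).trans (h.mem_left_iff y hy.1)
  mem_right_iff y hy := (hN y hy.2).trans (h.mem_right_iff y hy.1)

theorem IsFlattening.univ (h : IsFlattening M N x φ F G) : IsFlattening M Set.univ x φ F ⊤ :=
  { h with
    isClosed_right := isClosed_univ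
    le := le_top
    mem_right_iff := by simp }

theorem IsFlattening.preimage (h : IsFlattening M N x φ F G) (e : E ≃L[ℝ] E) :
    IsFlattening (e ⁻¹' M) (e ⁻¹' N) (e.symm x)
      ((e.toHomeomorph.toOpenPartialHomeomorph.trans φ).trans
        e.symm.toHomeomorph.toOpenPartialHomeomorph)
      (F.comap (e : E →ₗ[ℝ] E)) (G.comap (e : E →ₗ[ℝ] E)) where
  mem_source := by simpa using h.mem_source
  contDiffOn := by
    have hφ : ContDiffOn ℝ ∞ (fun y => φ (e y)) (e ⁻¹' φ.source) :=
      h.contDiffOn.comp e.contDiff.contDiffOn fun y hy => hy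
    exact (e.symm.contDiff.comp_contDiffOn hφ).mono fun y hy => by simpa using hy
  contDiffOn_symm := by
    have hφ : ContDiffOn ℝ ∞ (fun y => φ.symm (e y)) (e ⁻¹' φ.target) :=
      h.contDiffOn_symm.comp e.contDiff.contDiffOn fun y hy => hy
    exact (e.symm.contDiff.comp_contDiffOn hφ).mono fun y hy => by simpa using hy
  isClosed_left := h.isClosed_left.preimage e.continuous
  isClosed_right := h.isClosed_right.preimage e.continuous
  le := Submodule.comap_mono h.le
  mem_left_iff y hy := by simpa using h.mem_left_iff (e y) (by simpa using hy)
  mem_right_iff y hy := by simpa using h.mem_right_iff (e y) (by simpa using hy)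

theorem IsSubmanifoldOf.inter_isOpen {U : Set E} (h : IsSubmanifoldOf M N) (hU : IsOpen U) :
    IsSubmanifoldOf (M ∩ U) N := by
  refine ⟨Set.inter_subset_left.trans h.1, fun x hx => ?_⟩
  obtain ⟨φ, F, G, hφ⟩ := h.2 x hx.1
  exact ⟨_, F, G, hφ.restrOpen hU hx.2 (fun y hy => and_iff_left hy) fun _ _ => Iff.rfl⟩

theorem IsSubmanifoldOf.univ (h : IsSubmanifoldOf M N) : IsSubmanifoldOf M Set.univ := by
  refine ⟨Set.subset_univ M, fun x hx => ?_⟩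
  obtain ⟨φ, F, G, hφ⟩ := h.2 x hx
  exact ⟨φ, F, ⊤, hφ.univ⟩

theorem IsComplementedAt.congr (h : IsComplementedAt M N x) {U : Set E} (hU : IsOpen U)
    (hx : x ∈ U) (hM : ∀ y ∈ U, y ∈ M' ↔ y ∈ M) : IsComplementedAt M' N x := by
  obtain ⟨φ, F, G, hφ, hc⟩ := h
  exact ⟨_, F, G, hφ.restrOpen hU hx hM fun _ _ => Iff.rfl, hc⟩

theorem closedComplemented_comap_subtype_iff (h : F ≤ G) :
    (F.comap G.subtype).ClosedComplemented ↔
      ∃ π : G →L[ℝ] E, (∀ v, π v ∈ F) ∧ ∀ v : G, (v : E) ∈ F → π v = v := by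
  constructor
  · rintro ⟨π, hπ⟩
    exact ⟨G.subtypeL ∘L (F.comap G.subtype).subtypeL ∘L π, fun v => (π v).2,
      fun v hv => congrArg (fun w : F.comap G.subtype => ((w : G) : E)) (hπ ⟨v, hv⟩)⟩
  · rintro ⟨π, hπF, hπ⟩
    exact ⟨(π.codRestrict G fun v => h (hπF v)).codRestrict _ hπF,
      fun v => Subtype.ext (Subtype.ext (hπ v v.2))⟩

theorem IsComplementedAt.preimage (h : IsComplementedAt M N x) (e : E ≃L[ℝ] E) :
    IsComplementedAt (e ⁻¹' M) (e ⁻¹' N) (e.symm x) := by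
  obtain ⟨φ, F, G, hφ, hc⟩ := h
  obtain ⟨π, hπF, hπ⟩ := (closedComplemented_comap_subtype_iff hφ.le).1 hc
  refine ⟨_, _, _, hφ.preimage e, (closedComplemented_comap_subtype_iff
    (Submodule.comap_mono hφ.le)).2 ⟨e.symm.toContinuousLinearMap ∘L π ∘L
      ((e.toContinuousLinearMap ∘L Submodule.subtypeL _).codRestrict G fun v => v.2),
      fun v => ?_, fun v hv => ?_⟩⟩
  · simpa using hπF _
  · exact e.symm_apply_eq.2 (hπ _ hv)

theorem map_mem_of_hasFDerivAt {f : E → E'} {L : E →L[ℝ] E'} {a : E} (hf : HasFDerivAt f L a)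
    {F : Submodule ℝ E} {F' : Submodule ℝ E'} (hF' : IsClosed (F' : Set E')) (ha : a ∈ F)
    (h : ∀ᶠ y in 𝓝 a, y ∈ F → f y ∈ F') {v : E} (hv : v ∈ F) : L v ∈ F' := by
  have hline : HasDerivAt (fun t : ℝ => a + t • v) v 0 := by
    simpa using ((hasDerivAt_id (0 : ℝ)).smul_const v).const_add a
  have hline0 : a + (0 : ℝ) • v = a := by simp
  have hslope := hasDerivAt_iff_tendsto_slope.1
    ((hline0.symm ▸ hf : HasFDerivAt f L (a + (0 : ℝ) • v)).comp_hasDerivAt (0 : ℝ) hline)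
  have hnear : ∀ᶠ t : ℝ in 𝓝 0, a + t • v ∈ F → f (a + t • v) ∈ F' :=
    hline.continuousAt.eventually (hline0.symm ▸ h)
  refine hF'.mem_of_tendsto hslope (hnear.filter_mono nhdsWithin_le_nhds |>.mono fun t ht => ?_)
  have hfa : f (a + (0 : ℝ) • v) ∈ F' := hline0.symm ▸ h.self_of_nhds ha
  exact F'.smul_mem _ (F'.sub_mem (ht (F.add_mem ha (F.smul_mem t hv))) hfa)

theorem exists_hasFDerivAt_equiv {f : OpenPartialHomeomorph E E'} {a : E} (ha : a ∈ f.source)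
    (hf : DifferentiableAt ℝ f a) (hf' : DifferentiableAt ℝ f.symm (f a)) :
    ∃ L : E ≃L[ℝ] E', HasFDerivAt f (L : E →L[ℝ] E') a ∧
      HasFDerivAt f.symm (L.symm : E' →L[ℝ] E) (f a) := by
  have hleft : fderiv ℝ f.symm (f a) ∘L fderiv ℝ f a = .id ℝ E :=
    (hf'.hasFDerivAt.comp a hf.hasFDerivAt).unique
      ((hasFDerivAt_id a).congr_of_eventuallyEq (f.eventually_left_inverse ha))
  have hf'' : HasFDerivAt f (fderiv ℝ f a) (f.symm (f a)) := by
    rw [f.left_inv ha]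
    exact hf.hasFDerivAt
  have hright : fderiv ℝ f a ∘L fderiv ℝ f.symm (f a) = .id ℝ E' :=
    (hf''.comp (f a) hf'.hasFDerivAt).unique
      ((hasFDerivAt_id (f a)).congr_of_eventuallyEq (f.eventually_right_inverse' ha))
  exact ⟨.equivOfInverse _ _ (DFunLike.congr_fun hleft) (DFunLike.congr_fun hright),
    hf.hasFDerivAt, hf'.hasFDerivAt⟩

theorem apply_mem_iff_of_hasFDerivAt {f : OpenPartialHomeomorph E E'} {a : E} (ha : a ∈ f.source)
    {L : E ≃L[ℝ] E'} (hL : HasFDerivAt f (L : E →L[ℝ] E') a)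
    (hL' : HasFDerivAt f.symm (L.symm : E' →L[ℝ] E) (f a)) {F : Submodule ℝ E}
    {F' : Submodule ℝ E'} (hF : IsClosed (F : Set E)) (hF' : IsClosed (F' : Set E'))
    (haF : a ∈ F) (h : ∀ y ∈ f.source, y ∈ F ↔ f y ∈ F') (v : E) : L v ∈ F' ↔ v ∈ F := by
  refine ⟨fun hv => ?_, map_mem_of_hasFDerivAt hL hF' haF
    ((f.open_source.eventually_mem ha).mono fun y hy => (h y hy).1)⟩
  rw [← L.symm_apply_apply v]
  refine map_mem_of_hasFDerivAt hL' hF ((h a ha).1 haF)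
    ((f.open_target.eventually_mem (f.map_source ha)).mono fun y hy hyF => ?_) hv
  exact (h _ (f.map_target hy)).2 (by rwa [f.right_inv hy])

theorem IsFlattening.differentiableAt_transition (h : IsFlattening M N x φ F G)
    (h' : IsFlattening M' N' x ψ F' G') : DifferentiableAt ℝ (φ.symm.trans ψ) (φ x) := by
  have hφ := h.contDiffOn_symm.contDiffAt (φ.open_target.mem_nhds (φ.map_source h.mem_source))
  have hψ := h'.contDiffOn.contDiffAt (ψ.open_source.mem_nhds h'.mem_source)
  have hψ' : ContDiffAt ℝ ∞ ψ (φ.symm (φ x)) := by rwa [φ.left_inv h.mem_source]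
  exact (hψ'.comp _ hφ).differentiableAt (by simp)

theorem IsFlattening.exists_equiv (hx : x ∈ M) (hMN : M ⊆ N) (h : IsFlattening M N x φ F G)
    (h' : IsFlattening M N x ψ F' G') :
    ∃ L : E ≃L[ℝ] E, (∀ v, L v ∈ F' ↔ v ∈ F) ∧ ∀ v, L v ∈ G' ↔ v ∈ G := by
  have hsymm : φ.symm (φ x) = x := φ.left_inv h.mem_source
  have ha : φ x ∈ (φ.symm.trans ψ).source := by
    simpa [hsymm] using ⟨φ.map_source h.mem_source, h'.mem_source⟩
  have hdiff' : DifferentiableAt ℝ (ψ.symm.trans φ) ((φ.symm.trans ψ) (φ x)) :=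
    (congrArg ψ hsymm : (φ.symm.trans ψ) (φ x) = ψ x) ▸ h'.differentiableAt_transition h
  obtain ⟨L, hL, hL'⟩ :=
    exists_hasFDerivAt_equiv ha (h.differentiableAt_transition h') hdiff'
  have hF : ∀ y ∈ (φ.symm.trans ψ).source, y ∈ F ↔ (φ.symm.trans ψ) y ∈ F' := fun y hy => by
    have hy' := h.mem_left_iff _ (φ.map_target hy.1)
    rw [φ.right_inv hy.1] at hy'
    exact hy'.symm.trans (h'.mem_left_iff _ hy.2)
  have hG : ∀ y ∈ (φ.symm.trans ψ).source, y ∈ G ↔ (φ.symm.trans ψ) y ∈ G' := fun y hy => by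
    have hy' := h.mem_right_iff _ (φ.map_target hy.1)
    rw [φ.right_inv hy.1] at hy'
    exact hy'.symm.trans (h'.mem_right_iff _ hy.2)
  exact ⟨L, apply_mem_iff_of_hasFDerivAt ha hL hL' h.isClosed_left h'.isClosed_left
      ((h.mem_left_iff x h.mem_source).1 hx) hF,
    apply_mem_iff_of_hasFDerivAt ha hL hL' h.isClosed_right h'.isClosed_right
      ((h.mem_right_iff x h.mem_source).1 (hMN hx)) hG⟩

theorem IsComplementedAt.exists_projection (hc : IsComplementedAt M N x) (hx : x ∈ M)
    (hMN : M ⊆ N) (h : IsFlattening M N x ψ F' G') :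
    ∃ π : G' →L[ℝ] E, (∀ v, π v ∈ F') ∧ ∀ v : G', (v : E) ∈ F' → π v = v := by
  obtain ⟨φ, F, G, hφ, hc⟩ := hc
  obtain ⟨π, hπF, hπ⟩ := (closedComplemented_comap_subtype_iff hφ.le).1 hc
  obtain ⟨L, hF, hG⟩ := hφ.exists_equiv hx hMN h
  have hG' : ∀ v : G', L.symm v ∈ G := fun v => (hG _).1 (by simp)
  refine ⟨L.toContinuousLinearMap ∘L π ∘L
    (L.symm.toContinuousLinearMap ∘L G'.subtypeL).codRestrict G hG', fun v => (hF _).2 (hπF _),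
    fun v hv => L.eq_symm_apply.1 (hπ ⟨_, hG' v⟩ ((hF _).1 ?_))⟩
  simpa using hv

end BanachSub

/-! ### Graph charts of the projections of a C⋆-algebra -/

namespace ProjChart

variable {A : Type*} [CStarAlgebra A] {p q k l W X : A} {J : Submodule ℝ A}

/-- The off-diagonal corner `(1 - p) A p` of an idempotent `p`: the model space of the set of
projections near a projection `p`. -/
def corner (p : A) : Submodule ℝ A where
  carrier := {k | p * k = 0 ∧ k * p = k}
  add_mem' hk hl := ⟨by rw [mul_add, hk.1, hl.1, add_zero], by rw [add_mul, hk.2, hl.2]⟩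
  zero_mem' := ⟨mul_zero p, zero_mul p⟩
  smul_mem' c k hk := ⟨by rw [mul_smul_comm, hk.1, smul_zero], by rw [smul_mul_assoc, hk.2]⟩

/-- The map `X ↦ (1 - p) X p`, a projection onto `corner p` when `p` is idempotent. -/
def cornerMap (p : A) : A →L[ℝ] A :=
  ContinuousLinearMap.mulLeftRight ℝ A (1 - p) p

theorem cornerMap_apply (p X : A) : cornerMap p X = (1 - p) * X * p := rfl

theorem isClosed_corner (p : A) : IsClosed (corner p : Set A) :=
  (isClosed_eq (by fun_prop) continuous_const).inter (isClosed_eq (by fun_prop) continuous_id)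

theorem cornerMap_mem_corner (hp : IsIdempotentElem p) (X : A) : cornerMap p X ∈ corner p :=
  ⟨by rw [cornerMap_apply, ← mul_assoc, ← mul_assoc, hp.mul_one_sub_self, zero_mul, zero_mul],
    by rw [cornerMap_apply, mul_assoc, hp.eq]⟩

theorem one_sub_mul_of_mem_corner (hk : k ∈ corner p) : (1 - p) * k = k := by
  rw [sub_mul, hk.1, one_mul, sub_zero]

theorem cornerMap_of_mem_corner (hk : k ∈ corner p) : cornerMap p k = k := by
  rw [cornerMap_apply, one_sub_mul_of_mem_corner hk, hk.2]

theorem mul_self_of_mem_corner (hk : k ∈ corner p) : k * k = 0 := by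
  nth_rw 1 [← hk.2]
  rw [mul_assoc, hk.1, mul_zero]

theorem star_mul_of_mem_corner (hp : IsStarProjection p) (hk : k ∈ corner p) :
    star k * p = 0 := by
  rw [← hp.isSelfAdjoint.star_eq, ← star_mul, hk.1, star_zero]

theorem commute_ringInverse {a b : A} (h : Commute a b) : Commute a (Ring.inverse b) := by
  by_cases hb : IsUnit b
  · obtain ⟨u, rfl⟩ := hb
    rw [Ring.inverse_unit]
    exact h.units_inv_right
  · rw [Ring.inverse_non_unit b hb]
    exact Commute.zero_right a

theorem isUnit_one_add_star_mul_self (k : A) : IsUnit (1 + star k * k) := by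
  let _ := CStarAlgebra.spectralOrder A
  have _ := CStarAlgebra.spectralOrderedRing A
  exact CStarAlgebra.isUnit_of_le 1 (le_add_of_nonneg_right (star_mul_self_nonneg k))

/-- The projection onto the graph of `k`, for `k` in the corner of a projection `p`: when `p` is
the orthogonal projection of a Hilbert space onto `S`, its range is `{v + k v | v ∈ S}`. -/
def graphProj (p k : A) : A := (p + k) * Ring.inverse (1 + star k * k) * (p + star k)

theorem graphProj_mul_add (hp : IsStarProjection p) (hk : k ∈ corner p) :
    graphProj p k * (p + k) = p + k := by
  have hmul : (p + star k) * (p + k) = (1 + star k * k) * p := by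
    rw [add_mul, mul_add, mul_add, add_mul, hp.isIdempotentElem.eq, hk.1,
      star_mul_of_mem_corner hp hk, mul_assoc, hk.2, one_mul, add_zero, zero_add]
  rw [graphProj, mul_assoc, hmul, mul_assoc, ← mul_assoc (Ring.inverse _),
    Ring.inverse_mul_cancel _ (isUnit_one_add_star_mul_self k), one_mul, add_mul, hk.2,
    hp.isIdempotentElem.eq]

theorem isStarProjection_graphProj (hp : IsStarProjection p) (hk : k ∈ corner p) :
    IsStarProjection (graphProj p k) where
  isIdempotentElem := by
    rw [IsIdempotentElem]
    nth_rw 2 [graphProj]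
    rw [← mul_assoc, ← mul_assoc, graphProj_mul_add hp hk, graphProj]
  isSelfAdjoint := by
    rw [IsSelfAdjoint, graphProj, star_mul, star_mul, ← Ring.inverse_star, star_add, star_add,
      star_add, star_mul, star_star, star_one, hp.isSelfAdjoint.star_eq, mul_assoc]

theorem mul_graphProj_mul (hp : IsStarProjection p) (hk : k ∈ corner p) :
    k * (graphProj p k * p) = cornerMap p (graphProj p k) := by
  have hgp : graphProj p k * p = (p + k) * Ring.inverse (1 + star k * k) * p := by
    rw [graphProj, mul_assoc, add_mul p (star k), star_mul_of_mem_corner hp hk,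
      hp.isIdempotentElem.eq, add_zero]
  rw [cornerMap_apply, mul_assoc, hgp, ← mul_assoc, ← mul_assoc, ← mul_assoc, ← mul_assoc,
    mul_add, mul_add, hk.2, mul_self_of_mem_corner hk, one_sub_mul_of_mem_corner hk,
    hp.isIdempotentElem.one_sub_mul_self, add_zero, zero_add]

theorem contDiff_graphProj (p : A) : ContDiff ℝ ∞ (graphProj p) := by
  have hstar : ContDiff ℝ ∞ (star : A → A) := (starL' ℝ : A ≃L[ℝ] A).contDiff
  refine ((contDiff_const.add contDiff_id).mul ?_).mul (contDiff_const.add hstar)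
  refine contDiff_iff_contDiffAt.2 fun k => ?_
  obtain ⟨u, hu⟩ := isUnit_one_add_star_mul_self k
  have hinv : ContDiffAt ℝ ∞ Ring.inverse (1 + star k * k) := hu ▸ contDiffAt_ringInverse ℝ u
  exact hinv.comp k (contDiff_const.add (hstar.mul contDiff_id)).contDiffAt

theorem isUnit_compression (hp : IsStarProjection p) (hX : X ∈ Metric.ball p 1) :
    IsUnit (p * X * p + (1 - p)) := by
  have heq : p * X * p + (1 - p) = 1 - p * (p - X) * p := by
    rw [mul_sub, sub_mul, hp.isIdempotentElem.eq, hp.isIdempotentElem.eq]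
    abel
  rw [heq]
  refine isUnit_one_sub_of_norm_lt_one ?_
  calc ‖p * (p - X) * p‖ ≤ ‖p‖ * ‖p - X‖ * ‖p‖ := norm_mul₃_le
    _ ≤ 1 * ‖p - X‖ * 1 := by gcongr <;> exact hp.norm_le
    _ < 1 := by rwa [one_mul, mul_one, ← dist_eq_norm, dist_comm]

/-- The `k` in the corner of `p` whose graph is the range of `X p`, for `X` close to the
projection `p`. -/
def slope (p X : A) : A := cornerMap p X * Ring.inverse (p * X * p + (1 - p))

theorem slope_mem_corner (hp : IsIdempotentElem p) (X : A) : slope p X ∈ corner p := by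
  have hcomm : Commute p (p * X * p + (1 - p)) := by
    rw [commute_iff_eq, mul_add, add_mul, hp.mul_one_sub_self, hp.one_sub_mul_self,
      mul_assoc (p * X), hp.eq, ← mul_assoc, ← mul_assoc, hp.eq]
  obtain ⟨hleft, hright⟩ := cornerMap_mem_corner hp X
  exact ⟨by rw [slope, ← mul_assoc, hleft, zero_mul],
    by rw [slope, mul_assoc, ← (commute_ringInverse hcomm).eq, ← mul_assoc, hright]⟩

theorem mul_compression (hk : k ∈ corner p) (X : A) :
    k * (p * X * p + (1 - p)) = k * (X * p) := by
  rw [mul_add, mul_sub, mul_one, hk.2, sub_self, add_zero, ← mul_assoc, ← mul_assoc, hk.2,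
    mul_assoc]

theorem slope_mul (hp : IsStarProjection p) (hX : X ∈ Metric.ball p 1) :
    slope p X * (X * p) = cornerMap p X := by
  rw [← mul_compression (slope_mem_corner hp.isIdempotentElem X), slope, mul_assoc,
    Ring.inverse_mul_cancel _ (isUnit_compression hp hX), mul_one]

theorem slope_eq (hp : IsStarProjection p) (hk : k ∈ corner p) (hX : X ∈ Metric.ball p 1)
    (h : k * (X * p) = cornerMap p X) : slope p X = k := by
  rw [slope, ← h, ← mul_compression hk, mul_assoc,
    Ring.mul_inverse_cancel _ (isUnit_compression hp hX), mul_one]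

theorem graphProj_slope (hp : IsStarProjection p) (hq : IsStarProjection q)
    (hpq : q ∈ Metric.ball p 1) : graphProj p (slope p q) = q := by
  have hi := hp.isIdempotentElem
  have hk := slope_mem_corner hi q
  set r := graphProj p (slope p q) with hr_def
  have hr : IsStarProjection r := isStarProjection_graphProj hp hk
  have hgraph : (p + slope p q) * (p * q * p + (1 - p)) = q * p := by
    rw [add_mul, mul_compression hk, slope_mul hp hpq, cornerMap_apply, mul_add,
      hi.mul_one_sub_self, add_zero, ← mul_assoc, ← mul_assoc, hi.eq, sub_mul, sub_mul, one_mul,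
      add_sub_cancel]
  have hrange : q * (p + slope p q) = p + slope p q := by
    have hinv : p + slope p q = q * p * Ring.inverse (p * q * p + (1 - p)) := by
      rw [← hgraph, mul_assoc, Ring.mul_inverse_cancel _ (isUnit_compression hp hpq), mul_one]
    rw [hinv, ← mul_assoc, ← mul_assoc, hq.isIdempotentElem.eq]
  have hqr : q * r = r := by rw [hr_def, graphProj, ← mul_assoc, ← mul_assoc, hrange]
  have hrq : r * q = r := by
    simpa [hq.isSelfAdjoint.star_eq, hr.isSelfAdjoint.star_eq] using congrArg star hqr
  have hsubq : (q - r) * q = q - r := by rw [sub_mul, hq.isIdempotentElem.eq, hrq]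
  have hsubp : (q - r) * p = 0 := by
    rw [← hsubq, mul_assoc, ← hgraph, ← mul_assoc, sub_mul, hrange, graphProj_mul_add hp hk,
      sub_self, zero_mul]
  -- `q - r` is fixed by right multiplication by `q - p`, which has norm less than one.
  have hfix : (q - r) * (q - p) = q - r := by rw [mul_sub, hsubq, hsubp, sub_zero]
  have hnorm : ‖q - r‖ ≤ ‖q - r‖ * ‖q - p‖ := by
    simpa only [hfix] using norm_mul_le (q - r) (q - p)
  rw [mem_ball_iff_norm] at hpq
  have hzero : ‖q - r‖ = 0 := by nlinarith [norm_nonneg (q - r)]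
  exact (sub_eq_zero.1 (norm_eq_zero.1 hzero)).symm

/-- The inverse chart `unflat` sends `k` in the corner of `p` to the projection onto its graph.
The last summand makes `cornerMap p W` the slope of `unflat p W` for every `W`. -/
def unflat (p W : A) : A :=
  graphProj p (cornerMap p W) + (W - cornerMap p W) + cornerMap p W * (W * p)

/-- The chart at `p`, sending a projection to its slope over `p`. -/
def flat (p X : A) : A :=
  slope p X + ((X - graphProj p (slope p X)) - cornerMap p (X - graphProj p (slope p X)))

theorem unflat_flat (hp : IsStarProjection p) (hX : X ∈ Metric.ball p 1) :
    unflat p (flat p X) = X := by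
  have hi := hp.isIdempotentElem
  have hk := slope_mem_corner hi X
  have hcorner : cornerMap p (flat p X) = slope p X := by
    rw [flat, map_add, map_sub _ (X - _), cornerMap_of_mem_corner (cornerMap_mem_corner hi _),
      cornerMap_of_mem_corner hk, sub_self, add_zero]
  have hmul : slope p X * (flat p X * p) = cornerMap p (X - graphProj p (slope p X)) := by
    have hY := cornerMap_mem_corner hi (X - graphProj p (slope p X))
    rw [← hk.2, mul_assoc (slope p X), ← mul_assoc p, flat, mul_add, mul_sub p (X - _), hk.1,
      hY.1, zero_add, sub_zero, mul_assoc p, ← mul_assoc, hk.2, sub_mul, mul_sub,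
      slope_mul hp hX, mul_graphProj_mul hp hk, map_sub]
  rw [unflat, hcorner, hmul, flat]
  abel

theorem flat_unflat (hp : IsStarProjection p) (hW : unflat p W ∈ Metric.ball p 1) :
    flat p (unflat p W) = W := by
  have hk := cornerMap_mem_corner hp.isIdempotentElem W
  have hcorner : cornerMap p (cornerMap p W * (W * p)) = cornerMap p W * (W * p) := by
    rw [cornerMap_apply p (_ * _), ← mul_assoc, one_sub_mul_of_mem_corner hk, mul_assoc,
      mul_assoc, hp.isIdempotentElem.eq]
  have hslope : slope p (unflat p W) = cornerMap p W := by
    refine slope_eq hp hk hW ?_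
    rw [unflat, map_add, map_add, map_sub, cornerMap_of_mem_corner hk, sub_self, add_zero,
      hcorner, add_mul, add_mul, sub_mul, mul_add, mul_add, mul_sub, mul_graphProj_mul hp hk,
      hk.2, mul_assoc (cornerMap p W), ← mul_assoc (cornerMap p W) (cornerMap p W),
      mul_self_of_mem_corner hk, zero_mul, sub_zero, add_zero]
  rw [flat, hslope, unflat, add_assoc, add_sub_cancel_left, map_add, map_sub,
    cornerMap_of_mem_corner hk, sub_self, hcorner]
  abel

theorem flat_of_isStarProjection (hp : IsStarProjection p) (hq : IsStarProjection q)
    (hpq : q ∈ Metric.ball p 1) : flat p q = slope p q := by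
  rw [flat, graphProj_slope hp hq hpq, sub_self, map_zero, sub_zero, add_zero]

theorem flat_self (hp : IsStarProjection p) : flat p p = 0 := by
  rw [flat_of_isStarProjection hp hp (Metric.mem_ball_self one_pos), slope, cornerMap_apply,
    hp.isIdempotentElem.one_sub_mul_self, zero_mul, zero_mul]

theorem flat_mem_corner_iff (hp : IsStarProjection p) (hX : X ∈ Metric.ball p 1) :
    flat p X ∈ corner p ↔ IsStarProjection X := by
  refine ⟨fun h => ?_, fun h => ?_⟩
  · have hzero : flat p X * (flat p X * p) = 0 := by rw [h.2, mul_self_of_mem_corner h]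
    rw [← unflat_flat hp hX, unflat, cornerMap_of_mem_corner h, hzero, sub_self, add_zero,
      add_zero]
    exact isStarProjection_graphProj hp h
  · rw [flat_of_isStarProjection hp h hX]
    exact slope_mem_corner hp.isIdempotentElem X

theorem contDiff_unflat (p : A) : ContDiff ℝ ∞ (unflat p) :=
  (((contDiff_graphProj p).comp (cornerMap p).contDiff).add
    (contDiff_id.sub (cornerMap p).contDiff)).add
      ((cornerMap p).contDiff.mul (contDiff_id.mul contDiff_const))

theorem contDiffOn_flat (hp : IsStarProjection p) :
    ContDiffOn ℝ ∞ (flat p) (Metric.ball p 1) := by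
  have hslope : ContDiffOn ℝ ∞ (slope p) (Metric.ball p 1) := by
    refine (cornerMap p).contDiff.contDiffOn.mul fun X hX => ?_
    obtain ⟨u, hu⟩ := isUnit_compression hp hX
    have hinv : ContDiffAt ℝ ∞ Ring.inverse (p * X * p + (1 - p)) :=
      hu ▸ contDiffAt_ringInverse ℝ u
    exact (hinv.comp X (((contDiff_const.mul contDiff_id).mul contDiff_const).add
      contDiff_const).contDiffAt).contDiffWithinAt
  have hsub := contDiffOn_id.sub ((contDiff_graphProj p).comp_contDiffOn hslope)
  exact hslope.add (hsub.sub ((cornerMap p).contDiff.comp_contDiffOn hsub))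

/-- The chart `flat p` as a local homeomorphism, on the unit ball around `p`. -/
def projChart (hp : IsStarProjection p) : OpenPartialHomeomorph A A where
  toFun := flat p
  invFun := unflat p
  source := Metric.ball p 1
  target := unflat p ⁻¹' Metric.ball p 1
  map_source' X hX := by rwa [Set.mem_preimage, unflat_flat hp hX]
  map_target' W hW := hW
  left_inv' X hX := unflat_flat hp hX
  right_inv' W hW := flat_unflat hp hW
  open_source := Metric.isOpen_ball
  open_target := Metric.isOpen_ball.preimage (contDiff_unflat p).continuous
  continuousOn_toFun := (contDiffOn_flat hp).continuousOn
  continuousOn_invFun := (contDiff_unflat p).continuous.continuousOn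

/-- The factor multiplying the first component in `shear`. -/
def shearFactor (p q W : A) : A := 1 - (1 - p) * cornerMap q W

theorem shearFactor_zero (p q : A) : shearFactor p q 0 = 1 := by simp [shearFactor]

/-- The change of coordinates that turns the condition `(1 - q - l) (p + k) ∈ J` on
`(k, l) ∈ corner p × corner q` into the linear condition `(1 - q) k ∈ J`, for an ideal `J`
containing `(1 - q) p`. -/
def shear (p q : A) : OpenPartialHomeomorph (A × A) (A × A) where
  toFun W := (shearFactor p q W.2 * W.1 - cornerMap p (cornerMap q W.2), W.2)
  invFun W := (Ring.inverse (shearFactor p q W.2) * (W.1 + cornerMap p (cornerMap q W.2)), W.2)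
  source := {W | IsUnit (shearFactor p q W.2)}
  target := {W | IsUnit (shearFactor p q W.2)}
  map_source' W hW := hW
  map_target' W hW := hW
  left_inv' W hW := Prod.ext
    (by simp only [sub_add_cancel, ← mul_assoc, Ring.inverse_mul_cancel _ hW, one_mul]) rfl
  right_inv' W hW := Prod.ext
    (by simp only [← mul_assoc, Ring.mul_inverse_cancel _ hW, one_mul, add_sub_cancel_right]) rfl
  open_source := Units.isOpen.preimage (by unfold shearFactor; fun_prop)
  open_target := Units.isOpen.preimage (by unfold shearFactor; fun_prop)
  continuousOn_toFun := by unfold shearFactor; fun_prop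
  continuousOn_invFun := by
    have hcont : Continuous fun W : A × A => shearFactor p q W.2 := by
      unfold shearFactor; fun_prop
    refine ContinuousOn.prodMk (ContinuousOn.mul (fun W hW => ?_) (by fun_prop)) (by fun_prop)
    obtain ⟨u, hu⟩ := hW
    have hinv : ContinuousAt Ring.inverse (shearFactor p q W.2) :=
      hu ▸ NormedRing.inverse_continuousAt u
    exact (hinv.comp (f := fun W : A × A => shearFactor p q W.2)
      hcont.continuousAt).continuousWithinAt

theorem contDiff_shearFactor (p q : A) : ContDiff ℝ ∞ (shearFactor p q) :=
  contDiff_const.sub (contDiff_const.mul (cornerMap q).contDiff)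

theorem contDiff_shear (p q : A) : ContDiff ℝ ∞ (shear p q) :=
  ((((contDiff_shearFactor p q).comp contDiff_snd).mul contDiff_fst).sub
    ((cornerMap p).contDiff.comp ((cornerMap q).contDiff.comp contDiff_snd))).prodMk contDiff_snd

theorem contDiffOn_shear_symm (p q : A) :
    ContDiffOn ℝ ∞ (shear p q).symm (shear p q).target := by
  refine ContDiffOn.prodMk (ContDiffOn.mul (fun W hW => ?_) (contDiff_fst.add
    ((cornerMap p).contDiff.comp ((cornerMap q).contDiff.comp contDiff_snd))).contDiffOn)
      contDiff_snd.contDiffOn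
  obtain ⟨u, hu⟩ := hW
  have hinv : ContDiffAt ℝ ∞ Ring.inverse (shearFactor p q W.2) := hu ▸ contDiffAt_ringInverse ℝ u
  exact (hinv.comp W ((contDiff_shearFactor p q).comp contDiff_snd).contDiffAt).contDiffWithinAt

theorem shear_fst_mem_corner_iff (hp : IsIdempotentElem p) {W : A × A}
    (hW : IsUnit (shearFactor p q W.2)) :
    (shear p q W).1 ∈ corner p ↔ W.1 ∈ corner p := by
  have hmul : p * shearFactor p q W.2 = p := by
    rw [shearFactor, mul_sub, mul_one, ← mul_assoc, hp.mul_one_sub_self, zero_mul, sub_zero]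
  refine (Submodule.sub_mem_iff_left _ (cornerMap_mem_corner hp _)).trans (and_congr ?_ ?_)
  · rw [← mul_assoc, hmul]
  · rw [mul_assoc, hW.mul_right_inj]

/-- The model space of the pairs of projections `(X, Y)` with `(1 - Y) X ∈ J`. -/
def idealCorner (p q : A) (J : Submodule ℝ A) : Submodule ℝ (A × A) :=
  (corner p).prod (corner q) ⊓ J.comap (LinearMap.mulLeft ℝ (1 - q) ∘ₗ LinearMap.fst ℝ A A)

theorem mem_idealCorner {W : A × A} : W ∈ idealCorner p q J ↔
    (W.1 ∈ corner p ∧ W.2 ∈ corner q) ∧ (1 - q) * W.1 ∈ J := Iff.rfl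

theorem one_sub_graphProj_mul_graphProj_mem_iff (hp : IsStarProjection p)
    (hq : IsStarProjection q) (hJl : ∀ a, ∀ x ∈ J, a * x ∈ J) (hJr : ∀ a, ∀ x ∈ J, x * a ∈ J)
    (hk : k ∈ corner p) (hl : l ∈ corner q) :
    (1 - graphProj q l) * graphProj p k ∈ J ↔ (1 - q - l) * (p + k) ∈ J := by
  have hker : (1 - q - l) * graphProj q l = 0 := by
    have hmul : (1 - q - l) * (q + l) = 0 := by
      rw [sub_mul, mul_add, mul_add, hq.isIdempotentElem.one_sub_mul_self,
        one_sub_mul_of_mem_corner hl, hl.2, mul_self_of_mem_corner hl, zero_add, add_zero,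
        sub_self]
    rw [graphProj, ← mul_assoc, ← mul_assoc, hmul, zero_mul, zero_mul]
  have hleft : (1 - q - l) * (1 - graphProj q l) = 1 - q - l := by
    rw [mul_sub, hker, mul_one, sub_zero]
  have hright : (1 - graphProj q l) * (1 - q - l) = 1 - graphProj q l := by
    rw [sub_sub, mul_sub, mul_one, sub_mul _ _ (q + l), graphProj_mul_add hq hl, one_mul,
      sub_self, sub_zero]
  constructor <;> intro h
  · have hmem := hJr (p + k) _ (hJl (1 - q - l) _ h)
    rwa [← mul_assoc, hleft, mul_assoc, graphProj_mul_add hp hk] at hmem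
  · have hmem := hJl (1 - graphProj q l) _
      (hJr (Ring.inverse (1 + star k * k) * (p + star k)) _ h)
    rwa [mul_assoc (1 - q - l), ← mul_assoc _ (1 - q - l), hright, ← mul_assoc (p + k),
      ← graphProj] at hmem

theorem one_sub_mul_shear_mem_iff (hJr : ∀ a, ∀ x ∈ J, x * a ∈ J) (h0 : (1 - q) * p ∈ J)
    (hl : l ∈ corner q) :
    (1 - q) * (shear p q (k, l)).1 ∈ J ↔ (1 - q - l) * (p + k) ∈ J := by
  have hl' := one_sub_mul_of_mem_corner hl
  have hshear : (1 - q) * (shear p q (k, l)).1 =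
      (1 - q - l) * (p + k) - (1 - q) * p + (1 - q) * p * (l * (p + k)) := by
    calc (1 - q) * ((1 - (1 - p) * cornerMap q l) * k - (1 - p) * cornerMap q l * p)
        = (1 - q) * k - (1 - q) * l * (p + k) + (1 - q) * p * (l * (p + k)) := by
          rw [cornerMap_of_mem_corner hl]
          noncomm_ring
      _ = _ := by
          rw [hl']
          noncomm_ring
  rw [hshear, Submodule.add_mem_iff_left _ (hJr _ _ h0), Submodule.sub_mem_iff_left _ h0]

/-- The chart of `A × A` at a pair of projections `(p, q)`, flattening simultaneously the pairs of
projections and, for every ideal `J` containing `(1 - q) p`, the pairs of projections `(X, Y)`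
with `(1 - Y) X ∈ J`. -/
def pairChart (hp : IsStarProjection p) (hq : IsStarProjection q) :
    OpenPartialHomeomorph (A × A) (A × A) :=
  ((projChart hp).prod (projChart hq)).trans (shear p q)

theorem pairChart_mem_corner_prod_iff (hp : IsStarProjection p) (hq : IsStarProjection q)
    {y : A × A} (hy : y ∈ (pairChart hp hq).source) :
    pairChart hp hq y ∈ (corner p).prod (corner q) ↔
      IsStarProjection y.1 ∧ IsStarProjection y.2 := by
  obtain ⟨⟨hy₁, hy₂⟩, hunit⟩ := hy
  exact and_congr ((shear_fst_mem_corner_iff hp.isIdempotentElem hunit).trans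
    (flat_mem_corner_iff hp hy₁)) (flat_mem_corner_iff hq hy₂)

theorem pairChart_mem_idealCorner_iff (hp : IsStarProjection p) (hq : IsStarProjection q)
    (hJl : ∀ a, ∀ x ∈ J, a * x ∈ J) (hJr : ∀ a, ∀ x ∈ J, x * a ∈ J) (h0 : (1 - q) * p ∈ J)
    {y : A × A} (hy : y ∈ (pairChart hp hq).source) :
    pairChart hp hq y ∈ idealCorner p q J ↔
      (IsStarProjection y.1 ∧ IsStarProjection y.2) ∧ (1 - y.2) * y.1 ∈ J := by
  refine (and_congr_left' (pairChart_mem_corner_prod_iff hp hq hy)).trans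
    (and_congr_right fun h => ?_)
  have hflat₁ := flat_of_isStarProjection hp h.1 hy.1.1
  have hflat₂ := flat_of_isStarProjection hq h.2 hy.1.2
  have hk := slope_mem_corner hp.isIdempotentElem y.1
  have hl := slope_mem_corner hq.isIdempotentElem y.2
  have hiff := (one_sub_mul_shear_mem_iff hJr h0 (k := slope p y.1) hl).trans
    (one_sub_graphProj_mul_graphProj_mem_iff hp hq hJl hJr hk hl).symm
  rw [graphProj_slope hp h.1 hy.1.1, graphProj_slope hq h.2 hy.1.2, ← hflat₁, ← hflat₂] at hiff
  exact hiff

theorem isFlattening_pairChart (hp : IsStarProjection p) (hq : IsStarProjection q)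
    (hJ : IsClosed (J : Set A)) (hJl : ∀ a, ∀ x ∈ J, a * x ∈ J)
    (hJr : ∀ a, ∀ x ∈ J, x * a ∈ J) (h0 : (1 - q) * p ∈ J) :
    BanachSub.IsFlattening
      {y : A × A | (IsStarProjection y.1 ∧ IsStarProjection y.2) ∧ (1 - y.2) * y.1 ∈ J}
      {y : A × A | IsStarProjection y.1 ∧ IsStarProjection y.2} (p, q) (pairChart hp hq)
      (idealCorner p q J) ((corner p).prod (corner q)) where
  mem_source := by
    refine ⟨⟨Metric.mem_ball_self one_pos, Metric.mem_ball_self one_pos⟩, ?_⟩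
    change IsUnit (shearFactor p q (flat q q))
    rw [flat_self hq, shearFactor_zero]
    exact isUnit_one
  contDiffOn := (contDiff_shear p q).comp_contDiffOn <|
    ((contDiffOn_flat hp).prodMap (contDiffOn_flat hq)).mono fun _ hy => hy.1
  contDiffOn_symm := ((contDiff_unflat p).prodMap (contDiff_unflat q)).comp_contDiffOn <|
    (contDiffOn_shear_symm p q).mono fun _ hy => hy.1
  isClosed_left := ((isClosed_corner p).prod (isClosed_corner q)).inter
    (hJ.preimage (by fun_prop : Continuous fun W : A × A => (1 - q) * W.1))
  isClosed_right := (isClosed_corner p).prod (isClosed_corner q)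
  le := inf_le_left
  mem_left_iff _ hy := (pairChart_mem_idealCorner_iff hp hq hJl hJr h0 hy).symm
  mem_right_iff _ hy := (pairChart_mem_corner_prod_iff hp hq hy).symm

end ProjChart

/-! ### Idempotents in rings -/

namespace CommonCompl

open Topology Filter

section Ring

variable {R : Type*} [Ring R] {p q a b e f g l : R}

/-- The idempotents `a ≤ p` and `b ≤ q` are the core of the compression of `l` to a map from `p` to
`q`: up to the corners `p - a` and `q - b`, this compression is invertible. The last condition says
that it is invertible from the corner `a` to the corner `b`, in a form which is stable under small
perturbations. -/
structure IsCore (l p q a b : R) : Prop where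
  isIdempotentElem_left : IsIdempotentElem a
  isIdempotentElem_right : IsIdempotentElem b
  mul_left : p * a = a
  left_mul : a * p = a
  mul_right : q * b = b
  right_mul : b * q = b
  isUnit : IsUnit (b * l * a + (1 - b) * (1 - a))

/-- The idempotents `f` and `g` have the images of `p` and `q`, and the same kernel: this kernel is
a common complement of the two images. -/
structure ObliquePair (p q f g : R) : Prop where
  mul_left : p * f = f
  left_mul : f * p = p
  mul_right : q * g = g
  right_mul : g * q = q
  left_mul_right : f * g = f
  right_mul_left : g * f = g

/-- The corners of the idempotents `p` and `q` are isomorphic, by `a : p → q` with inverse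
`b : q → p`. -/
structure CornerIso (p q a b : R) : Prop where
  mul_left : q * a = a
  left_mul : a * p = a
  mul_right : p * b = b
  right_mul : b * q = b
  right_mul_left : b * a = p
  left_mul_right : a * b = q

theorem exists_corner_inverse (ha : IsIdempotentElem a) (hb : IsIdempotentElem b)
    (h : IsUnit (b * l * a + (1 - b) * (1 - a))) :
    ∃ k, a * k = k ∧ k * b = k ∧ k * l * a = a ∧ b * l * k = b := by
  obtain ⟨u, hu⟩ := h
  have hua : ↑u * a = b * l * a := by
    rw [hu, add_mul, mul_assoc, ha.eq, mul_assoc (1 - b), ha.one_sub_mul_self, mul_zero, add_zero]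
  have hbu : b * ↑u = b * l * a := by
    rw [hu, mul_add, ← mul_assoc, ← mul_assoc, hb.eq, ← mul_assoc, hb.mul_one_sub_self, zero_mul,
      add_zero]
  have hk : a * ↑u⁻¹ = ↑u⁻¹ * b := by
    rw [Units.mul_inv_eq_iff_eq_mul, mul_assoc, hbu, ← hua, Units.inv_mul_cancel_left]
  refine ⟨a * ↑u⁻¹, ?_, ?_, ?_, ?_⟩
  · rw [← mul_assoc, ha.eq]
  · rw [hk, mul_assoc, hb.eq]
  · rw [hk, mul_assoc, mul_assoc, ← mul_assoc b, ← hua, Units.inv_mul_cancel_left]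
  · rw [← mul_assoc, ← hbu, Units.mul_inv_cancel_right]

theorem intertwiner_mul (hp : IsIdempotentElem p) (hq : IsIdempotentElem q) :
    (q * p + (1 - q) * (1 - p)) * p = q * (q * p + (1 - q) * (1 - p)) := by
  rw [add_mul, mul_add, mul_assoc, mul_assoc, hp.eq, hp.one_sub_mul_self, mul_zero, ← mul_assoc,
    ← mul_assoc, hq.eq, hq.mul_one_sub_self, zero_mul]

theorem isUnit_intertwiner_of_mul_eq (hp : IsIdempotentElem p) (hf : IsIdempotentElem f)
    (hpf : p * f = f) (hfp : f * p = p) : IsUnit (f * p + (1 - f) * (1 - p)) := by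
  have h : f * p + (1 - f) * (1 - p) = 1 + (p - f) := by
    rw [mul_sub, mul_one, sub_mul, hfp]
    noncomm_ring
  have hsq : (p - f) * (p - f) = 0 := by
    rw [sub_mul, mul_sub, mul_sub, hp.eq, hf.eq, hpf, hfp, sub_self]
  rw [h]
  exact IsNilpotent.isUnit_one_add ⟨2, by rw [sq, hsq]⟩

/-- The element `r` is the oblique projection of the corner of `e` onto that of `p`, along that of
`q`. -/
theorem exists_oblique_of_isUnit (hp : IsIdempotentElem p) (hq : IsIdempotentElem q)
    (he : IsIdempotentElem e) (hep : e * p = p) (hpe : p * e = p) (heq : e * q = q)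
    (hqe : q * e = q) (h : IsUnit (p - q + (1 - e))) :
    ∃ r, p * r = r ∧ r * p = p ∧ r * q = 0 ∧ q * (e - r) = e - r ∧ r * e = r := by
  obtain ⟨u, hu⟩ := h
  have hup : ↑u * p = (e - q) * p := by
    rw [hu, add_mul, sub_mul, sub_mul, sub_mul, hp.eq, one_mul, hep, sub_self, add_zero]
  have hpu : (e - q) * ↑u = (e - q) * p := by
    simp only [hu, sub_mul, mul_add, mul_sub, mul_one, hq.eq, he.eq, hep, heq, hqe]
    abel
  have huq : ↑u * q = (e - p) * ↑u := by
    simp only [hu, add_mul, sub_mul, mul_add, mul_sub, one_mul, mul_one, hp.eq, hq.eq, he.eq, hep,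
      hpe, heq]
    abel
  have hue : ↑u * e = p - q := by
    rw [hu, add_mul, sub_mul, hpe, hqe, he.one_sub_mul_self, add_zero]
  have hr : p * ↑u⁻¹ = ↑u⁻¹ * (e - q) := by
    rw [Units.mul_inv_eq_iff_eq_mul, mul_assoc, hpu, ← hup, Units.inv_mul_cancel_left]
  have hr' : q * ↑u⁻¹ = ↑u⁻¹ * (e - p) := by
    rw [Units.mul_inv_eq_iff_eq_mul, mul_assoc, ← huq, Units.inv_mul_cancel_left]
  have hs : e - p * ↑u⁻¹ = -(q * ↑u⁻¹) := by
    have : e = ↑u⁻¹ * (p - q) := by rw [← hue, Units.inv_mul_cancel_left]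
    rw [hr, hr', this]
    noncomm_ring
  refine ⟨p * ↑u⁻¹, ?_, ?_, ?_, ?_, ?_⟩
  · rw [← mul_assoc, hp.eq]
  · rw [hr, mul_assoc, ← hup, Units.inv_mul_cancel_left]
  · rw [hr, mul_assoc, sub_mul, heq, hq.eq, sub_self, mul_zero]
  · rw [hs, mul_neg, ← mul_assoc, hq.eq]
  · rw [hr, mul_assoc, sub_mul, he.eq, hqe]

theorem isIdempotentElem_of_mul_eq (hpf : p * f = f) (hfp : f * p = p) : IsIdempotentElem f := by
  calc f * f = f * (p * f) := by rw [hpf]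
    _ = f := by rw [← mul_assoc, hfp, hpf]

theorem one_sub_mul_one_sub_of_mul_eq (h : p * q = p) : (1 - p) * (1 - q) = 1 - q := by
  rw [sub_mul, one_mul, mul_sub, h, mul_one, sub_self, sub_zero]

theorem one_sub_mul_one_sub_of_mul_eq' (h : p * q = q) : (1 - p) * (1 - q) = 1 - p := by
  rw [mul_sub, mul_one, sub_mul, h, one_mul, sub_self, sub_zero]

namespace ObliquePair

theorem isIdempotentElem_left (h : ObliquePair p q f g) : IsIdempotentElem f :=
  isIdempotentElem_of_mul_eq h.mul_left h.left_mul

theorem isIdempotentElem_right (h : ObliquePair p q f g) : IsIdempotentElem g :=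
  isIdempotentElem_of_mul_eq h.mul_right h.right_mul

theorem one_sub_star [StarRing R] (hp : IsSelfAdjoint p) (hq : IsSelfAdjoint q)
    (h : ObliquePair p q f g) : ObliquePair (1 - p) (1 - q) (1 - star f) (1 - star g) where
  mul_left := one_sub_mul_one_sub_of_mul_eq <| by
    simpa only [star_mul, hp.star_eq] using congrArg star h.left_mul
  left_mul := one_sub_mul_one_sub_of_mul_eq <| by
    simpa only [star_mul, hp.star_eq] using congrArg star h.mul_left
  mul_right := one_sub_mul_one_sub_of_mul_eq <| by
    simpa only [star_mul, hq.star_eq] using congrArg star h.right_mul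
  right_mul := one_sub_mul_one_sub_of_mul_eq <| by
    simpa only [star_mul, hq.star_eq] using congrArg star h.mul_right
  left_mul_right := one_sub_mul_one_sub_of_mul_eq' <| by
    simpa only [star_mul] using congrArg star h.right_mul_left
  right_mul_left := one_sub_mul_one_sub_of_mul_eq' <| by
    simpa only [star_mul] using congrArg star h.left_mul_right

theorem exists_of_isUnit {p' q' : R} (h : ObliquePair p q f g) (hp' : IsIdempotentElem p')
    (hq' : IsIdempotentElem q') (hf : IsUnit (f * p' + (1 - f) * (1 - p')))
    (hg : IsUnit (g * q' + (1 - g) * (1 - q'))) : ∃ f' g', ObliquePair p' q' f' g' := by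
  obtain ⟨k, hk, hkf, hkp, hfk⟩ :=
    exists_corner_inverse (l := 1) hp' h.isIdempotentElem_left (by rwa [mul_one])
  obtain ⟨m, hm, hmg, hmq, hgm⟩ :=
    exists_corner_inverse (l := 1) hq' h.isIdempotentElem_right (by rwa [mul_one])
  rw [mul_one] at hkp hfk hmq hgm
  refine ⟨k, m, hk, hkp, hm, hmq, ?_, ?_⟩
  · rw [← hkf, ← h.left_mul_right, mul_assoc, mul_assoc, hgm]
  · rw [← hmg, ← h.right_mul_left, mul_assoc, mul_assoc, hfk]

end ObliquePair

/-- In the direct sum of two isomorphic corners, the graph of the isomorphism is a common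
complement. -/
theorem CornerIso.exists_obliquePair (h : CornerIso p q a b) (hp : IsIdempotentElem p)
    (hq : IsIdempotentElem q) (he : IsIdempotentElem e) (hep : e * p = p) (hpe : p * e = p)
    (heq : e * q = q) (hqe : q * e = q) (hu : IsUnit (p - q + (1 - e))) :
    ∃ f g, ObliquePair p q f g ∧ f * e = f ∧ g * e = g := by
  obtain ⟨r, hpr, hrp, hrq, hqr, hre⟩ := exists_oblique_of_isUnit hp hq he hep hpe heq hqe hu
  have hrr : r * r = r := by
    calc r * r = r * (p * r) := by rw [hpr]
      _ = r := by rw [← mul_assoc, hrp, hpr]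
  have her : e * r = r := by rw [← hpr, ← mul_assoc, hep]
  have hra : r * a = 0 := by rw [← h.mul_left, ← mul_assoc, hrq, zero_mul]
  have hea : e * a = a := by rw [← h.mul_left, ← mul_assoc, heq]
  have hrb : r * b = b := by rw [← h.mul_right, ← mul_assoc, hrp]
  have heb : e * b = b := by rw [← h.mul_right, ← mul_assoc, hep]
  have hbar : b * (a * r) = r := by rw [← mul_assoc, h.right_mul_left, hpr]
  have habr : a * (b * (e - r)) = e - r := by rw [← mul_assoc, h.left_mul_right, hqr]
  refine ⟨r - b * (e - r), e - r - a * r, ⟨?_, ?_, ?_, ?_, ?_, ?_⟩, ?_, ?_⟩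
  · rw [mul_sub, hpr, ← mul_assoc, h.mul_right]
  · rw [sub_mul, hrp, mul_assoc, sub_mul, hep, hrp, sub_self, mul_zero, sub_zero]
  · rw [mul_sub, hqr, ← mul_assoc, h.mul_left]
  · rw [sub_mul, sub_mul, heq, mul_assoc, hrq, mul_zero, sub_zero, sub_zero]
  · rw [mul_sub, sub_mul _ _ (a * r), mul_assoc b, sub_mul e r (a * r), ← mul_assoc e, hea,
      ← mul_assoc r, hra, zero_mul, sub_zero, hbar, sub_mul, mul_assoc b]
    simp only [sub_mul, mul_sub, hre, hrr, he.eq, her]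
    abel
  · rw [mul_sub, sub_mul _ _ (b * (e - r)), mul_assoc a, ← mul_assoc r, hrb, habr, sub_mul e r,
      ← mul_assoc e, ← mul_assoc r, heb, hrb, sub_mul, sub_mul, mul_assoc a, her, hrr]
    abel
  · rw [sub_mul, hre, mul_assoc, sub_mul, he.eq, hre]
  · rw [sub_mul, sub_mul, he.eq, mul_assoc, hre]

theorem ObliquePair.add {p₀ q₀ f₀ g₀ : R} (h₀ : ObliquePair p₀ q₀ f₀ g₀)
    (h : ObliquePair p q f g) (hp₀ : e * p₀ = 0) (hq₀ : e * q₀ = 0)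
    (hfe₀ : f₀ * e = 0) (hge₀ : g₀ * e = 0) (hp : e * p = p) (hq : e * q = q) (hfe : f * e = f)
    (hge : g * e = g) (hpe₀ : p₀ * e = 0) (hqe₀ : q₀ * e = 0) (hpe : p * e = p) (hqe : q * e = q) :
    ObliquePair (p₀ + p) (q₀ + q) (f₀ + f) (g₀ + g) := by
  have h1 : ∀ {x y : R}, x * e = 0 → e * y = y → x * y = 0 := fun hx hy => by
    rw [← hy, ← mul_assoc, hx, zero_mul]
  have h2 : ∀ {x y : R}, x * e = x → e * y = 0 → x * y = 0 := fun hx hy => by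
    rw [← hx, mul_assoc, hy, mul_zero]
  have hf₀ : e * f₀ = 0 := by rw [← h₀.mul_left, ← mul_assoc, hp₀, zero_mul]
  have hg₀ : e * g₀ = 0 := by rw [← h₀.mul_right, ← mul_assoc, hq₀, zero_mul]
  have hf : e * f = f := by rw [← h.mul_left, ← mul_assoc, hp]
  have hg : e * g = g := by rw [← h.mul_right, ← mul_assoc, hq]
  constructor <;> rw [add_mul, mul_add, mul_add]
  · rw [h₀.mul_left, h.mul_left, h1 hpe₀ hf, h2 hpe hf₀, add_zero, zero_add]
  · rw [h₀.left_mul, h.left_mul, h1 hfe₀ hp, h2 hfe hp₀, add_zero, zero_add]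
  · rw [h₀.mul_right, h.mul_right, h1 hqe₀ hg, h2 hqe hg₀, add_zero, zero_add]
  · rw [h₀.right_mul, h.right_mul, h1 hge₀ hq, h2 hge hq₀, add_zero, zero_add]
  · rw [h₀.left_mul_right, h.left_mul_right, h1 hfe₀ hg, h2 hfe hg₀, add_zero, zero_add]
  · rw [h₀.right_mul_left, h.right_mul_left, h1 hge₀ hf, h2 hge hf₀, add_zero, zero_add]

theorem intertwiner_self (hp : IsIdempotentElem p) : p * p + (1 - p) * (1 - p) = 1 := by
  rw [hp.eq, hp.one_sub.eq, add_sub_cancel]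

theorem conj_mul_conj (v : Rˣ) (x y : R) :
    ↑v * x * ↑v⁻¹ * (↑v * y * ↑v⁻¹) = ↑v * (x * y) * ↑v⁻¹ := by
  simp only [mul_assoc, Units.inv_mul_cancel_left]

theorem IsCore.conj {l' : R} (h : IsCore l p q a b) (v w : Rˣ)
    (hu : IsUnit (↑w * b * ↑w⁻¹ * l' * (↑v * a * ↑v⁻¹) +
      (1 - ↑w * b * ↑w⁻¹) * (1 - ↑v * a * ↑v⁻¹))) :
    IsCore l' (↑v * p * ↑v⁻¹) (↑w * q * ↑w⁻¹) (↑v * a * ↑v⁻¹) (↑w * b * ↑w⁻¹) where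
  isIdempotentElem_left := by rw [IsIdempotentElem, conj_mul_conj, h.isIdempotentElem_left.eq]
  isIdempotentElem_right := by rw [IsIdempotentElem, conj_mul_conj, h.isIdempotentElem_right.eq]
  mul_left := by rw [conj_mul_conj, h.mul_left]
  left_mul := by rw [conj_mul_conj, h.left_mul]
  mul_right := by rw [conj_mul_conj, h.mul_right]
  right_mul := by rw [conj_mul_conj, h.right_mul]
  isUnit := hu

/-- Near `p`, the idempotents are the conjugates `conjNear p p' x` of `p`, for `x = p`. -/
def conjNear (p p' x : R) : R :=
  (p' * p + (1 - p') * (1 - p)) * x * Ring.inverse (p' * p + (1 - p') * (1 - p))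

end Ring

section NormedRing

variable {R : Type*} [NormedRing R] {p q a b f g l : R}

theorem tendsto_intertwiner (hp : IsIdempotentElem p) :
    Tendsto (fun p' => p' * p + (1 - p') * (1 - p)) (𝓝 p) (𝓝 1) := by
  have h : Continuous fun p' : R => p' * p + (1 - p') * (1 - p) := by fun_prop
  simpa only [intertwiner_self hp] using h.tendsto p

variable [CompleteSpace R]

theorem ObliquePair.eventually (h : ObliquePair p q f g) (hp : IsIdempotentElem p)
    (hq : IsIdempotentElem q) : ∀ᶠ x : R × R in 𝓝 (p, q), IsIdempotentElem x.1 →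
      IsIdempotentElem x.2 → ∃ f' g', ObliquePair x.1 x.2 f' g' := by
  have hf : ∀ᶠ x : R × R in 𝓝 (p, q), IsUnit (f * x.1 + (1 - f) * (1 - x.1)) :=
    (by fun_prop : ContinuousAt (fun x : R × R => f * x.1 + (1 - f) * (1 - x.1)) _).eventually
      (Units.isOpen.mem_nhds
        (isUnit_intertwiner_of_mul_eq hp h.isIdempotentElem_left h.mul_left h.left_mul))
  have hg : ∀ᶠ x : R × R in 𝓝 (p, q), IsUnit (g * x.2 + (1 - g) * (1 - x.2)) :=
    (by fun_prop : ContinuousAt (fun x : R × R => g * x.2 + (1 - g) * (1 - x.2)) _).eventually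
      (Units.isOpen.mem_nhds
        (isUnit_intertwiner_of_mul_eq hq h.isIdempotentElem_right h.mul_right h.right_mul))
  filter_upwards [hf, hg] with x hf hg hx₁ hx₂
  exact h.exists_of_isUnit hx₁ hx₂ hf hg

theorem tendsto_conjNear (hp : IsIdempotentElem p) (x : R) :
    Tendsto (fun p' => conjNear p p' x) (𝓝 p) (𝓝 x) := by
  have h : Tendsto Ring.inverse (𝓝 (1 : R)) (𝓝 1) := by
    simpa only [ContinuousAt, Units.val_one, Ring.inverse_one] using
      NormedRing.inverse_continuousAt (1 : Rˣ)
  simpa only [one_mul, mul_one, Function.comp_def, conjNear] using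
    ((tendsto_intertwiner hp).mul_const x).mul (h.comp (tendsto_intertwiner hp))

theorem eventually_exists_conjNear_eq (hp : IsIdempotentElem p) :
    ∀ᶠ p' in 𝓝 p, IsIdempotentElem p' →
      ∃ v : Rˣ, ↑v * p * ↑v⁻¹ = p' ∧ ∀ x, conjNear p p' x = ↑v * x * ↑v⁻¹ := by
  filter_upwards [(tendsto_intertwiner hp).eventually_mem (Units.isOpen.mem_nhds isUnit_one)]
    with p' ⟨v, hv⟩ hp'
  refine ⟨v, ?_, fun x => by rw [conjNear, ← hv, Ring.inverse_unit]⟩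
  rw [hv, intertwiner_mul hp hp', ← hv, Units.mul_inv_cancel_right]

theorem IsCore.eventually (h : IsCore l p q a b) (hp : IsIdempotentElem p)
    (hq : IsIdempotentElem q) : ∀ᶠ x : R × R × R in 𝓝 (l, p, q), IsIdempotentElem x.2.1 →
      IsIdempotentElem x.2.2 → ∃ (a' b' : R) (v w : Rˣ), IsCore x.1 x.2.1 x.2.2 a' b' ∧
        ↑v * (p - a) * ↑v⁻¹ = x.2.1 - a' ∧ ↑w * (q - b) * ↑w⁻¹ = x.2.2 - b' := by
  have hp₂ : Tendsto (fun x : R × R × R => x.2.1) (𝓝 (l, p, q)) (𝓝 p) :=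
    (continuous_fst.comp continuous_snd).continuousAt
  have hq₂ : Tendsto (fun x : R × R × R => x.2.2) (𝓝 (l, p, q)) (𝓝 q) :=
    (continuous_snd.comp continuous_snd).continuousAt
  have ha := (tendsto_conjNear hp a).comp hp₂
  have hb := (tendsto_conjNear hq b).comp hq₂
  have hl : Tendsto Prod.fst (𝓝 (l, p, q)) (𝓝 l) := continuousAt_fst
  have hu := (((hb.mul hl).mul ha).add ((hb.const_sub 1).mul (ha.const_sub 1))).eventually_mem
    (Units.isOpen.mem_nhds h.isUnit)
  filter_upwards [hu, hp₂.eventually (eventually_exists_conjNear_eq hp),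
    hq₂.eventually (eventually_exists_conjNear_eq hq)] with x hu hv hw hx₁ hx₂
  obtain ⟨v, hvp, hv⟩ := hv hx₁
  obtain ⟨w, hwq, hw⟩ := hw hx₂
  simp only [Function.comp_apply, hv, hw] at hu
  refine ⟨_, _, v, w, hvp ▸ hwq ▸ h.conj v w hu, ?_, ?_⟩
  · rw [mul_sub, sub_mul, hvp]
  · rw [mul_sub, sub_mul, hwq]

end NormedRing
end CommonCompl

/-! ### Subspaces reduced by a projection -/

namespace CommonCompl

open scoped InnerProductSpace

section Dim

variable {H : Type*} [NormedAddCommGroup H] [InnerProductSpace ℂ H] {e f x y : H →L[ℂ] H}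
  {S T : Submodule ℂ H}

theorem dim_lt_top_iff : dim S < ⊤ ↔ FiniteDimensional ℂ S := by
  rw [dim, Cardinal.toENat_lt_top, Module.rank_lt_aleph0_iff]

theorem dim_eq_top_iff : dim S = ⊤ ↔ ¬ FiniteDimensional ℂ S := by
  rw [← dim_lt_top_iff, lt_top_iff_ne_top, not_not]

theorem dim_eq_finrank (S : Submodule ℂ H) [FiniteDimensional ℂ S] :
    dim S = Module.finrank ℂ S := by
  rw [dim, ← Module.finrank_eq_rank, Cardinal.toENat_nat]

theorem dim_mono (h : S ≤ T) : dim S ≤ dim T :=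
  OrderHomClass.mono Cardinal.toENat (Submodule.rank_mono h)

theorem dim_range_mul_mul_le (x f y : H →L[ℂ] H) : dim (x * f * y).range ≤ dim f.range := by
  have h : LinearMap.rank ((x * f * y : H →L[ℂ] H) : H →ₗ[ℂ] H) ≤ LinearMap.rank (f : H →ₗ[ℂ] H) :=
    (LinearMap.rank_comp_le_left (y : H →ₗ[ℂ] H) ((x * f : H →L[ℂ] H) : H →ₗ[ℂ] H)).trans
      (LinearMap.rank_comp_le_right (f : H →ₗ[ℂ] H) (x : H →ₗ[ℂ] H))
  exact OrderHomClass.mono Cardinal.toENat h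

theorem dim_range_conj (v : (H →L[ℂ] H)ˣ) (f : H →L[ℂ] H) :
    dim (↑v * f * ↑v⁻¹ : H →L[ℂ] H).range = dim f.range := by
  have h : ↑v⁻¹ * (↑v * f * ↑v⁻¹) * ↑v = f := by
    rw [mul_assoc, Units.inv_mul_cancel_right, Units.inv_mul_cancel_left]
  refine (dim_range_mul_mul_le _ _ _).antisymm ?_
  conv_lhs => rw [← h]
  exact dim_range_mul_mul_le _ _ _

theorem dim_range_eq_of_mul_eq (hef : e * f = e) (hfe : f * e = f) : dim e.range = dim f.range :=
  (by simpa only [hef, mul_one] using dim_range_mul_mul_le e f 1 :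
    dim e.range ≤ dim f.range).antisymm
    (by simpa only [hfe, mul_one] using dim_range_mul_mul_le f e 1)

theorem mem_range_iff (he : IsIdempotentElem e) {v : H} : v ∈ e.range ↔ e v = v :=
  LinearMap.IsIdempotentElem.mem_range_iff
    (ContinuousLinearMap.IsIdempotentElem.toLinearMap he)

theorem re_inner_nonneg {R : H →L[ℂ] H} (hR : 0 ≤ R) (v : H) : 0 ≤ RCLike.re ⟪R v, v⟫_ℂ :=
  ((ContinuousLinearMap.nonneg_iff_isPositive R).1 hR).re_inner_nonneg_left v

end Dim

section StarProjection

variable {H : Type*} [NormedAddCommGroup H] [InnerProductSpace ℂ H] [CompleteSpace H]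
  {P Q E R : H →L[ℂ] H}

theorem ker_eq_orthogonal_range (hR : IsSelfAdjoint R) : R.ker = R.rangeᗮ := by
  rw [ContinuousLinearMap.orthogonal_range, ← ContinuousLinearMap.star_eq_adjoint, hR.star_eq]

theorem range_one_sub (hP : IsStarProjection P) : (1 - P).range = P.rangeᗮ := by
  rw [← ker_eq_orthogonal_range hP.isSelfAdjoint]
  exact (LinearMap.IsIdempotentElem.ker_eq_range_one_sub
    (ContinuousLinearMap.IsIdempotentElem.toLinearMap hP.isIdempotentElem)).symm

theorem mem_orthogonal_iff (hP : IsStarProjection P) {x : H} : x ∈ P.rangeᗮ ↔ P x = 0 := by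
  rw [← ker_eq_orthogonal_range hP.isSelfAdjoint]
  rfl

theorem commute_starProjection {K : Submodule ℂ H} [K.HasOrthogonalProjection]
    (hR : IsSelfAdjoint R) (hK : ∀ x ∈ K, R x ∈ K) : Commute K.starProjection R := by
  have hE : IsStarProjection K.starProjection := isStarProjection_starProjection
  have h : K.starProjection * (R * K.starProjection) = R * K.starProjection := by
    ext x
    exact Submodule.starProjection_eq_self_iff.2 (hK _ (K.starProjection_apply_mem x))
  have h' := congrArg star h
  simp only [star_mul, hE.isSelfAdjoint.star_eq, hR.star_eq] at h'
  rw [Commute, SemiconjBy, ← h', mul_assoc, h]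

theorem re_inner_apply_eq (hR : IsSelfAdjoint R) (x : H) :
    RCLike.re ⟪R x, x⟫_ℂ = RCLike.re ⟪R⁺ x, x⟫_ℂ - RCLike.re ⟪R⁻ x, x⟫_ℂ := by
  conv_lhs => rw [← CFC.posPart_sub_negPart R hR]
  rw [sub_apply, inner_sub_left, map_sub]

theorem posPart_apply_eq_zero {x : H} (hx : x ∈ R⁻.kerᗮ) : R⁺ x = 0 := by
  have hN : IsSelfAdjoint R⁻ := .of_nonneg (CFC.negPart_nonneg R)
  have h := ContinuousLinearMap.orthogonal_ker R⁻
  rw [← ContinuousLinearMap.star_eq_adjoint, hN.star_eq] at h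
  refine Submodule.topologicalClosure_minimal _ ?_ R⁺.isClosed_ker (h ▸ hx)
  rintro _ ⟨y, rfl⟩
  exact DFunLike.congr_fun (CFC.posPart_mul_negPart R) y

theorem exists_spectral_projection (hR : IsSelfAdjoint R) :
    ∃ E : H →L[ℂ] H, IsStarProjection E ∧
      (∀ B, IsSelfAdjoint B → Commute R B → Commute E B) ∧
      (∀ x, E x = x → 0 ≤ RCLike.re ⟪R x, x⟫_ℂ) ∧ ∀ x, E x = 0 → RCLike.re ⟪R x, x⟫_ℂ ≤ 0 := by
  have : CompleteSpace R⁻.ker := R⁻.isClosed_ker.completeSpace_coe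
  refine ⟨R⁻.ker.starProjection, isStarProjection_starProjection, fun B hB hRB => ?_,
    fun x hx => ?_, fun x hx => ?_⟩
  · have hNB : Commute R⁻ B := hRB.cfcₙ_real _
    refine commute_starProjection hB fun x (hx : R⁻ x = 0) => ?_
    exact (DFunLike.congr_fun hNB.eq x).trans (by simp [hx])
  · have hx₀ : R⁻ x = 0 := Submodule.starProjection_eq_self_iff.1 hx
    rw [re_inner_apply_eq hR, hx₀, inner_zero_left, map_zero, sub_zero]
    exact re_inner_nonneg (CFC.posPart_nonneg R) x
  · have hx₀ := posPart_apply_eq_zero ((Submodule.starProjection_apply_eq_zero_iff _).1 hx)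
    rw [re_inner_apply_eq hR, hx₀, inner_zero_left, map_zero, zero_sub, Left.neg_nonpos_iff]
    exact re_inner_nonneg (CFC.negPart_nonneg R) x

end StarProjection

section Reduces

variable {H : Type*} [NormedAddCommGroup H] [InnerProductSpace ℂ H] [CompleteSpace H]
  {P Q E : H →L[ℂ] H} {δ : ℝ}

/-- The projection `E` commutes with `P` and `Q`, and `P - Q` is bounded by `δ` on the kernel of `E`
and bounded below by `δ` on the range of `E`. -/
structure Reduces (δ : ℝ) (P Q E : H →L[ℂ] H) : Prop where
  isStarProjection : IsStarProjection E
  commute_left : Commute E P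
  commute_right : Commute E Q
  norm_le : ‖(P - Q) * (1 - E)‖ ≤ δ
  le_norm : ∀ x, E x = x → δ * ‖x‖ ≤ ‖(P - Q) x‖

theorem commute_sub_mul_self {R : Type*} [Ring R] {p q : R} (hp : IsIdempotentElem p)
    (hq : IsIdempotentElem q) : Commute ((p - q) * (p - q)) p := by
  have h : (p - q) * (p - q) = p - p * q - q * p + q := by
    simp only [mul_sub, sub_mul, hp.eq, hq.eq]
    abel
  have hqp : p * (q * p) = p * q * p := (mul_assoc p q p).symm
  have hpq : p * (p * q) = p * q := by rw [← mul_assoc, hp.eq]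
  rw [h, Commute, SemiconjBy]
  simp only [add_mul, sub_mul, mul_add, mul_sub, hp.eq, hpq, hqp, mul_assoc q p p]
  abel

theorem re_inner_sub_algebraMap (hP : IsSelfAdjoint P) (δ : ℝ) (x : H) :
    RCLike.re ⟪(P * P - algebraMap ℝ (H →L[ℂ] H) (δ ^ 2)) x, x⟫_ℂ =
      ‖P x‖ ^ 2 - (δ * ‖x‖) ^ 2 := by
  have h : ⟪P (P x), x⟫_ℂ = ⟪P x, P x⟫_ℂ := hP.isSymmetric (P x) x
  have hc : algebraMap ℝ (H →L[ℂ] H) (δ ^ 2) x = ((δ ^ 2 : ℝ) : ℂ) • x := by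
    rw [Algebra.algebraMap_eq_smul_one]
    rfl
  rw [sub_apply, mul_apply_eq_comp, hc, inner_sub_left, h, map_sub,
    inner_self_eq_norm_sq, inner_smul_left, Complex.conj_ofReal, mul_pow,
    ← inner_self_eq_norm_sq (𝕜 := ℂ) x]
  exact congrArg _ (Complex.re_ofReal_mul _ _)

theorem exists_reduces (hP : IsStarProjection P) (hQ : IsStarProjection Q) (hδ : 0 ≤ δ) :
    ∃ E, Reduces δ P Q E := by
  have hD : IsSelfAdjoint (P - Q) := hP.isSelfAdjoint.sub hQ.isSelfAdjoint
  have hR : IsSelfAdjoint ((P - Q) * (P - Q) - algebraMap ℝ (H →L[ℂ] H) (δ ^ 2)) :=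
    (by rw [IsSelfAdjoint, star_mul, hD.star_eq] : IsSelfAdjoint ((P - Q) * (P - Q))).sub
      (.algebraMap _ (.all _))
  obtain ⟨E, hE, hcomm, hpos, hneg⟩ := exists_spectral_projection hR
  simp only [re_inner_sub_algebraMap hD, sub_nonneg, sub_nonpos] at hpos hneg
  have hswap : (P - Q) * (P - Q) = (Q - P) * (Q - P) := by noncomm_ring
  refine ⟨E, hE, hcomm P hP.isSelfAdjoint ?_, hcomm Q hQ.isSelfAdjoint ?_, ?_, fun x hx => ?_⟩
  · exact (commute_sub_mul_self hP.isIdempotentElem hQ.isIdempotentElem).sub_left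
      (Algebra.commutes _ _)
  · rw [hswap]
    exact (commute_sub_mul_self hQ.isIdempotentElem hP.isIdempotentElem).sub_left
      (Algebra.commutes _ _)
  · refine ContinuousLinearMap.opNorm_le_bound _ hδ fun x => ?_
    have hx : E ((1 - E) x) = 0 := DFunLike.congr_fun hE.mul_one_sub_self x
    calc ‖(P - Q) ((1 - E) x)‖ ≤ δ * ‖(1 - E) x‖ :=
          pow_le_pow_iff_left₀ (norm_nonneg _) (by positivity) two_ne_zero |>.1 (hneg _ hx)
      _ ≤ δ * (1 * ‖x‖) := by
          gcongr
          exact (1 - E).le_of_opNorm_le hE.one_sub.norm_le x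
      _ = δ * ‖x‖ := by rw [one_mul]
  · exact pow_le_pow_iff_left₀ (by positivity) (norm_nonneg _) two_ne_zero |>.1 (hpos x hx)

end Reduces
end CommonCompl

namespace CommonCompl

open scoped InnerProductSpace

section Block

variable {H : Type*} [NormedAddCommGroup H] [InnerProductSpace ℂ H] [CompleteSpace H]
  {P Q E L : H →L[ℂ] H} {δ : ℝ}

theorem norm_sq_eq_add_of_isStarProjection (hP : IsStarProjection P) (x : H) :
    ‖x‖ ^ 2 = ‖P x‖ ^ 2 + ‖x - P x‖ ^ 2 := by
  have h : ⟪P x, x - P x⟫_ℂ = 0 :=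
    calc ⟪P x, x - P x⟫_ℂ = ⟪x, P (x - P x)⟫_ℂ := hP.isSelfAdjoint.isSymmetric x (x - P x)
      _ = ⟪x, (0 : H)⟫_ℂ := congrArg (⟪x, ·⟫_ℂ) (DFunLike.congr_fun hP.mul_one_sub_self x)
      _ = 0 := inner_zero_right x
  simpa only [sq, add_sub_cancel] using
    norm_add_sq_eq_norm_sq_add_norm_sq_of_inner_eq_zero (P x) (x - P x) h

theorem isUnit_mul_add_one_sub {R : H →L[ℂ] H} (hE : IsStarProjection E) (hR : IsSelfAdjoint R)
    (h : Commute E R) (hδ₀ : 0 < δ) (hδ : δ ≤ 1) (hRE : ∀ x, E x = x → δ * ‖x‖ ≤ ‖R x‖) :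
    IsUnit (R * E + (1 - E)) := by
  set D : H →L[ℂ] H := R * E + (1 - E) with hD
  have hD' : IsSelfAdjoint D := by
    rw [IsSelfAdjoint, hD, star_add, star_mul, star_sub, star_one, hE.isSelfAdjoint.star_eq,
      hR.star_eq, h.eq]
  have hbound : ∀ x, δ ^ 2 * ‖x‖ ^ 2 ≤ ‖D x‖ ^ 2 := fun x => by
    have hED : E * D = R * E := by
      rw [hD, mul_add, ← mul_assoc, h.eq, mul_assoc, hE.isIdempotentElem.eq, hE.mul_one_sub_self,
        add_zero]
    have hx₁ : E (D x) = R (E x) := DFunLike.congr_fun hED x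
    have hx₂ : D x - R (E x) = x - E x := add_sub_cancel_left (R (E x)) (x - E x)
    have hx := hRE (E x) (DFunLike.congr_fun hE.isIdempotentElem.eq x)
    rw [norm_sq_eq_add_of_isStarProjection hE (D x), hx₁, hx₂,
      norm_sq_eq_add_of_isStarProjection hE x, mul_add, ← mul_pow]
    gcongr
    exact mul_le_of_le_one_left (sq_nonneg _) (pow_le_one₀ hδ₀.le hδ)
  have hu : IsUnit (D * D) := by
    refine ContinuousLinearMap.isUnit_of_forall_le_norm_inner_map (c := ⟨δ ^ 2, sq_nonneg δ⟩) _
      (pow_pos hδ₀ 2) fun x => ?_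
    rw [mul_apply_eq_comp, show ⟪D (D x), x⟫_ℂ = ⟪D x, D x⟫_ℂ from hD'.isSymmetric (D x) x,
      inner_self_eq_norm_sq_to_K, norm_pow, RCLike.norm_ofReal, abs_norm, mul_comm]
    exact hbound x
  exact ((Commute.refl D).isUnit_mul_iff.1 hu).1

theorem sub_mul_one_sub {R : Type*} [Ring R] (x y : R) : x - x * (1 - y) = x * y := by
  rw [mul_sub, mul_one, sub_sub_cancel]

namespace Reduces

theorem symm (h : Reduces δ P Q E) : Reduces δ Q P E where
  isStarProjection := h.isStarProjection
  commute_left := h.commute_right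
  commute_right := h.commute_left
  norm_le := by simpa only [← neg_sub P Q, neg_mul, norm_neg] using h.norm_le
  le_norm x hx := (h.le_norm x hx).trans_eq (norm_sub_rev (P x) (Q x))

theorem isStarProjection_mul (h : Reduces δ P Q E) (hP : IsStarProjection P) :
    IsStarProjection (P * E) :=
  hP.mul h.isStarProjection h.commute_left.symm

theorem isStarProjection_mul_one_sub (h : Reduces δ P Q E) (hP : IsStarProjection P) :
    IsStarProjection (P * (1 - E)) :=
  hP.mul h.isStarProjection.one_sub ((Commute.one_left P).sub_left h.commute_left).symm

theorem mul_mul (h : Reduces δ P Q E) (hP : IsIdempotentElem P) : P * E * P = P * E := by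
  rw [mul_assoc, h.commute_left.eq, ← mul_assoc, hP.eq]

theorem mul_one_sub_mul (h : Reduces δ P Q E) (hP : IsIdempotentElem P) :
    P * (1 - E) * P = P * (1 - E) := by
  rw [mul_sub, mul_one, sub_mul, h.mul_mul hP, hP.eq]

theorem isUnit (h : Reduces δ P Q E) (hP : IsStarProjection P) (hQ : IsStarProjection Q)
    (hδ₀ : 0 < δ) (hδ : δ ≤ 1) : IsUnit (P * E - Q * E + (1 - E)) := by
  rw [← sub_mul]
  exact isUnit_mul_add_one_sub h.isStarProjection (hP.isSelfAdjoint.sub hQ.isSelfAdjoint)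
    (h.commute_left.sub_right h.commute_right) hδ₀ hδ h.le_norm

theorem isCore (h : Reduces δ P Q E) (hP : IsStarProjection P) (hQ : IsStarProjection Q)
    (hL : L * Q = Q) (hδ : δ * (1 + ‖L‖) < 1) :
    IsCore L P Q (P * (1 - E)) (Q * (1 - E)) := by
  have hA := h.isStarProjection_mul_one_sub hP
  have hB := h.symm.isStarProjection_mul_one_sub hQ
  have hLB : L * (Q * (1 - E)) = Q * (1 - E) := by rw [← mul_assoc, hL]
  set A := P * (1 - E) with hAdef
  set B := Q * (1 - E) with hBdef
  have hAB : ‖A - B‖ ≤ δ := by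
    rw [hAdef, hBdef, ← sub_mul]
    exact h.norm_le
  refine ⟨hA.isIdempotentElem, hB.isIdempotentElem, ?_, h.mul_one_sub_mul hP.isIdempotentElem, ?_,
    h.symm.mul_one_sub_mul hQ.isIdempotentElem, ?_⟩
  · rw [hAdef, ← mul_assoc, hP.isIdempotentElem.eq]
  · rw [hBdef, ← mul_assoc, hQ.isIdempotentElem.eq]
  · have hU : 1 - (B * L * A + (1 - B) * (1 - A)) = (A - B) * A - B * L * (A - B) := by
      rw [mul_sub (B * L), mul_assoc B L B, hLB, hB.isIdempotentElem.eq, sub_mul A,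
        hA.isIdempotentElem.eq]
      noncomm_ring
    rw [← sub_sub_cancel 1 (B * L * A + _), hU]
    refine isUnit_one_sub_of_norm_lt_one (lt_of_le_of_lt ?_ hδ)
    calc ‖(A - B) * A - B * L * (A - B)‖ ≤ ‖A - B‖ * ‖A‖ + ‖B‖ * ‖L‖ * ‖A - B‖ :=
          (norm_sub_le _ _).trans (add_le_add (norm_mul_le _ _) norm_mul₃_le)
      _ ≤ δ * 1 + 1 * ‖L‖ * δ := by
          have := hA.norm_le
          have := hB.norm_le
          have := (norm_nonneg _).trans hAB
          gcongr
      _ = δ * (1 + ‖L‖) := by ring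

end Reduces
end Block
end CommonCompl

/-! ### Common complements and compactness -/

namespace CommonCompl

open scoped InnerProductSpace
open TopologicalSpace

theorem IsCore.exists_obliquePair {R : Type*} [Ring R] {p q a b : R} (h : IsCore q p q a b) :
    ∃ k, ObliquePair a b k b ∧ k * b = k := by
  obtain ⟨k, hak, hkb, hka, hbk⟩ :=
    exists_corner_inverse h.isIdempotentElem_left h.isIdempotentElem_right h.isUnit
  rw [← hkb, mul_assoc k b q, h.right_mul, hkb] at hka
  rw [h.right_mul] at hbk
  exact ⟨k, ⟨hak, hka, h.isIdempotentElem_right, h.isIdempotentElem_right, hkb, hbk⟩, hkb⟩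

section HilbertBasis

variable {K : Type*} [NormedAddCommGroup K] [InnerProductSpace ℂ K]

theorem countable_of_orthonormal [SeparableSpace K] {ι : Type*} {v : ι → K} (hv : Orthonormal ℂ v) :
    Countable ι := by
  have hdist : ∀ i j, i ≠ j → 1 ≤ dist (v i) (v j) := fun i j hij => by
    have h := norm_sub_sq (𝕜 := ℂ) (v i) (v j)
    rw [hv.2 hij, hv.1, hv.1, map_zero] at h
    rw [dist_eq_norm]
    nlinarith [norm_nonneg (v i - v j)]
  refine Pairwise.countable_of_isOpen_disjoint (s := fun i => Metric.ball (v i) (1 / 2))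
    (fun i j hij => Metric.ball_disjoint_ball ?_) (fun _ => Metric.isOpen_ball)
    fun i => ⟨v i, Metric.mem_ball_self (by norm_num)⟩
  linarith [hdist i j hij]

theorem nonempty_hilbertBasis_nat [CompleteSpace K] [SeparableSpace K]
    (h : ¬ FiniteDimensional ℂ K) : Nonempty (HilbertBasis ℕ ℂ K) := by
  obtain ⟨w, b, -⟩ := exists_hilbertBasis ℂ K
  have : Countable w := countable_of_orthonormal b.orthonormal
  have : Infinite w := by
    by_contra hfin
    rw [not_infinite_iff_finite] at hfin
    have := Fintype.ofFinite w
    exact h (Module.Basis.finiteDimensional_of_finite b.toOrthonormalBasis.toBasis)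
  obtain ⟨e⟩ := nonempty_equiv_of_countable (α := ℕ) (β := w)
  refine ⟨HilbertBasis.mk (v := b ∘ e) (b.orthonormal.comp e e.injective) ?_⟩
  rw [Set.range_comp, e.range_eq_univ, Set.image_univ, b.dense_span]

end HilbertBasis

variable {H : Type*} [NormedAddCommGroup H] [InnerProductSpace ℂ H]
  {P Q E : H →L[ℂ] H} {δ : ℝ}

section CommonComplement

theorem nonempty_equiv_of_dim_eq [SeparableSpace H] {S T : Submodule ℂ H} [CompleteSpace S]
    [CompleteSpace T] (h : dim S = dim T) : Nonempty (S ≃L[ℂ] T) := by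
  by_cases hS : FiniteDimensional ℂ S
  · have hT : FiniteDimensional ℂ T := dim_lt_top_iff.1 (h ▸ dim_lt_top_iff.2 hS)
    rw [dim_eq_finrank S, dim_eq_finrank T] at h
    exact ⟨.ofFinrankEq (by exact_mod_cast h)⟩
  · obtain ⟨b⟩ := nonempty_hilbertBasis_nat hS
    obtain ⟨c⟩ := nonempty_hilbertBasis_nat (dim_eq_top_iff.1 (h ▸ dim_eq_top_iff.2 hS))
    exact ⟨(b.repr.trans c.repr.symm).toContinuousLinearEquiv⟩

theorem exists_cornerIso_of_dim_eq [CompleteSpace H] [SeparableSpace H] (hP : IsIdempotentElem P)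
    (hQ : IsIdempotentElem Q) (h : dim P.range = dim Q.range) : ∃ A B, CornerIso P Q A B := by
  have hP' := ContinuousLinearMap.IsIdempotentElem.isClosed_range hP
  have hQ' := ContinuousLinearMap.IsIdempotentElem.isClosed_range hQ
  have := hP'.completeSpace_coe
  have := hQ'.completeSpace_coe
  obtain ⟨φ⟩ := nonempty_equiv_of_dim_eq h
  have hPs : ∀ x : P.range, P.rangeRestrict (x : H) = x := fun x =>
    Subtype.ext ((mem_range_iff hP).1 x.2)
  have hQs : ∀ x : Q.range, Q.rangeRestrict (x : H) = x := fun x =>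
    Subtype.ext ((mem_range_iff hQ).1 x.2)
  refine ⟨Q.range.subtypeL ∘L φ ∘L P.rangeRestrict, P.range.subtypeL ∘L φ.symm ∘L Q.rangeRestrict,
    ?_, ?_, ?_, ?_, ?_, ?_⟩ <;> ext x
  · exact congrArg Subtype.val (hQs (φ (P.rangeRestrict x)))
  · exact congrArg (fun y => (φ y : H)) (hPs (P.rangeRestrict x))
  · exact congrArg Subtype.val (hPs (φ.symm (Q.rangeRestrict x)))
  · exact congrArg (fun y => (φ.symm y : H)) (hQs (Q.rangeRestrict x))
  · refine (congrArg (fun y => (φ.symm y : H)) (hQs (φ (P.rangeRestrict x)))).trans ?_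
    exact congrArg Subtype.val (φ.symm_apply_apply (P.rangeRestrict x))
  · refine (congrArg (fun y => (φ y : H)) (hPs (φ.symm (Q.rangeRestrict x)))).trans ?_
    exact congrArg Subtype.val (φ.apply_symm_apply (Q.rangeRestrict x))

theorem exists_mul_eq_and_ker_eq_of_isCompl [CompleteSpace H] {Z : Submodule ℂ H}
    (hP : IsIdempotentElem P) (hZ : IsClosed (Z : Set H)) (h : IsCompl P.range Z) :
    ∃ F : H →L[ℂ] H, P * F = F ∧ F * P = P ∧ F.ker = Z := by
  have ht := Submodule.IsCompl.isTopCompl_of_isClosed h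
    (ContinuousLinearMap.IsIdempotentElem.isClosed_range hP) hZ
  refine ⟨P.range.subtypeL ∘L P.range.projectionOntoL Z ht, ?_, ?_, ?_⟩ <;> ext x
  · exact (mem_range_iff hP).1 (P.range.projectionOntoL Z ht x).2
  · exact congrArg Subtype.val (Submodule.projectionOntoL_apply_left ht ⟨P x, x, rfl⟩)
  · exact (ZeroMemClass.coe_eq_zero (x := P.range.projectionOntoL Z ht x)).trans
      (Submodule.projectionOntoL_apply_eq_zero_iff ht)

theorem mul_eq_of_ker_le {F G : H →L[ℂ] H} (hG : IsIdempotentElem G) (h : G.ker ≤ F.ker) :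
    F * G = F :=
  ContinuousLinearMap.coe_injective <| (LinearMap.IsIdempotentElem.comp_eq_left_iff
    (ContinuousLinearMap.IsIdempotentElem.toLinearMap hG) (F : H →ₗ[ℂ] H)).2 h

theorem ker_le_of_mul_eq {F G : H →L[ℂ] H} (h : F * G = F) : G.ker ≤ F.ker :=
  fun x (hx : G x = 0) => (DFunLike.congr_fun h x).symm.trans ((congrArg F hx).trans (map_zero F))

theorem isCompl_range_ker_of_mul_eq {F : H →L[ℂ] H} (hPF : P * F = F) (hFP : F * P = P) :
    IsCompl P.range F.ker :=
  LinearMap.IsProj.isCompl (f := (F : H →ₗ[ℂ] H)) ⟨fun x => ⟨F x, DFunLike.congr_fun hPF x⟩, by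
    rintro _ ⟨x, rfl⟩
    exact DFunLike.congr_fun hFP x⟩

theorem hasCommonComplement_iff [CompleteSpace H] (hP : IsIdempotentElem P)
    (hQ : IsIdempotentElem Q) :
    HasCommonComplement P.range Q.range ↔ ∃ F G, ObliquePair P Q F G := by
  constructor
  · rintro ⟨Z, hZ, hPZ, hQZ⟩
    obtain ⟨F, hPF, hFP, rfl⟩ := exists_mul_eq_and_ker_eq_of_isCompl hP hZ hPZ
    obtain ⟨G, hQG, hGQ, hG⟩ := exists_mul_eq_and_ker_eq_of_isCompl hQ hZ hQZ
    exact ⟨F, G, hPF, hFP, hQG, hGQ,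
      mul_eq_of_ker_le (isIdempotentElem_of_mul_eq hQG hGQ) hG.le,
      mul_eq_of_ker_le (isIdempotentElem_of_mul_eq hPF hFP) hG.ge⟩
  · rintro ⟨F, G, h⟩
    have hker : F.ker = G.ker :=
      (ker_le_of_mul_eq h.right_mul_left).antisymm (ker_le_of_mul_eq h.left_mul_right)
    exact ⟨F.ker, F.isClosed_ker, isCompl_range_ker_of_mul_eq h.mul_left h.left_mul,
      hker ▸ isCompl_range_ker_of_mul_eq h.mul_right h.right_mul⟩

end CommonComplement

section Compact

theorem isCompactOperator_of_finiteDimensional_range {f : H →L[ℂ] H}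
    (hf : FiniteDimensional ℂ f.range) : IsCompactOperator f := by
  have : ProperSpace f.range := FiniteDimensional.proper ℂ _
  exact (isCompactOperator_of_locallyCompactSpace_dom f.rangeRestrict).clm_comp f.range.subtypeL

variable [CompleteSpace H]

/-- On the range of `1 - E` the subspaces are close to each other; on the range of `E` they are in
direct sum, and a graph is a common complement. -/
theorem Reduces.hasCommonComplement [SeparableSpace H] (h : Reduces δ P Q E)
    (hP : IsStarProjection P) (hQ : IsStarProjection Q) (hδ₀ : 0 < δ) (hδ : 2 * δ < 1)
    (hd : dim (P * E).range = dim (Q * E).range) : HasCommonComplement P.range Q.range := by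
  have hQQ := hQ.isIdempotentElem
  have hE := h.isStarProjection.isIdempotentElem
  have hEE : E * (1 - E) = 0 := hE.mul_one_sub_self
  have hEE' : (1 - E) * E = 0 := hE.one_sub_mul_self
  have hEP : ∀ X, E * (P * X) = P * (E * X) := fun X => by
    rw [← mul_assoc, h.commute_left.eq, mul_assoc]
  have hEQ : ∀ X, E * (Q * X) = Q * (E * X) := fun X => by
    rw [← mul_assoc, h.commute_right.eq, mul_assoc]
  have hPE := (h.isStarProjection_mul hP).isIdempotentElem
  have hQE := (h.symm.isStarProjection_mul hQ).isIdempotentElem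
  have hcore : IsCore Q P Q (P * (1 - E)) (Q * (1 - E)) :=
    h.isCore hP hQ hQQ.eq <| by nlinarith [hQ.norm_le]
  obtain ⟨K, hK, hKB⟩ := hcore.exists_obliquePair
  obtain ⟨A, B, hAB⟩ := exists_cornerIso_of_dim_eq hPE hQE hd
  obtain ⟨F, G, hFG, hFE, hGE⟩ := hAB.exists_obliquePair hPE hQE hE
    (by rw [hEP, hE.eq]) (by rw [mul_assoc, hE.eq]) (by rw [hEQ, hE.eq]) (by rw [mul_assoc, hE.eq])
    (h.isUnit hP hQ hδ₀ (by linarith))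
  have hsum := hK.add (e := E) hFG (by rw [hEP, hEE, mul_zero]) (by rw [hEQ, hEE, mul_zero])
    (by rw [← hKB, mul_assoc, mul_assoc, hEE', mul_zero, mul_zero])
    (by rw [mul_assoc, hEE', mul_zero])
    (by rw [hEP, hE.eq]) (by rw [hEQ, hE.eq]) hFE hGE
    (by rw [mul_assoc, hEE', mul_zero]) (by rw [mul_assoc, hEE', mul_zero])
    (by rw [mul_assoc, hE.eq]) (by rw [mul_assoc, hE.eq])
  rw [← mul_add, sub_add_cancel, mul_one, ← mul_add, sub_add_cancel, mul_one] at hsum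
  exact (hasCommonComplement_iff hP.isIdempotentElem hQQ).2 ⟨_, _, hsum⟩

theorem Reduces.finiteDimensional (h : Reduces δ P Q E) (hP : IsStarProjection P) (hδ₀ : 0 < δ)
    (hc : IsCompactOperator ((1 - Q) * P : H →L[ℂ] H)) :
    FiniteDimensional ℂ (P * E).range := by
  have hPE := h.isStarProjection_mul hP
  set X : Submodule ℂ H := (P * E).range
  have hPPE : P * (P * E) = P * E := by rw [← mul_assoc, hP.isIdempotentElem.eq]
  have hEPE : E * (P * E) = P * E := by
    rw [← mul_assoc, h.commute_left.eq, mul_assoc, h.isStarProjection.isIdempotentElem.eq]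
  have hXP : ∀ x : X, P x = x ∧ E x = x := by
    rintro ⟨_, x, rfl⟩
    exact ⟨DFunLike.congr_fun hPPE x, DFunLike.congr_fun hEPE x⟩
  have : CompleteSpace X :=
    (ContinuousLinearMap.IsIdempotentElem.isClosed_range hPE.isIdempotentElem).completeSpace_coe
  let f : X →L[ℂ] H := ((1 - Q) * P) ∘L X.subtypeL
  have hanti : AntilipschitzWith δ.toNNReal⁻¹ f := by
    refine f.antilipschitz_of_bound fun x => ?_
    have hfx : f x = P x - Q x := by
      change P x - Q (P x) = _
      rw [(hXP x).1]
    rw [hfx, NNReal.coe_inv, Real.coe_toNNReal _ hδ₀.le, inv_mul_eq_div, le_div_iff₀ hδ₀, mul_comm]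
    exact h.le_norm x (hXP x).2
  have hemb := hanti.isClosedEmbedding f.uniformContinuous
  obtain ⟨K, hK, hK₀⟩ := hc.comp_clm X.subtypeL
  exact .of_isCompactOperator_id ⟨f ⁻¹' K, hemb.isCompact_preimage hK, hK₀⟩

theorem isCompactOperator_of_reduces (hQ : IsStarProjection Q)
    (h : ∀ ε > 0, ∃ δ ≤ ε, ∃ E, Reduces δ P Q E ∧ FiniteDimensional ℂ (P * E).range) :
    IsCompactOperator ((1 - Q) * P : H →L[ℂ] H) := by
  have hcl : IsClosed {f : H →L[ℂ] H | IsCompactOperator f} :=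
    isClosed_setOfPred_isCompactOperator
  refine hcl.closure_subset (Metric.mem_closure_iff.2 fun ε hε => ?_)
  obtain ⟨δ, hδ, E, hE, hfin⟩ := h (ε / 2) (half_pos hε)
  have hcomp : IsCompactOperator ((1 - Q) * (P * E) : H →L[ℂ] H) :=
    (isCompactOperator_of_finiteDimensional_range hfin).clm_comp (1 - Q : H →L[ℂ] H)
  refine ⟨(1 - Q) * (P * E), hcomp, ?_⟩
  have heq : (1 - Q) * P - (1 - Q) * (P * E) = (1 - Q) * ((P - Q) * (1 - E)) := by
    rw [sub_mul P Q, mul_sub (1 - Q), ← mul_assoc _ Q,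
      hQ.isIdempotentElem.one_sub_mul_self, zero_mul, sub_zero, ← mul_sub, mul_sub P, mul_one]
  calc dist ((1 - Q) * P) ((1 - Q) * (P * E)) = ‖(1 - Q) * ((P - Q) * (1 - E))‖ := by
        rw [dist_eq_norm, heq]
    _ ≤ 1 * δ := (norm_mul_le _ _).trans <|
        mul_le_mul hQ.one_sub.norm_le hE.norm_le (norm_nonneg _) zero_le_one
    _ < ε := by linarith

theorem isCompactOperator_or_of_not_hasCommonComplement [SeparableSpace H]
    (hP : IsStarProjection P) (hQ : IsStarProjection Q)
    (h : ¬ HasCommonComplement P.range Q.range) :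
    IsCompactOperator ((1 - Q) * P : H →L[ℂ] H) ∨
      IsCompactOperator ((1 - P) * Q : H →L[ℂ] H) := by
  by_contra! hcon
  have h₁ := mt (isCompactOperator_of_reduces hQ) hcon.1
  have h₂ := mt (isCompactOperator_of_reduces hP) hcon.2
  push Not at h₁ h₂
  obtain ⟨ε₁, hε₁, h₁⟩ := h₁
  obtain ⟨ε₂, hε₂, h₂⟩ := h₂
  set δ := min (min ε₁ ε₂) (1 / 3)
  have hδ₀ : 0 < δ := by positivity
  have hδ₁ : 2 * δ < 1 := by linarith [min_le_right (min ε₁ ε₂) (1 / 3 : ℝ)]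
  obtain ⟨E, hE⟩ := exists_reduces hP hQ hδ₀.le
  have hPE := h₁ δ ((min_le_left _ _).trans (min_le_left _ _)) E hE
  have hQE := h₂ δ ((min_le_left _ _).trans (min_le_right _ _)) E hE.symm
  exact h (hE.hasCommonComplement hP hQ hδ₀ hδ₁
    ((dim_eq_top_iff.2 hPE).trans (dim_eq_top_iff.2 hQE).symm))

end Compact
end CommonCompl

/-! ### Fredholm index -/

namespace CommonCompl

section RankNullity

universe u

variable {K : Type*} {V W X : Type u} [DivisionRing K] [AddCommGroup V] [Module K V]
  [AddCommGroup W] [Module K W] [AddCommGroup X] [Module K X] {f : V →ₗ[K] W} {g : W →ₗ[K] X}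

open LinearMap

theorem exists_quotient_ker_equiv_of_comp_surjective (h : Function.Surjective (g ∘ₗ f)) :
    Nonempty ((g.ker ⧸ f.range.comap g.ker.subtype) ≃ₗ[K] W ⧸ f.range) := by
  refine ⟨(Submodule.quotEquivOfEq _ _ ?_).trans
    ((f.range.mkQ ∘ₗ g.ker.subtype).quotKerEquivOfSurjective ?_)⟩
  · rw [LinearMap.ker_comp, Submodule.ker_mkQ]
  · refine fun y => Submodule.Quotient.induction_on _ y fun w => ?_
    obtain ⟨v, hv⟩ := h (g w)
    refine ⟨⟨w - f v, by rw [mem_ker, map_sub, ← hv, comp_apply, sub_self]⟩, ?_⟩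
    exact (Submodule.Quotient.eq _).2 ⟨-v, by simp⟩

theorem rank_ker_add_rank_ker (h : Function.Surjective (g ∘ₗ f)) :
    Module.rank K f.ker + Module.rank K g.ker =
      Module.rank K (g ∘ₗ f).ker + Module.rank K (W ⧸ f.range) := by
  obtain ⟨e⟩ := exists_quotient_ker_equiv_of_comp_surjective h
  let φ : (g ∘ₗ f).ker →ₗ[K] g.ker := f.restrict fun x hx => hx
  have hφr : f.range.comap g.ker.subtype = φ.range := by
    ext ⟨w, hw⟩
    refine ⟨?_, ?_⟩
    · rintro ⟨v, rfl⟩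
      exact ⟨⟨v, hw⟩, rfl⟩
    · rintro ⟨v, hv⟩
      exact ⟨v, congrArg Subtype.val hv⟩
  have hφk : Module.rank K φ.ker = Module.rank K f.ker := by
    have hle : f.ker ≤ (g ∘ₗ f).ker := ker_le_ker_comp f g
    have : φ.ker = f.ker.comap (g ∘ₗ f).ker.subtype := by
      ext x
      exact Subtype.ext_iff
    rw [this]
    exact (Submodule.comapSubtypeEquivOfLe hle).rank_eq
  rw [← e.rank_eq, hφr, ← Submodule.rank_quotient_add_rank φ.range, ← rank_range_add_rank_ker φ,
    hφk]
  ac_rfl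

end RankNullity

section Index

variable {H : Type*} [NormedAddCommGroup H] [InnerProductSpace ℂ H] {L P Q A B : H →L[ℂ] H}

theorem dim_map_subtype {S : Submodule ℂ H} (T : Submodule ℂ S) :
    dim (T.map S.subtype) = (Module.rank ℂ T).toENat :=
  congrArg Cardinal.toENat (S.equivSubtypeMap T).rank_eq.symm

namespace IsCore

variable {f : P.range →ₗ[ℂ] Q.range}

theorem surjective_rangeRestrict_comp (h : IsCore L P Q A B) (hf : ∀ x, (f x : H) = L x) :
    Function.Surjective
      ((B : H →ₗ[ℂ] H).rangeRestrict ∘ₗ Q.range.subtype ∘ₗ f) := by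
  obtain ⟨K, hAK, -, -, hBLK⟩ :=
    exists_corner_inverse h.isIdempotentElem_left h.isIdempotentElem_right h.isUnit
  have hPK : P * K = K := by rw [← hAK, ← mul_assoc, h.mul_left]
  rintro ⟨_, y, rfl⟩
  refine ⟨⟨K y, K y, DFunLike.congr_fun hPK y⟩, Subtype.ext ?_⟩
  exact (congrArg B (hf _)).trans (DFunLike.congr_fun hBLK y)

theorem map_ker_rangeRestrict (h : IsCore L P Q A B) (hQ : IsIdempotentElem Q) :
    (((B : H →ₗ[ℂ] H).rangeRestrict ∘ₗ Q.range.subtype).ker).map Q.range.subtype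
      = (Q - B).range := by
  ext x
  constructor
  · rintro ⟨y, hy, rfl⟩
    have hBy : B y = 0 := congrArg Subtype.val hy
    exact ⟨y, by simp [(mem_range_iff hQ).1 y.2, hBy]⟩
  · rintro ⟨y, rfl⟩
    have hB : B * (Q - B) = 0 := by rw [mul_sub, h.right_mul, h.isIdempotentElem_right.eq, sub_self]
    have hQB : Q * (Q - B) = Q - B := by rw [mul_sub, hQ.eq, h.mul_right]
    exact ⟨⟨(Q - B) y, (Q - B) y, DFunLike.congr_fun hQB y⟩,
      Subtype.ext (DFunLike.congr_fun hB y), rfl⟩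

theorem dim_map_ker_comp (h : IsCore L P Q A B) (hP : IsIdempotentElem P)
    (hf : ∀ x, (f x : H) = L x) :
    dim (((B : H →ₗ[ℂ] H).rangeRestrict ∘ₗ Q.range.subtype ∘ₗ f).ker.map P.range.subtype)
      = dim (P - A).range := by
  obtain ⟨K, hAK, hKB, hKLA, hBLK⟩ :=
    exists_corner_inverse h.isIdempotentElem_left h.isIdempotentElem_right h.isUnit
  have hPK : P * K = K := by rw [← hAK, ← mul_assoc, h.mul_left]
  set e := P - K * L * P with he
  have hPe : P * e = e := by rw [he, mul_sub, hP.eq, ← mul_assoc, ← mul_assoc, hPK]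
  have hBLe : B * L * e = 0 := by
    rw [he, mul_sub, ← mul_assoc, ← mul_assoc, hBLK, sub_self]
  have hrange : ((B : H →ₗ[ℂ] H).rangeRestrict ∘ₗ Q.range.subtype ∘ₗ f).ker.map P.range.subtype
      = e.range := by
    ext x
    constructor
    · rintro ⟨y, hy, rfl⟩
      have hBLy : B (L y) = 0 := (congrArg B (hf y)).symm.trans (congrArg Subtype.val hy)
      have hKLy : K (L y) = 0 := by
        rw [← hKB, mul_apply_eq_comp, hBLy, map_zero]
      exact ⟨y, by simp [he, (mem_range_iff hP).1 y.2, hKLy]⟩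
    · rintro ⟨y, rfl⟩
      refine ⟨⟨e y, e y, DFunLike.congr_fun hPe y⟩, Subtype.ext ?_, rfl⟩
      exact (congrArg B (hf _)).trans (DFunLike.congr_fun hBLe y)
  rw [hrange]
  refine dim_range_eq_of_mul_eq ?_ ?_
  · have heP : e * P = e := by rw [he, sub_mul, hP.eq, mul_assoc, hP.eq]
    have heA : e * A = 0 := by
      rw [he, sub_mul, h.mul_left, mul_assoc, h.mul_left, hKLA, sub_self]
    rw [mul_sub, heP, heA, sub_zero]
  · have hAe : A * e = A - K * L * P := by
      rw [he, mul_sub, h.left_mul, ← mul_assoc, ← mul_assoc, hAK]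
    rw [sub_mul, hPe, hAe, he, sub_sub_sub_cancel_right]

/-- The index formula: the core is invertible, so that `f` has the index of a map from the corner
`P - A` to the corner `Q - B`. -/
theorem rank_ker_add_dim (h : IsCore L P Q A B) (hP : IsIdempotentElem P)
    (hQ : IsIdempotentElem Q) (hf : ∀ x, (f x : H) = L x) :
    (Module.rank ℂ f.ker).toENat + dim (Q - B).range =
      dim (P - A).range + (Module.rank ℂ (Q.range ⧸ f.range)).toENat := by
  have hrank := congrArg Cardinal.toENat (rank_ker_add_rank_ker
    (g := (B : H →ₗ[ℂ] H).rangeRestrict ∘ₗ Q.range.subtype) (h.surjective_rangeRestrict_comp hf))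
  rw [map_add, map_add] at hrank
  rw [← h.map_ker_rangeRestrict hQ, ← h.dim_map_ker_comp hP hf, dim_map_subtype, dim_map_subtype]
  exact hrank

theorem rank_ker_le (h : IsCore L P Q A B) (hP : IsIdempotentElem P)
    (hf : ∀ x, (f x : H) = L x) : (Module.rank ℂ f.ker).toENat ≤ dim (P - A).range := by
  rw [← h.dim_map_ker_comp hP hf, ← dim_map_subtype]
  exact dim_mono (Submodule.map_mono (LinearMap.ker_le_ker_comp f
    ((B : H →ₗ[ℂ] H).rangeRestrict ∘ₗ Q.range.subtype)))

end IsCore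
end Index
end CommonCompl

namespace CommonCompl

open scoped InnerProductSpace
open Topology Filter

section Defect

variable {H : Type*} [NormedAddCommGroup H] [InnerProductSpace ℂ H] {L P Q A B : H →L[ℂ] H}
  {m n : ℕ∞}

theorem IsCore.isClosed_range_mul (h : IsCore L P Q A B) (hd : dim (P - A).range < ⊤) :
    IsClosed ((L * P).range : Set H) := by
  obtain ⟨K, hAK, -, hKLA, -⟩ :=
    exists_corner_inverse h.isIdempotentElem_left h.isIdempotentElem_right h.isUnit
  have hLK : IsIdempotentElem (L * K) := by
    calc L * K * (L * K) = L * (K * L * A) * K := by simp only [mul_assoc, hAK]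
      _ = L * K := by rw [hKLA, mul_assoc, hAK]
  have hsup : (L * P).range = (L * K).range ⊔ (L * (P - A)).range := by
    refine le_antisymm ?_ (sup_le ?_ ?_)
    · rintro _ ⟨x, rfl⟩
      have hx : (L * P) x = (L * K) (L (A x)) + (L * (P - A)) x := by
        have hL : L * P = L * (K * L * A) + L * (P - A) := by rw [hKLA, ← mul_add, add_sub_cancel]
        exact DFunLike.congr_fun hL x
      exact hx ▸ Submodule.add_mem_sup ⟨_, rfl⟩ ⟨_, rfl⟩
    · rintro _ ⟨x, rfl⟩
      have hPK : P * K = K := by rw [← hAK, ← mul_assoc, h.mul_left]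
      exact ⟨K x, congrArg L (DFunLike.congr_fun hPK x)⟩
    · rintro _ ⟨x, rfl⟩
      refine ⟨x - A x, ?_⟩
      have hPA : P * (1 - A) = P - A := by rw [mul_sub, mul_one, h.mul_left]
      exact congrArg L (DFunLike.congr_fun hPA x)
  have hfin : FiniteDimensional ℂ (L * (P - A)).range :=
    dim_lt_top_iff.1 ((dim_range_mul_mul_le L (P - A) 1).trans_lt hd)
  rw [hsup]
  exact Submodule.isClosed_sup_finiteDimensional _ _
    (ContinuousLinearMap.IsIdempotentElem.isClosed_range hLK)

theorem isClosed_range_restr (h : IsClosed ((Q * P).range : Set H)) :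
    IsClosed ((restr P Q).range : Set Q.range) := by
  have hrange : ((restr P Q).range : Set Q.range) = (↑) ⁻¹' ((Q * P).range : Set H) := by
    ext y
    constructor
    · rintro ⟨⟨_, x, rfl⟩, rfl⟩
      exact ⟨x, rfl⟩
    · rintro ⟨x, hx⟩
      exact ⟨⟨P x, x, rfl⟩, Subtype.ext hx⟩
  exact hrange ▸ h.preimage continuous_subtype_val

/-- Up to summands of dimension `m` of the range of `P` and of dimension `n` of the range of `Q`,
the restriction of `Q` to the range of `P` is an isomorphism onto the range of `Q`. In contrast to
the dimensions of the kernel and the cokernel of this restriction, this is an open condition. -/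
def HasDefect (P Q : H →L[ℂ] H) (m n : ℕ∞) : Prop :=
  ∃ A B, IsCore Q P Q A B ∧ dim (P - A).range = m ∧ dim (Q - B).range = n

theorem HasDefect.isClosed_range_restr (h : HasDefect P Q m n) (hm : m < ⊤) :
    IsClosed ((restr P Q).range : Set Q.range) := by
  obtain ⟨A, B, hAB, rfl, -⟩ := h
  exact CommonCompl.isClosed_range_restr (hAB.isClosed_range_mul hm)

variable [CompleteSpace H]

theorem rank_ker_restr (hQ : IsStarProjection Q) :
    (Module.rank ℂ (restr P Q).ker).toENat = dim (P.range ⊓ Q.rangeᗮ) := by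
  refine dim_map_subtype (restr P Q).ker |>.symm.trans (congrArg dim ?_)
  ext x
  constructor
  · rintro ⟨y, hy, rfl⟩
    exact ⟨y.2, (mem_orthogonal_iff hQ).2 (congrArg Subtype.val hy)⟩
  · rintro ⟨hxP, hxQ⟩
    exact ⟨⟨x, hxP⟩, Subtype.ext ((mem_orthogonal_iff hQ).1 hxQ), rfl⟩

theorem mem_orthogonal_range_restr (hQ : IsStarProjection Q) {y : Q.range} :
    y ∈ (restr P Q).rangeᗮ ↔ (y : H) ∈ P.rangeᗮ := by
  have hinner : ∀ x, ⟪Q x, (y : H)⟫_ℂ = ⟪x, (y : H)⟫_ℂ := fun x =>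
    (hQ.isSelfAdjoint.isSymmetric x y).trans
      (congrArg (⟪x, ·⟫_ℂ) ((mem_range_iff hQ.isIdempotentElem).1 y.2))
  rw [Submodule.mem_orthogonal, Submodule.mem_orthogonal]
  constructor
  · exact fun h x hx => (hinner x).symm.trans (h _ ⟨⟨x, hx⟩, rfl⟩)
  · rintro h _ ⟨x, rfl⟩
    exact (hinner x).trans (h x x.2)

theorem rank_coker_restr (hQ : IsStarProjection Q)
    (hcl : IsClosed ((restr P Q).range : Set Q.range)) :
    (Module.rank ℂ (Q.range ⧸ (restr P Q).range)).toENat = dim (P.rangeᗮ ⊓ Q.range) := by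
  have : CompleteSpace Q.range :=
    (ContinuousLinearMap.IsIdempotentElem.isClosed_range hQ.isIdempotentElem).completeSpace_coe
  have : CompleteSpace (restr P Q).range := hcl.completeSpace_coe
  rw [(Submodule.quotientEquivOfIsCompl _ _
    (Submodule.isCompl_orthogonal (K := (restr P Q).range))).rank_eq, ← dim_map_subtype]
  refine congrArg dim ?_
  ext x
  constructor
  · rintro ⟨y, hy, rfl⟩
    exact ⟨(mem_orthogonal_range_restr hQ).1 hy, y.2⟩
  · rintro ⟨hxP, hxQ⟩
    exact ⟨⟨x, hxQ⟩, (mem_orthogonal_range_restr hQ).2 hxP, rfl⟩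

theorem isFredholm_restr (hP : IsStarProjection P) (hQ : IsStarProjection Q)
    (hcl : IsClosed ((restr P Q).range : Set Q.range)) (hi : dim (P.range ⊓ Q.rangeᗮ) < ⊤)
    (hj : dim (P.rangeᗮ ⊓ Q.range) < ⊤) : (restr P Q).IsFredholm := by
  have : CompleteSpace P.range :=
    (ContinuousLinearMap.IsIdempotentElem.isClosed_range hP.isIdempotentElem).completeSpace_coe
  have : CompleteSpace Q.range :=
    (ContinuousLinearMap.IsIdempotentElem.isClosed_range hQ.isIdempotentElem).completeSpace_coe
  have : CompleteSpace (restr P Q).range := hcl.completeSpace_coe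
  have hker : FiniteDimensional ℂ (restr P Q).ker := by
    rw [← rank_ker_restr hQ, Cardinal.toENat_lt_top] at hi
    exact Module.rank_lt_aleph0_iff.1 hi
  have hcoker : FiniteDimensional ℂ (Q.range ⧸ (restr P Q).range) := by
    rw [← rank_coker_restr hQ hcl, Cardinal.toENat_lt_top] at hj
    exact Module.rank_lt_aleph0_iff.1 hj
  refine ⟨?_, hcl, hker, hcoker, Submodule.ClosedComplemented.of_finiteDimensional _⟩
  rw [isStrictMap_iff_isQuotientMap_rangeFactorization]
  exact (restr P Q).rangeRestrict.isQuotientMap (LinearMap.surjective_rangeRestrict _)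

theorem index_restr (hQ : IsStarProjection Q)
    (hcl : IsClosed ((restr P Q).range : Set Q.range)) {i j : ℕ}
    (hi : dim (P.range ⊓ Q.rangeᗮ) = i) (hj : dim (P.rangeᗮ ⊓ Q.range) = j) :
    index (restr P Q) = i - j := by
  rw [← rank_ker_restr hQ] at hi
  rw [← rank_coker_restr hQ hcl] at hj
  rw [index, Module.finrank, Module.finrank, ← Cardinal.toNat_toENat,
    ← Cardinal.toNat_toENat, hi, hj]
  rfl

theorem Reduces.hasDefect {E : H →L[ℂ] H} {δ : ℝ} (h : Reduces δ P Q E) (hP : IsStarProjection P)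
    (hQ : IsStarProjection Q) (hδ₀ : 0 ≤ δ) (hδ : 2 * δ < 1) :
    HasDefect P Q (dim (P * E).range) (dim (Q * E).range) := by
  refine ⟨_, _, h.isCore hP hQ hQ.isIdempotentElem.eq (by nlinarith [hQ.norm_le]), ?_, ?_⟩
  · rw [sub_mul_one_sub]
  · rw [sub_mul_one_sub]

namespace HasDefect

theorem eventually (h : HasDefect P Q m n) (hP : IsIdempotentElem P) (hQ : IsIdempotentElem Q) :
    ∀ᶠ y in 𝓝 (P, Q), IsIdempotentElem y.1 → IsIdempotentElem y.2 → HasDefect y.1 y.2 m n := by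
  obtain ⟨A, B, hAB, rfl, rfl⟩ := h
  have hcont : Continuous fun y : (H →L[ℂ] H) × (H →L[ℂ] H) => (y.2, y.1, y.2) := by fun_prop
  filter_upwards [hcont.continuousAt.eventually (hAB.eventually hP hQ)] with y hy hy₁ hy₂
  obtain ⟨A', B', v, w, hcore, hA', hB'⟩ := hy hy₁ hy₂
  exact ⟨A', B', hcore, by rw [← hA', dim_range_conj], by rw [← hB', dim_range_conj]⟩

theorem dim_inf_orthogonal_le (h : HasDefect P Q m n) (hP : IsIdempotentElem P)
    (hQ : IsStarProjection Q) : dim (P.range ⊓ Q.rangeᗮ) ≤ m := by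
  obtain ⟨A, B, hAB, rfl, -⟩ := h
  exact rank_ker_restr hQ ▸ hAB.rank_ker_le (f := (restr P Q : P.range →ₗ[ℂ] Q.range)) hP
    fun _ => rfl

theorem dim_add_eq (h : HasDefect P Q m n) (hP : IsStarProjection P) (hQ : IsStarProjection Q)
    (hm : m < ⊤) : dim (P.range ⊓ Q.rangeᗮ) + n = m + dim (P.rangeᗮ ⊓ Q.range) := by
  have hcl := h.isClosed_range_restr hm
  obtain ⟨A, B, hAB, rfl, rfl⟩ := h
  rw [← rank_ker_restr hQ, ← rank_coker_restr hQ hcl]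
  exact hAB.rank_ker_add_dim (f := (restr P Q : P.range →ₗ[ℂ] Q.range)) hP.isIdempotentElem
    hQ.isIdempotentElem fun _ => rfl

end HasDefect

end Defect
end CommonCompl

/-! ### `Γ` is closed -/

namespace CommonCompl

open Topology Filter TopologicalSpace

section Compact

variable {H : Type*} [NormedAddCommGroup H] [InnerProductSpace ℂ H]
  {P Q A B F G : H →L[ℂ] H} {n : ℕ∞}

theorem HasCommonComplement.symm {S T : Submodule ℂ H} (h : HasCommonComplement S T) :
    HasCommonComplement T S :=
  let ⟨Z, hZ, hS, hT⟩ := h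
  ⟨Z, hZ, hT, hS⟩

theorem HasCommonComplement.dim_eq {S T : Submodule ℂ H} (h : HasCommonComplement S T) :
    dim S = dim T := by
  obtain ⟨Z, -, hS, hT⟩ := h
  exact congrArg Cardinal.toENat
    ((Submodule.quotientEquivOfIsCompl Z S hS.symm).symm.trans
      (Submodule.quotientEquivOfIsCompl Z T hT.symm)).rank_eq

theorem ObliquePair.bijective_restrict (h : ObliquePair P Q F G) :
    Function.Bijective ((G : H →ₗ[ℂ] H).restrict (p := P.range) (q := Q.range)
      fun x _ => ⟨G x, DFunLike.congr_fun h.mul_right x⟩) := by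
  constructor
  · rw [injective_iff_map_eq_zero]
    rintro ⟨_, x, rfl⟩ hx
    have hGP : G (P x) = 0 := congrArg Subtype.val hx
    refine Subtype.ext ?_
    calc P x = F (P x) := (DFunLike.congr_fun h.left_mul x).symm
      _ = F (G (P x)) := (DFunLike.congr_fun h.left_mul_right (P x)).symm
      _ = 0 := by rw [hGP, map_zero]
  · rintro ⟨_, y, rfl⟩
    refine ⟨⟨F (Q y), F (Q y), DFunLike.congr_fun h.mul_left (Q y)⟩, Subtype.ext ?_⟩
    exact (DFunLike.congr_fun h.right_mul_left (Q y)).trans (DFunLike.congr_fun h.right_mul y)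

theorem ObliquePair.dim_eq_of_isCore (h : ObliquePair P Q F G) (hcore : IsCore G P Q A B)
    (hP : IsIdempotentElem P) (hQ : IsIdempotentElem Q) :
    dim (Q - B).range = dim (P - A).range := by
  have hf := h.bijective_restrict
  have hindex := hcore.rank_ker_add_dim hP hQ (f := (G : H →ₗ[ℂ] H).restrict
    fun x _ => ⟨G x, DFunLike.congr_fun h.mul_right x⟩) fun _ => rfl
  rw [LinearMap.ker_eq_bot.2 hf.1, LinearMap.range_eq_top.2 hf.2] at hindex
  simpa only [rank_bot, rank_subsingleton', map_zero, zero_add, add_zero] using hindex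

variable [CompleteSpace H]

theorem dim_eq_of_hasCommonComplement (hP : IsStarProjection P) (hQ : IsStarProjection Q)
    (hc : IsCompactOperator ((1 - Q) * P : H →L[ℂ] H))
    (h : HasCommonComplement P.range Q.range) :
    dim (P.range ⊓ Q.rangeᗮ) = dim (P.rangeᗮ ⊓ Q.range) := by
  obtain ⟨F, G, hFG⟩ :=
    (hasCommonComplement_iff hP.isIdempotentElem hQ.isIdempotentElem).1 h
  set δ : ℝ := (3 + ‖G‖)⁻¹
  have hδ₀ : 0 < δ := by positivity
  have hδG : δ * (3 + ‖G‖) = 1 := inv_mul_cancel₀ (by positivity)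
  obtain ⟨E, hE⟩ := exists_reduces hP hQ hδ₀.le
  have hfin := dim_lt_top_iff.2 (hE.finiteDimensional hP hδ₀ hc)
  have hdim := hFG.dim_eq_of_isCore (hE.isCore hP hQ hFG.right_mul (by linarith))
    hP.isIdempotentElem hQ.isIdempotentElem
  rw [sub_mul_one_sub, sub_mul_one_sub] at hdim
  have hadd := (hE.hasDefect hP hQ hδ₀.le (by nlinarith [norm_nonneg G])).dim_add_eq hP hQ hfin
  rw [hdim, add_comm] at hadd
  exact WithTop.add_left_cancel hfin.ne hadd

theorem HasDefect.eq_of_dim_eq {m n : ℕ∞} (h : HasDefect P Q m n) (hP : IsStarProjection P)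
    (hQ : IsStarProjection Q) (hm : m < ⊤)
    (hd : dim (P.range ⊓ Q.rangeᗮ) = dim (P.rangeᗮ ⊓ Q.range)) : m = n := by
  have hadd := h.dim_add_eq hP hQ hm
  rw [← hd, add_comm m] at hadd
  have hlt := (h.dim_inf_orthogonal_le hP.isIdempotentElem hQ).trans_lt hm
  exact (WithTop.add_left_cancel hlt.ne hadd).symm

theorem isCompactOperator_symm (hP : IsStarProjection P) (hQ : IsStarProjection Q)
    (hc : IsCompactOperator ((1 - Q) * P : H →L[ℂ] H)) (hj : dim (P.rangeᗮ ⊓ Q.range) < ⊤) :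
    IsCompactOperator ((1 - P) * Q : H →L[ℂ] H) := by
  refine isCompactOperator_of_reduces hP fun ε hε => ?_
  set δ := min ε (1 / 3)
  have hδ₀ : 0 < δ := by positivity
  have hδ : 2 * δ < 1 := by linarith [min_le_right ε (1 / 3 : ℝ)]
  obtain ⟨E, hE⟩ := exists_reduces hP hQ hδ₀.le
  have hfin := dim_lt_top_iff.2 (hE.finiteDimensional hP hδ₀ hc)
  refine ⟨δ, min_le_left _ _, E, hE.symm, dim_lt_top_iff.1 ?_⟩
  have hadd := (hE.hasDefect hP hQ hδ₀.le hδ).dim_add_eq hP hQ hfin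
  exact (WithTop.add_lt_top.1 (hadd.trans_lt (WithTop.add_lt_top.2 ⟨hfin, hj⟩))).2

variable [SeparableSpace H]

theorem exists_hasDefect (hP : IsStarProjection P) (hQ : IsStarProjection Q)
    (hc : IsCompactOperator ((1 - Q) * P : H →L[ℂ] H)) :
    ∃ m n, m < ⊤ ∧ HasDefect P Q m n ∧ (m = n → HasCommonComplement P.range Q.range) := by
  obtain ⟨E, hE⟩ := exists_reduces hP hQ (δ := 1 / 3) (by norm_num)
  exact ⟨_, _, dim_lt_top_iff.2 (hE.finiteDimensional hP (by norm_num) hc),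
    hE.hasDefect hP hQ (by norm_num) (by norm_num),
    hE.hasCommonComplement hP hQ (by norm_num) (by norm_num)⟩

theorem dim_inf_orthogonal_lt_top (hP : IsStarProjection P) (hQ : IsStarProjection Q)
    (hc : IsCompactOperator ((1 - Q) * P : H →L[ℂ] H)) : dim (P.range ⊓ Q.rangeᗮ) < ⊤ := by
  obtain ⟨m, n, hm, h, -⟩ := exists_hasDefect hP hQ hc
  exact (h.dim_inf_orthogonal_le hP.isIdempotentElem hQ).trans_lt hm

theorem hasCommonComplement_of_dim_eq (hP : IsStarProjection P) (hQ : IsStarProjection Q)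
    (hc : IsCompactOperator ((1 - Q) * P : H →L[ℂ] H))
    (hd : dim (P.range ⊓ Q.rangeᗮ) = dim (P.rangeᗮ ⊓ Q.range)) :
    HasCommonComplement P.range Q.range := by
  obtain ⟨m, n, hm, h, hmn⟩ := exists_hasDefect hP hQ hc
  exact hmn (h.eq_of_dim_eq hP hQ hm hd)

theorem eventually_mem_gam_iff (hP : IsStarProjection P) (hQ : IsStarProjection Q)
    (hc : IsCompactOperator ((1 - Q) * P : H →L[ℂ] H))
    (h : ¬ HasCommonComplement P.range Q.range) :
    ∀ᶠ x : (H →L[ℂ] H) × (H →L[ℂ] H) in 𝓝 (P, Q), x ∈ projPairs H →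
      (x ∈ Gam H ↔ IsCompactOperator ((1 - x.2) * x.1 : H →L[ℂ] H)) := by
  obtain ⟨m, n, hm, hd, hmn⟩ := exists_hasDefect hP hQ hc
  filter_upwards [hd.eventually hP.isIdempotentElem hQ.isIdempotentElem]
  rintro ⟨P', Q'⟩ hx ⟨hP' : IsStarProjection P', hQ' : IsStarProjection Q'⟩
  have hd' : HasDefect P' Q' m n := hx hP'.isIdempotentElem hQ'.isIdempotentElem
  constructor
  · rintro ⟨-, hn⟩
    refine (isCompactOperator_or_of_not_hasCommonComplement hP' hQ' hn).elim id fun hc' => ?_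
    refine isCompactOperator_symm hQ' hP' hc' ?_
    rw [inf_comm]
    exact (hd'.dim_inf_orthogonal_le hP'.isIdempotentElem hQ').trans_lt hm
  · exact fun hc' => ⟨⟨hP', hQ'⟩, fun hn =>
      h (hmn (hd'.eq_of_dim_eq hP' hQ' hm (dim_eq_of_hasCommonComplement hP' hQ' hc' hn)))⟩

end Compact

section Closed

variable {H : Type*} [NormedAddCommGroup H] [InnerProductSpace ℂ H] [CompleteSpace H]
  {P Q : H →L[ℂ] H}

theorem isClosed_projPairs : IsClosed (projPairs H) := by
  have hcl : IsClosed {P : H →L[ℂ] H | IsStarProjection P} := by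
    simp only [isStarProjection_iff, IsIdempotentElem, IsSelfAdjoint]
    exact (isClosed_eq (by fun_prop) continuous_id).inter
      (isClosed_eq continuous_star continuous_id)
  exact (hcl.preimage continuous_fst).inter (hcl.preimage continuous_snd)

theorem eventually_hasCommonComplement (hP : IsIdempotentElem P) (hQ : IsIdempotentElem Q)
    (h : HasCommonComplement P.range Q.range) :
    ∀ᶠ x : (H →L[ℂ] H) × (H →L[ℂ] H) in 𝓝 (P, Q), IsIdempotentElem x.1 → IsIdempotentElem x.2 →
      HasCommonComplement x.1.range x.2.range := by
  obtain ⟨F, G, hFG⟩ := (hasCommonComplement_iff hP hQ).1 h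
  filter_upwards [hFG.eventually hP hQ] with x hx hx₁ hx₂
  exact (hasCommonComplement_iff hx₁ hx₂).2 (hx hx₁ hx₂)

theorem isClosed_gam : IsClosed (Gam H) := by
  rw [← isOpen_compl_iff, isOpen_iff_eventually]
  rintro ⟨P, Q⟩ hx
  by_cases hp : (P, Q) ∈ projPairs H
  · have hc : HasCommonComplement P.range Q.range := by
      by_contra hn
      exact hx ⟨hp, hn⟩
    filter_upwards [eventually_hasCommonComplement hp.1.isIdempotentElem hp.2.isIdempotentElem hc]
      with y hy hyΓ
    exact hyΓ.2 (hy hyΓ.1.1.isIdempotentElem hyΓ.1.2.isIdempotentElem)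
  · filter_upwards [isClosed_projPairs.isOpen_compl.eventually_mem hp] with y hy hyΓ
    exact hy hyΓ.1

end Closed
end CommonCompl

/-! ### The pieces of `Γ` -/

namespace CommonCompl

open Topology Filter TopologicalSpace

section FiniteDimension

variable {H : Type*} [NormedAddCommGroup H] [InnerProductSpace ℂ H]

theorem HasCommonComplement.dim_orthogonal_eq {S T : Submodule ℂ H} [S.HasOrthogonalProjection]
    [T.HasOrthogonalProjection] (h : HasCommonComplement S T) : dim Sᗮ = dim Tᗮ := by
  obtain ⟨Z, -, hS, hT⟩ := h
  have e {K : Submodule ℂ H} [K.HasOrthogonalProjection] (hK : IsCompl K Z) : Kᗮ ≃ₗ[ℂ] Z :=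
    (Submodule.quotientEquivOfIsCompl K _ K.isCompl_orthogonal).symm.trans
      (Submodule.quotientEquivOfIsCompl K Z hK)
  exact congrArg Cardinal.toENat ((e hS).trans (e hT).symm).rank_eq

variable [CompleteSpace H] {P Q : H →L[ℂ] H}

theorem dim_inf_orthogonal_eq_of_dim_range_eq (hQ : IsStarProjection Q)
    (hd : dim P.range = dim Q.range) (hf : dim P.range < ⊤) :
    dim (P.range ⊓ Q.rangeᗮ) = dim (P.rangeᗮ ⊓ Q.range) := by
  have := dim_lt_top_iff.1 hf
  have : FiniteDimensional ℂ Q.range := dim_lt_top_iff.1 (hd ▸ hf)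
  rw [← rank_ker_restr hQ,
    ← rank_coker_restr hQ (restr P Q).range.closed_of_finiteDimensional]
  have hker := (restr P Q : P.range →ₗ[ℂ] Q.range).finrank_range_add_finrank_ker
  have hcoker := (restr P Q).range.finrank_quotient_add_finrank
  rw [dim_eq_finrank, dim_eq_finrank, Nat.cast_inj] at hd
  simp only [← Module.finrank_eq_rank, Cardinal.toENat_nat, Nat.cast_inj]
  lia

variable [SeparableSpace H]

theorem hasCommonComplement_of_dim_range_eq (hP : IsStarProjection P) (hQ : IsStarProjection Q)
    (hd : dim P.range = dim Q.range) (hf : dim P.range < ⊤) :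
    HasCommonComplement P.range Q.range :=
  hasCommonComplement_of_dim_eq hP hQ
    ((isCompactOperator_of_finiteDimensional_range (dim_lt_top_iff.1 hf)).clm_comp
      (1 - Q : H →L[ℂ] H))
    (dim_inf_orthogonal_eq_of_dim_range_eq hQ hd hf)

theorem hasCommonComplement_of_dim_orthogonal_eq (hP : IsStarProjection P)
    (hQ : IsStarProjection Q) (hd : dim P.rangeᗮ = dim Q.rangeᗮ) (hf : dim P.rangeᗮ < ⊤) :
    HasCommonComplement P.range Q.range := by
  rw [← range_one_sub hP] at hd hf
  rw [← range_one_sub hQ] at hd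
  obtain ⟨F, G, h⟩ := (hasCommonComplement_iff hP.one_sub.isIdempotentElem
    hQ.one_sub.isIdempotentElem).1 (hasCommonComplement_of_dim_range_eq hP.one_sub hQ.one_sub hd hf)
  have h' := h.one_sub_star hP.one_sub.isSelfAdjoint hQ.one_sub.isSelfAdjoint
  rw [sub_sub_cancel, sub_sub_cancel] at h'
  exact (hasCommonComplement_iff hP.isIdempotentElem hQ.isIdempotentElem).2 ⟨_, _, h'⟩

end FiniteDimension

section Pieces

variable {H : Type*} [NormedAddCommGroup H] [InnerProductSpace ℂ H] [CompleteSpace H]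
  {P Q : H →L[ℂ] H} {x : (H →L[ℂ] H) × (H →L[ℂ] H)}

theorem swap_mem_projPairs : x.swap ∈ projPairs H ↔ x ∈ projPairs H :=
  and_comm

theorem swap_mem_gam : x.swap ∈ Gam H ↔ x ∈ Gam H :=
  and_congr swap_mem_projPairs (not_congr ⟨.symm, .symm⟩)

theorem swap_mem_gamInfInf : x.swap ∈ GamInfInf H ↔ x ∈ GamInfInf H :=
  and_congr swap_mem_gam and_comm

theorem swap_mem_gamInfL : x.swap ∈ GamInfL H ↔ x ∈ GamInfR H := by
  refine and_congr swap_mem_gamInfInf (and_comm.trans ?_)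
  rw [Prod.fst_swap, Prod.snd_swap, inf_comm, inf_comm x.2.range]

theorem piece_subset_gam (a : PieceIndex) : piece H a ⊆ Gam H := by
  intro x hx
  cases a with
  | full i j k l h =>
    obtain ⟨⟨hP, rfl, rfl⟩, hQ, rfl, rfl⟩ := hx
    have := (ContinuousLinearMap.IsIdempotentElem.isClosed_range
      hP.isIdempotentElem).completeSpace_coe
    have := (ContinuousLinearMap.IsIdempotentElem.isClosed_range
      hQ.isIdempotentElem).completeSpace_coe
    exact ⟨⟨hP, hQ⟩, fun hc => h (Prod.ext hc.dim_eq hc.dim_orthogonal_eq)⟩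
  | fredholm n h => exact hx.1.1.1
  | left => exact hx.1.1
  | right => exact hx.1.1

theorem isCompactOperator_of_mem_gam [SeparableSpace H] (hx : x ∈ Gam H)
    (hi : dim (x.1.range ⊓ x.2.rangeᗮ) < ⊤) :
    IsCompactOperator ((1 - x.2) * x.1 : H →L[ℂ] H) := by
  obtain ⟨⟨hP, hQ⟩, hn⟩ := hx
  refine (isCompactOperator_or_of_not_hasCommonComplement hP hQ hn).elim id fun hc => ?_
  exact isCompactOperator_symm hQ hP hc (by rwa [inf_comm])

theorem exists_hasDefect_of_mem_gam [SeparableSpace H] (hx : x ∈ Gam H)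
    (hi : dim (x.1.range ⊓ x.2.rangeᗮ) < ⊤) :
    ∃ m n, m < ⊤ ∧ HasDefect x.1 x.2 m n :=
  let ⟨m, n, hm, h, _⟩ := exists_hasDefect hx.1.1 hx.1.2 (isCompactOperator_of_mem_gam hx hi)
  ⟨m, n, hm, h⟩

theorem mem_gam1n [SeparableSpace H] (hx : x ∈ GamInfInf H) {i j : ℕ}
    (hi : dim (x.1.range ⊓ x.2.rangeᗮ) = i) (hj : dim (x.1.rangeᗮ ⊓ x.2.range) = j) :
    x ∈ Gam1n H (i - j) := by
  have hi' : dim (x.1.range ⊓ x.2.rangeᗮ) < ⊤ := hi ▸ ENat.natCast_lt_top i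
  have hj' : dim (x.1.rangeᗮ ⊓ x.2.range) < ⊤ := hj ▸ ENat.natCast_lt_top j
  obtain ⟨hP, hQ⟩ := hx.1.1
  obtain ⟨m, n, hm, h⟩ := exists_hasDefect_of_mem_gam hx.1 hi'
  have hcl := h.isClosed_range_restr hm
  exact ⟨⟨hx, hi', hj'⟩, isFredholm_restr hP hQ hcl hi' hj', index_restr hQ hcl hi hj⟩

theorem mem_gamInfInf_of_dim_eq [SeparableSpace H] (hx : x ∈ Gam H)
    (h : dim x.1.range = dim x.2.range) (h' : dim x.1.rangeᗮ = dim x.2.rangeᗮ) :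
    x ∈ GamInfInf H := by
  obtain ⟨⟨hP, hQ⟩, hn⟩ := id hx
  have hrange := not_lt_top_iff.1 (mt (hasCommonComplement_of_dim_range_eq hP hQ h) hn)
  have horth := not_lt_top_iff.1 (mt (hasCommonComplement_of_dim_orthogonal_eq hP hQ h') hn)
  exact ⟨hx, ⟨hP, hrange, horth⟩, hQ, h ▸ hrange, h' ▸ horth⟩

theorem dim_inf_lt_top_of_mem_gam [SeparableSpace H] (hx : x ∈ Gam H) :
    dim (x.1.range ⊓ x.2.rangeᗮ) < ⊤ ∨ dim (x.1.rangeᗮ ⊓ x.2.range) < ⊤ := by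
  obtain ⟨⟨hP, hQ⟩, hn⟩ := hx
  refine (isCompactOperator_or_of_not_hasCommonComplement hP hQ hn).imp
    (dim_inf_orthogonal_lt_top hP hQ) fun hc => ?_
  rw [inf_comm]
  exact dim_inf_orthogonal_lt_top hQ hP hc

theorem exists_mem_piece_of_mem_gamInfInf [SeparableSpace H] (hx : x ∈ GamInfInf H) :
    ∃ a, x ∈ piece H a := by
  obtain ⟨⟨hP, hQ⟩, hn⟩ := hx.1
  rcases eq_or_ne (dim (x.1.range ⊓ x.2.rangeᗮ)) ⊤ with hi | hi
  · exact ⟨.right, ⟨hx, hi, (dim_inf_lt_top_of_mem_gam hx.1).resolve_left hi.not_lt⟩⟩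
  rcases eq_or_ne (dim (x.1.rangeᗮ ⊓ x.2.range)) ⊤ with hj | hj
  · exact ⟨.left, ⟨hx, hi.lt_top, hj⟩⟩
  obtain ⟨i, hi'⟩ := ENat.ne_top_iff_exists.1 hi
  obtain ⟨j, hj'⟩ := ENat.ne_top_iff_exists.1 hj
  have hij : (i - j : ℤ) ≠ 0 := fun h0 => hn <| hasCommonComplement_of_dim_eq hP hQ
    (isCompactOperator_of_mem_gam hx.1 hi.lt_top) (by rw [← hi', ← hj']; congr; lia)
  exact ⟨.fredholm (i - j) hij, mem_gam1n hx hi'.symm hj'.symm⟩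

theorem gam_eq_iUnion [SeparableSpace H] : Gam H = ⋃ a, piece H a := by
  refine subset_antisymm (fun x hx => Set.mem_iUnion.2 ?_) (Set.iUnion_subset piece_subset_gam)
  by_cases hd : (dim x.1.range, dim x.1.rangeᗮ) = (dim x.2.range, dim x.2.rangeᗮ)
  · obtain ⟨h, h'⟩ := Prod.mk.inj hd
    exact exists_mem_piece_of_mem_gamInfInf (mem_gamInfInf_of_dim_eq hx h h')
  · exact ⟨.full _ _ _ _ hd, ⟨hx.1.1, rfl, rfl⟩, hx.1.2, rfl, rfl⟩

theorem full_or_gamInfInf {a : PieceIndex} (hx : x ∈ piece H a) :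
    (∃ i j k l h, a = .full i j k l h) ∨ x ∈ GamInfInf H := by
  cases a with
  | full i j k l h => exact .inl ⟨i, j, k, l, h, rfl⟩
  | fredholm n h => exact .inr hx.1.1
  | left => exact .inr hx.1
  | right => exact .inr hx.1

theorem notMem_full_of_mem_gamInfInf (hx : x ∈ GamInfInf H) {i j k l : ℕ∞}
    (h : (i, j) ≠ (k, l)) : x ∉ piece H (.full i j k l h) := by
  rintro ⟨⟨-, rfl, rfl⟩, -, rfl, rfl⟩
  obtain ⟨-, ⟨-, hP, hP'⟩, -, hQ, hQ'⟩ := hx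
  exact h (by rw [hP, hP', hQ, hQ'])

theorem eq_of_mem_piece_of_mem_gamInfInf (hx : x ∈ GamInfInf H) {a b : PieceIndex}
    (ha : x ∈ piece H a) (hb : x ∈ piece H b) : a = b := by
  match a, b, ha, hb with
  | .full _ _ _ _ h, _, ha, _ => exact absurd ha (notMem_full_of_mem_gamInfInf hx h)
  | _, .full _ _ _ _ h, _, hb => exact absurd hb (notMem_full_of_mem_gamInfInf hx h)
  | .fredholm _ _, .fredholm _ _, ⟨_, _, hm⟩, ⟨_, _, hn⟩ => subst hm hn; rfl
  | .fredholm _ _, .left, ha, hb => exact absurd hb.2.2 ha.1.2.2.ne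
  | .fredholm _ _, .right, ha, hb => exact absurd hb.2.1 ha.1.2.1.ne
  | .left, .fredholm _ _, ha, hb => exact absurd ha.2.2 hb.1.2.2.ne
  | .left, .left, _, _ => rfl
  | .left, .right, ha, hb => exact absurd hb.2.1 ha.2.1.ne
  | .right, .fredholm _ _, ha, hb => exact absurd ha.2.1 hb.1.2.1.ne
  | .right, .left, ha, hb => exact absurd ha.2.1 hb.2.1.ne
  | .right, .right, _, _ => rfl

theorem pairwise_disjoint_piece : Pairwise fun a b => Disjoint (piece H a) (piece H b) := by
  refine fun a b hab => Set.disjoint_left.2 fun x ha hb => hab ?_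
  rcases full_or_gamInfInf ha with ⟨i, j, k, l, h, rfl⟩ | hx
  · rcases full_or_gamInfInf hb with ⟨i', j', k', l', h', rfl⟩ | hx
    · obtain ⟨⟨-, rfl, rfl⟩, -, rfl, rfl⟩ := ha
      obtain ⟨⟨-, rfl, rfl⟩, -, rfl, rfl⟩ := hb
      rfl
    · exact eq_of_mem_piece_of_mem_gamInfInf hx ha hb
  · exact eq_of_mem_piece_of_mem_gamInfInf hx ha hb

theorem eventually_mem_projOfRank {i j : ℕ∞} (hP : P ∈ projOfRank H i j) :
    ∀ᶠ P' in 𝓝 P, IsStarProjection P' → P' ∈ projOfRank H i j := by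
  obtain ⟨hP, rfl, rfl⟩ := hP
  filter_upwards [eventually_exists_conjNear_eq hP.isIdempotentElem] with P' h hP'
  obtain ⟨v, rfl, -⟩ := h hP'.isIdempotentElem
  refine ⟨hP', dim_range_conj v P, ?_⟩
  have hconj : 1 - ↑v * P * ↑v⁻¹ = ↑v * (1 - P) * ↑v⁻¹ := by
    rw [mul_sub, sub_mul, mul_one, Units.mul_inv]
  rw [← range_one_sub hP, ← range_one_sub hP', hconj, dim_range_conj]

theorem eventually_mem_full {i j k l : ℕ∞} (hx : x ∈ projOfRank H i j ×ˢ projOfRank H k l) :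
    ∀ᶠ y in 𝓝 x, y ∈ projPairs H → y ∈ projOfRank H i j ×ˢ projOfRank H k l := by
  filter_upwards [continuousAt_fst.eventually (eventually_mem_projOfRank hx.1),
    continuousAt_snd.eventually (eventually_mem_projOfRank hx.2)] with y hP hQ hy
  exact ⟨hP hy.1, hQ hy.2⟩

theorem eventually_mem_gamInfInf (hx : x ∈ GamInfInf H) :
    ∀ᶠ y in 𝓝 x, y ∈ Gam H → y ∈ GamInfInf H := by
  filter_upwards [eventually_mem_full hx.2] with y hy hyΓ
  exact ⟨hyΓ, hy hyΓ.1⟩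

theorem eventually_hasDefect {m n : ℕ∞} (h : HasDefect x.1 x.2 m n) (hx : x ∈ projPairs H) :
    ∀ᶠ y in 𝓝 x, y ∈ projPairs H → HasDefect y.1 y.2 m n := by
  filter_upwards [h.eventually hx.1.isIdempotentElem hx.2.isIdempotentElem] with y h hy
  exact h hy.1.isIdempotentElem hy.2.isIdempotentElem

theorem HasDefect.eq_top_iff {m n : ℕ∞} (h : HasDefect P Q m n) (hP : IsStarProjection P)
    (hQ : IsStarProjection Q) (hm : m < ⊤) : n = ⊤ ↔ dim (P.rangeᗮ ⊓ Q.range) = ⊤ := by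
  have hadd := h.dim_add_eq hP hQ hm
  have hlt := (h.dim_inf_orthogonal_le hP.isIdempotentElem hQ).trans_lt hm
  calc n = ⊤ ↔ dim (P.range ⊓ Q.rangeᗮ) + n = ⊤ := by rw [ENat.add_eq_top, or_iff_right hlt.ne]
    _ ↔ dim (P.rangeᗮ ⊓ Q.range) = ⊤ := by rw [hadd, ENat.add_eq_top, or_iff_right hm.ne]

theorem eventually_mem_gamInfL [SeparableSpace H] (hx : x ∈ GamInfL H) :
    ∀ᶠ y in 𝓝 x, y ∈ Gam H → y ∈ GamInfL H := by
  obtain ⟨hinf, hi, hj⟩ := hx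
  obtain ⟨m, n, hm, h⟩ := exists_hasDefect_of_mem_gam hinf.1 hi
  have hn := (h.eq_top_iff hinf.1.1.1 hinf.1.1.2 hm).2 hj
  filter_upwards [eventually_mem_gamInfInf hinf, eventually_hasDefect h hinf.1.1]
    with y hy hyd hyΓ
  have hd := hyd hyΓ.1
  exact ⟨hy hyΓ, (hd.dim_inf_orthogonal_le hyΓ.1.1.isIdempotentElem hyΓ.1.2).trans_lt hm,
    (hd.eq_top_iff hyΓ.1.1 hyΓ.1.2 hm).1 hn⟩

theorem eventually_mem_gamInfR [SeparableSpace H] (hx : x ∈ GamInfR H) :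
    ∀ᶠ y in 𝓝 x, y ∈ Gam H → y ∈ GamInfR H := by
  filter_upwards [continuous_swap.continuousAt.eventually
    (eventually_mem_gamInfL (swap_mem_gamInfL.2 hx))] with y hy hyΓ
  exact swap_mem_gamInfL.1 (hy (swap_mem_gam.2 hyΓ))

theorem HasDefect.mem_gam1n_iff [SeparableSpace H] {m n : ℕ}
    (h : HasDefect x.1 x.2 m n) (hx : x ∈ GamInfInf H) {k : ℤ} :
    x ∈ Gam1n H k ↔ k = m - n := by
  obtain ⟨hP, hQ⟩ := hx.1.1
  have hm : (m : ℕ∞) < ⊤ := ENat.natCast_lt_top m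
  have hi := (h.dim_inf_orthogonal_le hP.isIdempotentElem hQ).trans_lt hm
  have hj := mt (h.eq_top_iff hP hQ hm).2 (ENat.natCast_ne_top n)
  obtain ⟨i, hi'⟩ := ENat.ne_top_iff_exists.1 hi.ne
  obtain ⟨j, hj'⟩ := ENat.ne_top_iff_exists.1 hj
  have hadd := h.dim_add_eq hP hQ hm
  rw [← hi', ← hj'] at hadd
  norm_cast at hadd
  have hmem := mem_gam1n hx hi'.symm hj'.symm
  have hij : (i - j : ℤ) = m - n := by lia
  exact ⟨fun hk => hk.2.2.symm.trans (hmem.2.2.trans hij), fun hk => hk ▸ hij ▸ hmem⟩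

theorem eventually_mem_gam1n [SeparableSpace H] {k : ℤ} (hx : x ∈ Gam1n H k) :
    ∀ᶠ y in 𝓝 x, y ∈ Gam H → y ∈ Gam1n H k := by
  obtain ⟨⟨hinf, hi, hj⟩, -⟩ := id hx
  obtain ⟨m, n, hm, h⟩ := exists_hasDefect_of_mem_gam hinf.1 hi
  have hn := mt (h.eq_top_iff hinf.1.1.1 hinf.1.1.2 hm).1 hj.ne
  lift m to ℕ using hm.ne
  lift n to ℕ using hn
  have hk := (h.mem_gam1n_iff hinf).1 hx
  filter_upwards [eventually_mem_gamInfInf hinf, eventually_hasDefect h hinf.1.1]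
    with y hy hyd hyΓ
  exact ((hyd hyΓ.1).mem_gam1n_iff (hy hyΓ)).2 hk

theorem eventually_mem_piece [SeparableSpace H] {a : PieceIndex} (hx : x ∈ piece H a) :
    ∀ᶠ y in 𝓝 x, y ∈ Gam H → y ∈ piece H a := by
  cases a with
  | full i j k l h =>
    filter_upwards [eventually_mem_full hx] with y hy hyΓ using hy hyΓ.1
  | fredholm n h => exact eventually_mem_gam1n hx
  | left => exact eventually_mem_gamInfL hx
  | right => exact eventually_mem_gamInfR hx

theorem exists_isOpen_piece_eq [SeparableSpace H] (a : PieceIndex) :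
    ∃ U : Set ((H →L[ℂ] H) × (H →L[ℂ] H)), IsOpen U ∧ piece H a = Gam H ∩ U := by
  refine ⟨interior {y | y ∈ Gam H → y ∈ piece H a}, isOpen_interior, Set.ext fun x => ?_⟩
  exact ⟨fun hx => ⟨piece_subset_gam a hx,
    mem_interior_iff_mem_nhds.2 (eventually_mem_piece hx)⟩, fun hx => interior_subset hx.2 hx.1⟩

end Pieces
end CommonCompl

/-! ### `Γ` is a submanifold -/

namespace CommonCompl

open TopologicalSpace ProjChart BanachSub

/-- The ideal of compact operators, as a subspace of the real Banach space `B(H)`. -/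
def compacts (H : Type*) [NormedAddCommGroup H] [InnerProductSpace ℂ H] :
    Submodule ℝ (H →L[ℂ] H) :=
  (compactOperator (RingHom.id ℂ) H H).restrictScalars ℝ

variable {H : Type*} [NormedAddCommGroup H] [InnerProductSpace ℂ H] [CompleteSpace H]
  {x : (H →L[ℂ] H) × (H →L[ℂ] H)} {N : Set ((H →L[ℂ] H) × (H →L[ℂ] H))}

theorem exists_isFlattening_gam_of_isCompactOperator [SeparableSpace H]
    (hx : x ∈ Gam H) (hc : IsCompactOperator ((1 - x.2) * x.1 : H →L[ℂ] H)) :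
    ∃ φ, IsFlattening (Gam H) (projPairs H) x φ (idealCorner x.1 x.2 (compacts H))
      ((corner x.1).prod (corner x.2)) := by
  have hchart := isFlattening_pairChart hx.1.1 hx.1.2 (J := compacts H)
    isClosed_setOfPred_isCompactOperator (fun a _ hf => IsCompactOperator.clm_comp hf a)
    (fun a _ hf => IsCompactOperator.comp_clm hf a) hc
  obtain ⟨U, hU, hUo, hxU⟩ := eventually_nhds_iff.1 (eventually_mem_gam_iff hx.1.1 hx.1.2 hc hx.2)
  exact ⟨_, hchart.restrOpen hUo hxU
    (fun y hy => ⟨fun h => ⟨h.1, (hU y hy h.1).1 h⟩, fun h => (hU y hy h.1).2 h.2⟩)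
    fun y _ => Iff.rfl⟩

variable (H) in
/-- The flip of `B(H) × B(H)`, under which `Γ` and `P(H) × P(H)` are invariant. -/
def flip : ((H →L[ℂ] H) × (H →L[ℂ] H)) ≃L[ℝ] (H →L[ℂ] H) × (H →L[ℂ] H) :=
  ContinuousLinearEquiv.prodComm ℝ _ _

theorem flip_preimage_gam : flip H ⁻¹' Gam H = Gam H :=
  Set.ext fun _ => swap_mem_gam

theorem flip_preimage_projPairs : flip H ⁻¹' projPairs H = projPairs H :=
  Set.ext fun _ => swap_mem_projPairs

theorem exists_isFlattening_gam [SeparableSpace H] (hx : x ∈ Gam H) :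
    ∃ φ F G, IsFlattening (Gam H) (projPairs H) x φ F G := by
  rcases isCompactOperator_or_of_not_hasCommonComplement hx.1.1 hx.1.2 hx.2 with hc | hc
  · obtain ⟨φ, hφ⟩ := exists_isFlattening_gam_of_isCompactOperator hx hc
    exact ⟨φ, _, _, hφ⟩
  · obtain ⟨φ, hφ⟩ :=
      exists_isFlattening_gam_of_isCompactOperator (x := x.swap) (swap_mem_gam.2 hx) hc
    have h := hφ.preimage (flip H)
    rw [flip_preimage_gam, flip_preimage_projPairs] at h
    exact ⟨_, _, _, h⟩

theorem isSubmanifoldOf_gam [SeparableSpace H] (hN : N = Set.univ ∨ N = projPairs H) :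
    IsSubmanifoldOf (Gam H) N := by
  have h : IsSubmanifoldOf (Gam H) (projPairs H) :=
    ⟨fun x hx => hx.1, fun x hx => exists_isFlattening_gam hx⟩
  rcases hN with rfl | rfl
  exacts [h.univ, h]

theorem isSubmanifoldOf_piece [SeparableSpace H] (hN : N = Set.univ ∨ N = projPairs H)
    (a : PieceIndex) : IsSubmanifoldOf (piece H a) N := by
  obtain ⟨U, hU, h⟩ := exists_isOpen_piece_eq (H := H) a
  rw [h]
  exact (isSubmanifoldOf_gam hN).inter_isOpen hU

end CommonCompl

/-! ### Complements of spaces of compact operators -/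

namespace CommonCompl

open scoped lp ENNReal

section AlmostDisjoint

/-- The indicator of a set of natural numbers, as a bounded sequence. -/
def ind (A : Set ℕ) : ℓ^∞(ℕ, ℂ) :=
  ⟨A.indicator 1, memℓp_infty ⟨1, by
    rintro _ ⟨n, rfl⟩
    exact (norm_indicator_le_norm_self _ _).trans (by simp)⟩⟩

theorem ind_apply (A : Set ℕ) (n : ℕ) : ind A n = A.indicator 1 n := rfl

/-- The set of codes of the finite initial segments of `α`. Distinct sequences share only finitely
many initial segments, so these sets form an uncountable almost disjoint family. -/
def branch (α : ℕ → Bool) : Set ℕ :=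
  Set.range fun n => Encodable.encode ((List.range n).map α)

theorem infinite_branch (α : ℕ → Bool) : (branch α).Infinite := by
  refine Set.infinite_range_of_injective fun m n h => ?_
  simpa using congrArg List.length (Encodable.encode_injective h)

theorem finite_branch_inter {α β : ℕ → Bool} (h : α ≠ β) : (branch α ∩ branch β).Finite := by
  obtain ⟨k, hk⟩ := Function.ne_iff.1 h
  refine ((Set.finite_Iic k).image
    fun n => Encodable.encode ((List.range n).map α)).subset ?_
  rintro _ ⟨⟨n, rfl⟩, ⟨m, hm⟩⟩
  refine ⟨n, Set.mem_Iic.2 (not_lt.1 fun hlt => ?_), rfl⟩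
  have hmap := Encodable.encode_injective hm
  obtain rfl : m = n := by simpa using congrArg List.length hmap
  exact hk (List.map_inj_left.1 hmap k (List.mem_range.2 hlt)).symm

variable {ι : Type*} {B : ι → Set ℕ} (g : ℓ^∞(ℕ, ℂ) →L[ℝ] ℝ)

theorem sum_abs_apply_ind_le_of_pairwiseDisjoint {s : Finset ι}
    (hB : (s : Set ι).PairwiseDisjoint B) : ∑ i ∈ s, |g (ind (B i))| ≤ ‖g‖ := by
  set b : ℓ^∞(ℕ, ℂ) := ∑ i ∈ s, (SignType.sign (g (ind (B i))) : ℝ) • ind (B i) with hb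
  have hbn (n : ℕ) :
      b n = ∑ i ∈ s, (SignType.sign (g (ind (B i))) : ℝ) • (B i).indicator (1 : ℕ → ℂ) n := by
    rw [hb, lp.coeFn_sum, Finset.sum_apply]
    rfl
  have hnorm : ‖b‖ ≤ 1 := by
    refine lp.norm_le_of_forall_le zero_le_one fun n => ?_
    rw [hbn]
    by_cases hn : ∃ i ∈ s, n ∈ B i
    · obtain ⟨i, hi, hni⟩ := hn
      rw [Finset.sum_eq_single_of_mem i hi fun j hj hji => by
        rw [Set.indicator_of_notMem (Set.disjoint_right.1 (hB hj hi hji) hni), smul_zero],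
        Set.indicator_of_mem hni, norm_smul, Pi.one_apply, norm_one, mul_one]
      rcases SignType.sign (g (ind (B i))) with _ | _ | _ <;> simp
    · push Not at hn
      rw [Finset.sum_eq_zero fun i hi => by rw [Set.indicator_of_notMem (hn i hi), smul_zero],
        norm_zero]
      exact zero_le_one
  calc ∑ i ∈ s, |g (ind (B i))| = g b := by
        simp only [hb, map_sum, map_smul, smul_eq_mul, sign_mul_self]
    _ ≤ ‖g b‖ := le_abs_self _
    _ ≤ ‖g‖ := g.unit_le_opNorm b hnorm

variable {Y : Type*} [NormedAddCommGroup Y] [NormedSpace ℝ Y] {L : ℓ^∞(ℕ, ℂ) →L[ℝ] Y}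

theorem apply_ind_sdiff (hL : ∀ a : ℓ^∞(ℕ, ℂ), {n | a n ≠ 0}.Finite → L a = 0) (A : Set ℕ)
    {D : Set ℕ} (hD : D.Finite) : L (ind (A \ D)) = L (ind A) := by
  rw [eq_comm, ← sub_eq_zero, ← map_sub]
  refine hL _ (hD.subset fun n hn => by_contra fun hnD => hn ?_)
  have hind : (A \ D).indicator (1 : ℕ → ℂ) n = A.indicator 1 n := by
    classical simp only [Set.indicator_apply, Set.mem_sdiff, hnD, not_false_eq_true, and_true]
  rw [lp.coeFn_sub, Pi.sub_apply, ind_apply, ind_apply, hind, sub_self]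

variable {g}

theorem sum_abs_apply_ind_le (hB : Pairwise fun i j => (B i ∩ B j).Finite)
    (hg : ∀ a : ℓ^∞(ℕ, ℂ), {n | a n ≠ 0}.Finite → g a = 0) (s : Finset ι) :
    ∑ i ∈ s, |g (ind (B i))| ≤ ‖g‖ := by
  set D : Set ℕ := ⋃ i ∈ s, ⋃ j ∈ s, ⋃ (_ : i ≠ j), B i ∩ B j with hD
  have hDfin : D.Finite :=
    .biUnion s.finite_toSet fun i _ => .biUnion s.finite_toSet fun j _ =>
      Set.finite_iUnion fun hij => hB hij
  have hdisj : (s : Set ι).PairwiseDisjoint fun i => B i \ D := by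
    refine fun i hi j hj hij => Set.disjoint_left.2 fun n hni hnj => hni.2 ?_
    simp only [hD, Set.mem_iUnion]
    exact ⟨i, hi, j, hj, hij, hni.1, hnj.1⟩
  simpa only [apply_ind_sdiff hg _ hDfin] using sum_abs_apply_ind_le_of_pairwiseDisjoint g hdisj

theorem countable_support_apply_ind (hB : Pairwise fun i j => (B i ∩ B j).Finite)
    (hg : ∀ a : ℓ^∞(ℕ, ℂ), {n | a n ≠ 0}.Finite → g a = 0) :
    {i | g (ind (B i)) ≠ 0}.Countable := by
  have h := (summable_of_sum_le (fun i => abs_nonneg (g (ind (B i))))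
    (sum_abs_apply_ind_le hB hg)).countable_support
  simpa only [Function.support, abs_ne_zero] using h

/-- Whitley's argument for Phillips' theorem that `c₀` is not complemented in `ℓ^∞`. -/
theorem exists_infinite_apply_ind_eq_zero {κ : Type*} [Countable κ] (f : κ → Y →L[ℝ] ℝ)
    (hf : ∀ v, (∀ k, f k v = 0) → v = 0)
    (hL : ∀ a : ℓ^∞(ℕ, ℂ), {n | a n ≠ 0}.Finite → L a = 0) :
    ∃ A : Set ℕ, A.Infinite ∧ L (ind A) = 0 := by
  have hcount : (⋃ k, {α | f k (L (ind (branch α))) ≠ 0}).Countable :=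
    Set.countable_iUnion fun k => countable_support_apply_ind (g := (f k).comp L)
      (fun _ _ => finite_branch_inter) fun a ha => by
        rw [ContinuousLinearMap.comp_apply, hL a ha, map_zero]
  obtain ⟨α, hα⟩ : ∃ α, α ∉ ⋃ k, {α | f k (L (ind (branch α))) ≠ 0} := by
    by_contra! h
    rw [Set.eq_univ_of_forall h, Set.countable_univ_iff] at hcount
    obtain ⟨e, he⟩ := exists_surjective_nat (ℕ → Bool)
    obtain ⟨n, hn⟩ := he fun n => !(e n n)
    simpa using congrFun hn n
  refine ⟨branch α, infinite_branch α, hf _ fun k => by_contra fun hk => hα ?_⟩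
  exact Set.mem_iUnion.2 ⟨k, hk⟩

end AlmostDisjoint

section Diagonal

/-- The diagonal operators on `ℓ²`. -/
def diag : ℓ^∞(ℕ, ℂ) →L[ℂ] ℓ²(ℕ, ℂ) →L[ℂ] ℓ²(ℕ, ℂ) :=
  lp.holderL 2 (fun _ => ContinuousLinearMap.mul ℂ ℂ) (K := 1) fun _ => by simp

theorem diag_apply (a : ℓ^∞(ℕ, ℂ)) (v : ℓ²(ℕ, ℂ)) (n : ℕ) : diag a v n = a n * v n := rfl

theorem diag_single (a : ℓ^∞(ℕ, ℂ)) (n : ℕ) :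
    diag a (lp.single 2 n 1) = a n • lp.single 2 n (1 : ℂ) := by
  ext m
  rw [diag_apply, lp.coeFn_smul, Pi.smul_apply, smul_eq_mul]
  by_cases h : m = n
  · rw [h]
  · simp [lp.single_apply, h]

theorem isCompactOperator_diag {a : ℓ^∞(ℕ, ℂ)} (ha : {n | a n ≠ 0}.Finite) :
    IsCompactOperator (diag a) := by
  let K : Submodule ℂ ℓ²(ℕ, ℂ) :=
    Submodule.span ℂ ((fun n => lp.single 2 n (1 : ℂ)) '' {n | a n ≠ 0})
  have : FiniteDimensional ℂ K := FiniteDimensional.span_of_finite ℂ (ha.image _)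
  refine isCompactOperator_of_finiteDimensional_range
    (Submodule.finiteDimensional_of_le (S₂ := K) ?_)
  rintro _ ⟨v, rfl⟩
  have hsum : diag a v = ∑ n ∈ ha.toFinset, (a n * v n) • lp.single 2 n (1 : ℂ) := by
    ext m
    rw [diag_apply, lp.coeFn_sum, Finset.sum_apply]
    rw [Finset.sum_eq_single m (fun n _ hnm => by simp [lp.single_apply, hnm.symm]) fun hm => by
      simp [not_not.1 (mt ha.mem_toFinset.2 hm)]]
    simp
  exact hsum ▸ K.sum_mem fun n hn => K.smul_mem _
    (Submodule.subset_span ⟨n, ha.mem_toFinset.1 hn, rfl⟩)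

theorem not_isCompactOperator_of_orthonormal {X Y : Type*} [NormedAddCommGroup X]
    [InnerProductSpace ℂ X] [NormedAddCommGroup Y] [InnerProductSpace ℂ Y] (T : X →L[ℂ] Y)
    {e : ℕ → X} (he : ∀ n, ‖e n‖ ≤ 1) (hT : Orthonormal ℂ fun n => T (e n)) :
    ¬ IsCompactOperator T := by
  intro hc
  obtain ⟨K, hK, hsub⟩ :=
    IsCompactOperator.image_closedBall_subset_compact (f := (T : X →ₗ[ℂ] Y)) hc 1
  have hmem (n : ℕ) : T (e n) ∈ K := hsub ⟨e n, mem_closedBall_zero_iff.2 (he n), rfl⟩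
  obtain ⟨_, -, σ, hσ, hlim⟩ := hK.tendsto_subseq hmem
  obtain ⟨N, hN⟩ := Metric.cauchySeq_iff'.1 hlim.cauchySeq 1 one_pos
  have hlt : ‖T (e (σ (N + 1))) - T (e (σ N))‖ < 1 := by
    simpa only [dist_eq_norm, Function.comp_apply] using hN (N + 1) N.le_succ
  have hsq : ‖T (e (σ (N + 1))) - T (e (σ N))‖ ^ 2 = 2 := by
    rw [@norm_sub_sq ℂ, hT.2 (hσ N.lt_succ_self).ne', hT.1, hT.1]
    norm_num
  nlinarith [norm_nonneg (T (e (σ (N + 1))) - T (e (σ N)))]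

theorem not_isCompactOperator_diag_ind {A : Set ℕ} (hA : A.Infinite) :
    ¬ IsCompactOperator (diag (ind A)) := by
  let σ := hA.natEmbedding
  let b : HilbertBasis ℕ ℂ ℓ²(ℕ, ℂ) := .ofRepr (.refl ℂ _)
  have hdiag (n : ℕ) : diag (ind A) (b (σ n)) = b (σ n) := by
    have hb : b (σ n) = lp.single 2 (σ n : ℕ) (1 : ℂ) := b.repr_self _
    rw [hb, diag_single, ind_apply, Set.indicator_of_mem (σ n).2, Pi.one_apply, one_smul]
  refine not_isCompactOperator_of_orthonormal _ (fun n => (b.orthonormal.1 (σ n)).le) ?_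
  simp only [hdiag]
  exact b.orthonormal.comp (fun n => (σ n : ℕ)) (Subtype.val_injective.comp σ.injective)

end Diagonal
end CommonCompl

namespace CommonCompl

open TopologicalSpace ProjChart BanachSub ContinuousLinearMap
open scoped lp InnerProductSpace ENNReal

section Separation

variable (H : Type*) [NormedAddCommGroup H] [InnerProductSpace ℂ H] [SeparableSpace H]

theorem exists_countable_separating_apply :
    ∃ g : ℕ × ℕ → (H →L[ℂ] H) →L[ℝ] ℂ, ∀ T, (∀ n, g n T = 0) → T = 0 := by
  let d := denseSeq H
  have hd : DenseRange d := denseRange_denseSeq H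
  refine ⟨fun n => ((innerSL ℂ (d n.1)).comp
    (ContinuousLinearMap.apply ℂ H (d n.2))).restrictScalars ℝ, fun T hT => ?_⟩
  have hinner (j : ℕ) : (fun y => ⟪y, T (d j)⟫_ℂ) = fun _ => 0 :=
    hd.equalizer (by fun_prop) continuous_const (funext fun i => hT (i, j))
  exact DFunLike.coe_injective <| hd.equalizer T.continuous continuous_const <|
    funext fun j => inner_self_eq_zero.1 (congrFun (hinner j) (T (d j)))

theorem exists_countable_separating :
    ∃ f : (ℕ × ℕ) × Bool × Bool → ((H →L[ℂ] H) × (H →L[ℂ] H)) →L[ℝ] ℝ,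
      ∀ v, (∀ i, f i v = 0) → v = 0 := by
  obtain ⟨g, hg⟩ := exists_countable_separating_apply H
  refine ⟨fun i => ((if i.2.1 then Complex.reCLM else Complex.imCLM).comp (g i.1)).comp
    (if i.2.2 then .fst ℝ _ _ else .snd ℝ _ _), fun v hv => Prod.ext ?_ ?_⟩
  · exact hg _ fun n => Complex.ext (hv (n, true, true)) (hv (n, false, true))
  · exact hg _ fun n => Complex.ext (hv (n, true, false)) (hv (n, false, false))

end Separation

variable {H : Type*} [NormedAddCommGroup H] [InnerProductSpace ℂ H] [CompleteSpace H]

theorem isCompactOperator_comp_comp_adjoint_iff {K : Type*} [NormedAddCommGroup K]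
    [InnerProductSpace ℂ K] [CompleteSpace K] (U V : K →ₗᵢ[ℂ] H) {T : K →L[ℂ] K} :
    IsCompactOperator (V.toContinuousLinearMap ∘L T ∘L adjoint U.toContinuousLinearMap) ↔
      IsCompactOperator T := by
  refine ⟨fun h => ?_, fun h => (h.comp_clm (adjoint U.toContinuousLinearMap)).clm_comp
    V.toContinuousLinearMap⟩
  have hcomp := (h.comp_clm U.toContinuousLinearMap).clm_comp (adjoint V.toContinuousLinearMap)
  have hU := DFunLike.congr_fun U.adjoint_comp_self
  have hV := DFunLike.congr_fun V.adjoint_comp_self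
  have hT : ⇑T = adjoint V.toContinuousLinearMap ∘
      (V.toContinuousLinearMap ∘L T ∘L adjoint U.toContinuousLinearMap) ∘
        U.toContinuousLinearMap :=
    funext fun v => ((hV (T _)).trans (congrArg T (hU v))).symm
  rwa [hT]

theorem exists_linearIsometry_of_dim_eq_top [SeparableSpace H] {S : Submodule ℂ H}
    [CompleteSpace S] (hS : dim S = ⊤) :
    ∃ U : ℓ²(ℕ, ℂ) →ₗᵢ[ℂ] H, ∀ v, U v ∈ S := by
  obtain ⟨b⟩ := nonempty_hilbertBasis_nat (dim_eq_top_iff.1 hS)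
  exact ⟨S.subtypeₗᵢ.comp b.repr.symm.toLinearIsometry, fun v => (b.repr.symm v).2⟩

variable {P Q : H →L[ℂ] H}

theorem exists_clm_isCompactOperator_iff [SeparableSpace H] (hP : IsStarProjection P)
    (hQ : IsStarProjection Q) (hdP : dim P.range = ⊤) (hdQ : dim Q.rangeᗮ = ⊤) :
    ∃ X : ℓ^∞(ℕ, ℂ) →L[ℂ] H →L[ℂ] H, ∀ a, X a * P = X a ∧ (1 - Q) * X a = X a ∧
      (IsCompactOperator (X a) ↔ IsCompactOperator (diag a)) := by
  have := (ContinuousLinearMap.IsIdempotentElem.isClosed_range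
    hP.isIdempotentElem).completeSpace_coe
  obtain ⟨U, hU⟩ := exists_linearIsometry_of_dim_eq_top hdP
  obtain ⟨V, hV⟩ := exists_linearIsometry_of_dim_eq_top hdQ
  have hUP : adjoint U.toContinuousLinearMap ∘L P = adjoint U.toContinuousLinearMap := by
    have hPU : P ∘L U.toContinuousLinearMap = U.toContinuousLinearMap :=
      ContinuousLinearMap.ext fun v => (mem_range_iff hP.isIdempotentElem).1 (hU v)
    rw [← isSelfAdjoint_iff'.1 hP.isSelfAdjoint, ← adjoint_comp, hPU]
  have hQV : (1 - Q) ∘L V.toContinuousLinearMap = V.toContinuousLinearMap :=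
    ContinuousLinearMap.ext fun v => by
      change V v - Q (V v) = V v
      rw [(mem_orthogonal_iff hQ).1 (hV v), sub_zero]
  refine ⟨postcomp H V.toContinuousLinearMap ∘L
    precomp ℓ²(ℕ, ℂ) (adjoint U.toContinuousLinearMap) ∘L diag, fun a => ⟨?_, ?_, ?_⟩⟩
  · exact congrArg (V.toContinuousLinearMap ∘L diag a ∘L ·) hUP
  · exact congrArg (· ∘L diag a ∘L adjoint U.toContinuousLinearMap) hQV
  · exact isCompactOperator_comp_comp_adjoint_iff U V

theorem exists_clm_mem_idealCorner_iff [SeparableSpace H] (hP : IsStarProjection P)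
    (hQ : IsStarProjection Q) (hdP : dim P.range = ⊤) (hdQ : dim Q.rangeᗮ = ⊤)
    (hc : IsCompactOperator ((1 - Q) * P : H →L[ℂ] H)) :
    ∃ W : ℓ^∞(ℕ, ℂ) →L[ℝ] (corner P).prod (corner Q), ∀ a,
      (W a : (H →L[ℂ] H) × (H →L[ℂ] H)) ∈ idealCorner P Q (compacts H) ↔
        IsCompactOperator (diag a) := by
  obtain ⟨X, hX⟩ := exists_clm_isCompactOperator_iff hP hQ hdP hdQ
  have hmem (a) : (cornerMap P (X a), (0 : H →L[ℂ] H)) ∈ (corner P).prod (corner Q) :=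
    ⟨cornerMap_mem_corner hP.isIdempotentElem _, zero_mem _⟩
  refine ⟨((cornerMap P ∘L X.restrictScalars ℝ).prod 0).codRestrict _ hmem, fun a => ?_⟩
  obtain ⟨hXP, hQX, hXa⟩ := hX a
  have hcorner : (1 - Q) * cornerMap P (X a) = X a - (1 - Q) * P * X a := by
    rw [cornerMap_apply, mul_assoc, hXP, sub_mul 1 P, one_mul, mul_sub, hQX, mul_assoc]
  have hcX : (1 - Q) * P * X a ∈ compacts H := hc.comp_clm (X a)
  rw [← hXa, mem_idealCorner]
  refine (and_iff_right (hmem a)).trans ?_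
  change (1 - Q) * cornerMap P (X a) ∈ compacts H ↔ X a ∈ compacts H
  rw [hcorner]
  exact (compacts H).sub_mem_iff_left hcX

variable {x : (H →L[ℂ] H) × (H →L[ℂ] H)} {N : Set ((H →L[ℂ] H) × (H →L[ℂ] H))}

theorem not_exists_projection_idealCorner [SeparableSpace H] (hx : x ∈ GamInfInf H)
    (hc : IsCompactOperator ((1 - x.2) * x.1 : H →L[ℂ] H)) :
    ¬ ∃ π : (corner x.1).prod (corner x.2) →L[ℝ] (H →L[ℂ] H) × (H →L[ℂ] H),
      (∀ v, π v ∈ idealCorner x.1 x.2 (compacts H)) ∧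
      ∀ v : (corner x.1).prod (corner x.2),
        (v : (H →L[ℂ] H) × (H →L[ℂ] H)) ∈ idealCorner x.1 x.2 (compacts H) → π v = v := by
  rintro ⟨π, hmem, hπ⟩
  obtain ⟨W, hW⟩ :=
    exists_clm_mem_idealCorner_iff hx.1.1.1 hx.1.1.2 hx.2.1.2.1 hx.2.2.2.2 hc
  obtain ⟨f, hf⟩ := exists_countable_separating H
  obtain ⟨A, hA, hA0⟩ := exists_infinite_apply_ind_eq_zero
    (L := ((corner x.1).prod (corner x.2)).subtypeL ∘L W - π ∘L W) f hf fun a ha =>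
      sub_eq_zero.2 (hπ _ ((hW a).2 (isCompactOperator_diag ha))).symm
  have hfix : (W (ind A) : (H →L[ℂ] H) × (H →L[ℂ] H)) = π (W (ind A)) := sub_eq_zero.1 hA0
  exact not_isCompactOperator_diag_ind hA ((hW _).1 (hfix ▸ hmem _))

theorem not_isComplementedAt_gam_of_isCompactOperator [SeparableSpace H]
    (hN : N = Set.univ ∨ N = projPairs H) (hx : x ∈ GamInfInf H)
    (hc : IsCompactOperator ((1 - x.2) * x.1 : H →L[ℂ] H)) :
    ¬ IsComplementedAt (Gam H) N x := by
  intro hcomp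
  obtain ⟨φ, hφ⟩ := exists_isFlattening_gam_of_isCompactOperator hx.1 hc
  refine not_exists_projection_idealCorner hx hc ?_
  rcases hN with rfl | rfl
  · obtain ⟨π, hmem, hπ⟩ := hcomp.exists_projection hx.1 (Set.subset_univ _) hφ.univ
    exact ⟨π ∘L (Submodule.subtypeL _).codRestrict ⊤ fun _ => trivial, fun v => hmem _,
      fun v hv => hπ _ hv⟩
  · exact hcomp.exists_projection hx.1 (fun y hy => hy.1) hφ

theorem not_isComplementedAt_gam [SeparableSpace H] (hN : N = Set.univ ∨ N = projPairs H)
    (hx : x ∈ GamInfInf H) : ¬ IsComplementedAt (Gam H) N x := by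
  rcases isCompactOperator_or_of_not_hasCommonComplement hx.1.1.1 hx.1.1.2 hx.1.2 with hc | hc
  · exact not_isComplementedAt_gam_of_isCompactOperator hN hx hc
  · intro hcomp
    have h := hcomp.preimage (flip H)
    rw [flip_preimage_gam] at h
    have hN' : flip H ⁻¹' N = Set.univ ∨ flip H ⁻¹' N = projPairs H := by
      rcases hN with rfl | rfl
      exacts [.inl Set.preimage_univ, .inr flip_preimage_projPairs]
    exact not_isComplementedAt_gam_of_isCompactOperator hN' (swap_mem_gamInfInf.2 hx) hc h

theorem not_isComplementedAt_piece [SeparableSpace H] (hN : N = Set.univ ∨ N = projPairs H)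
    (a : PieceIndex) (hx : x ∈ GamInfInf H) (hxa : x ∈ piece H a) :
    ¬ IsComplementedAt (Gam H) N x ∧ ¬ IsComplementedAt (piece H a) N x := by
  refine ⟨not_isComplementedAt_gam hN hx, fun h => not_isComplementedAt_gam hN hx ?_⟩
  obtain ⟨U, hU, hpiece⟩ := exists_isOpen_piece_eq (H := H) a
  rw [hpiece] at hxa h
  exact h.congr hU hxa.2 fun y hy => (and_iff_left hy).symm

end CommonCompl

/-! ### A point of `Γ_{∞,∞}` -/

namespace CommonCompl

open TopologicalSpace

variable {H : Type*} [NormedAddCommGroup H] [InnerProductSpace ℂ H] {b : ℕ → H}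

/-- The closed span of the vectors `b n` with `n ∈ A`. -/
def coordSubspace (b : ℕ → H) (A : Set ℕ) : Submodule ℂ H :=
  (Submodule.span ℂ (b '' A)).topologicalClosure

instance [CompleteSpace H] (b : ℕ → H) (A : Set ℕ) : CompleteSpace (coordSubspace b A) :=
  (Submodule.isClosed_topologicalClosure _).completeSpace_coe

theorem mem_coordSubspace (b : ℕ → H) {A : Set ℕ} {n : ℕ} (hn : n ∈ A) :
    b n ∈ coordSubspace b A :=
  Submodule.le_topologicalClosure _ (Submodule.subset_span ⟨n, hn, rfl⟩)

theorem mem_orthogonal_coordSubspace (hb : Orthonormal ℂ b) {A : Set ℕ} {n : ℕ} (hn : n ∉ A) :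
    b n ∈ (coordSubspace b A)ᗮ := by
  have hspan : Submodule.span ℂ (b '' A) ≤ (ℂ ∙ b n)ᗮ := by
    refine Submodule.span_le.2 ?_
    rintro _ ⟨m, hm, rfl⟩
    exact Submodule.mem_orthogonal_singleton_iff_inner_right.2
      (hb.2 fun hnm => hn (hnm ▸ hm))
  rw [coordSubspace, Submodule.orthogonal_closure]
  exact (Submodule.mem_orthogonal' _ _).2 fun u hu =>
    Submodule.mem_orthogonal_singleton_iff_inner_right.1 (hspan hu)

theorem coordSubspace_lt (hb : Orthonormal ℂ b) {A B : Set ℕ} (h : A ⊂ B) :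
    coordSubspace b A < coordSubspace b B := by
  obtain ⟨hAB, n, hnB, hnA⟩ := Set.ssubset_iff_exists.1 h
  refine SetLike.lt_iff_le_and_exists.2
    ⟨Submodule.topologicalClosure_mono (Submodule.span_mono (Set.image_mono hAB)), b n,
      mem_coordSubspace b hnB, fun hn => hb.ne_zero n ?_⟩
  exact inner_self_eq_zero.1 (mem_orthogonal_coordSubspace hb hnA _ hn)

theorem dim_eq_top_of_orthonormal (hb : Orthonormal ℂ b) {A : Set ℕ} (hA : A.Infinite)
    {S : Submodule ℂ H} (hS : ∀ n ∈ A, b n ∈ S) : dim S = ⊤ := by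
  refine dim_eq_top_iff.2 fun _ => ?_
  have hli : LinearIndependent ℂ fun n : A => (⟨b n, hS n n.2⟩ : S) :=
    LinearIndependent.of_comp S.subtype (hb.linearIndependent.comp _ Subtype.val_injective)
  have := hli.finite
  exact hA (Set.toFinite A)

theorem starProjection_coordSubspace_mem_projOfRank [CompleteSpace H] (hb : Orthonormal ℂ b)
    {A : Set ℕ} (hA : A.Infinite) (hA' : Aᶜ.Infinite) :
    (coordSubspace b A).starProjection ∈ projOfRank H ⊤ ⊤ := by
  refine ⟨isStarProjection_starProjection, ?_, ?_⟩ <;> rw [Submodule.range_starProjection]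
  exacts [dim_eq_top_of_orthonormal hb hA fun n => mem_coordSubspace b,
    dim_eq_top_of_orthonormal hb hA' fun n => mem_orthogonal_coordSubspace hb]

theorem not_hasCommonComplement_of_lt {S T : Submodule ℂ H} (h : T < S) :
    ¬ HasCommonComplement S T := by
  rintro ⟨Z, -, hS, hT⟩
  refine h.ne (eq_of_le_of_inf_le_of_sup_le h.le (z := Z) ?_ ?_)
  · exact hS.inf_eq_bot.trans_le bot_le
  · exact le_top.trans_eq hT.sup_eq_top.symm

theorem gamInfInf_nonempty [CompleteSpace H] [SeparableSpace H] (h : ¬ FiniteDimensional ℂ H) :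
    (GamInfInf H).Nonempty := by
  obtain ⟨b⟩ := nonempty_hilbertBasis_nat h
  let A : Set ℕ := {n | Even n}
  let B : Set ℕ := A \ {0}
  have hBA : B ⊂ A := Set.sdiff_singleton_ssubset.2 Even.zero
  have hA : A.Infinite := Set.infinite_of_injective_forall_mem (f := fun n => 2 * n)
    (mul_right_injective₀ two_ne_zero) even_two_mul
  have hA' : Aᶜ.Infinite := Set.infinite_of_injective_forall_mem (f := fun n => 2 * n + 1)
    (fun m n hmn => by simpa using hmn) Nat.not_even_two_mul_add_one
  refine ⟨((coordSubspace b A).starProjection, (coordSubspace b B).starProjection),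
    ⟨⟨isStarProjection_starProjection, isStarProjection_starProjection⟩, ?_⟩,
    starProjection_coordSubspace_mem_projOfRank b.orthonormal hA hA',
    starProjection_coordSubspace_mem_projOfRank b.orthonormal
      (hA.sdiff (Set.finite_singleton 0)) (hA'.mono (Set.compl_subset_compl.2 hBA.subset))⟩
  rw [Submodule.range_starProjection, Submodule.range_starProjection]
  exact not_hasCommonComplement_of_lt (coordSubspace_lt b.orthonormal hBA)

end CommonCompl

end

theorem mainTheorem4 (H : Type*) [NormedAddCommGroup H] [InnerProductSpace ℂ H] [CompleteSpace H]
    [TopologicalSpace.SeparableSpace H] :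
    -- `Γ` is closed in `B(H) × B(H)`
    IsClosed (CommonCompl.Gam H) ∧
    -- `Γ` is the disjoint union of its pieces, each of which is relatively open in `Γ`
    CommonCompl.Gam H = (⋃ a, CommonCompl.piece H a) ∧
    Pairwise (fun a b => Disjoint (CommonCompl.piece H a) (CommonCompl.piece H b)) ∧
    (∀ a, ∃ U : Set ((H →L[ℂ] H) × (H →L[ℂ] H)), IsOpen U ∧
      CommonCompl.piece H a = CommonCompl.Gam H ∩ U) ∧
    -- both in `B(H) × B(H)` and in `P(H) × P(H)`:
    (∀ N ∈ ({Set.univ, CommonCompl.projPairs H} : Set (Set ((H →L[ℂ] H) × (H →L[ℂ] H)))),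
      -- `Γ` and each of its pieces are `C^∞` submanifolds
      BanachSub.IsSubmanifoldOf (CommonCompl.Gam H) N ∧
      (∀ a, BanachSub.IsSubmanifoldOf (CommonCompl.piece H a) N) ∧
      -- which are not complemented at any point of the pieces `Γ_1^n`, `Γ_∞^l`, `Γ_∞^r`
      (∀ n : ℤ, n ≠ 0 → ∀ x ∈ CommonCompl.Gam1n H n,
        ¬ BanachSub.IsComplementedAt (CommonCompl.Gam H) N x ∧
        ¬ BanachSub.IsComplementedAt (CommonCompl.Gam1n H n) N x) ∧
      (∀ x ∈ CommonCompl.GamInfL H,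
        ¬ BanachSub.IsComplementedAt (CommonCompl.Gam H) N x ∧
        ¬ BanachSub.IsComplementedAt (CommonCompl.GamInfL H) N x) ∧
      (∀ x ∈ CommonCompl.GamInfR H,
        ¬ BanachSub.IsComplementedAt (CommonCompl.Gam H) N x ∧
        ¬ BanachSub.IsComplementedAt (CommonCompl.GamInfR H) N x) ∧
      -- so that `Γ` is not a complemented submanifold if `H` is infinite-dimensional
      (¬ FiniteDimensional ℂ H →
        ∃ x ∈ CommonCompl.Gam H, ¬ BanachSub.IsComplementedAt (CommonCompl.Gam H) N x)) := by
  refine ⟨CommonCompl.isClosed_gam, CommonCompl.gam_eq_iUnion, CommonCompl.pairwise_disjoint_piece,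
    CommonCompl.exists_isOpen_piece_eq, fun N hN => ?_⟩
  refine ⟨CommonCompl.isSubmanifoldOf_gam hN, CommonCompl.isSubmanifoldOf_piece hN, ?_, ?_, ?_, ?_⟩
  · exact fun n hn x hx => CommonCompl.not_isComplementedAt_piece hN (.fredholm n hn) hx.1.1 hx
  · exact fun x hx => CommonCompl.not_isComplementedAt_piece hN .left hx.1 hx
  · exact fun x hx => CommonCompl.not_isComplementedAt_piece hN .right hx.1 hx
  · intro h
    obtain ⟨x, hx⟩ := CommonCompl.gamInfInf_nonempty h
    exact ⟨x, hx.1, CommonCompl.not_isComplementedAt_gam hN hx⟩
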